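/- Throughout, $\mathsf{Z}_2$ denotes full classical second-order arithmetic (basic arithmetic, induction, comprehension for all second-order formulas) together with the choice schemes $\Sigma^1_\infty\text{-}\mathsf{AC}$ and $\Sigma^1_\infty\text{-}\mathsf{DC}$; it proves a sentence iff the sentence is true in all (Henkin) models. **Definitions (inside $\mathsf{Z}_2$).** Write $ab\simeq c$ for application $\{a\}(b)=c$ in Kleene's first algebra, $\mathbf{p}xy$ for a bijective pairing of numbers with projections $(x)_0,(x)_1$, and $\langle a_0,\dots,a_{n-1}\rangle$ for codes of finite sequences. A tree is a set of finite sequences that contains $\langle\rangle$ and is closed under initial segments; it is well-founded if it has no infinite path. Put $S\downarrow a=\{\sigma\mid\langle a\rangle^\frown\sigma\in S\}$ and $\operatorname{immd}(S)=\{a\mid\langle a\rangle\in S\}$. *Realizability.* Formulas of set theory have primitive bounded quantifiers. The relation $e\Vdash\phi$, for $\phi$ with well-founded trees as parameters, is defined by: - $e\not\Vdash\bot$; - $e\Vdash S\in T$ iff $(e)_0\in\operatorname{immd}(T)$ and $(e)_1\Vdash S=T\downarrow(e)_0$; - $e\Vdash S=T$ iff $(e)_0a\Vdash (S\downarrow a)\in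 T$ for all $a\in\operatorname{immd}(S)$ and $(e)_1b\Vdash (T\downarrow b)\in S$ for all $b\in\operatorname{immd}(T)$; - $e\Vdash\phi\land\psi$ iff $(e)_0\Vdash\phi$ and $(e)_1\Vdash\psi$; - $e\Vdash\phi\lor\psi$ iff $(e)_0=0$ and $(e)_1\Vdash\phi$, or $(e)_0=1$ and $(e)_1\Vdash\psi$; - $e\Vdash\phi\to\psi$ iff for all $f\Vdash\phi$, $ef$ is defined and $ef\Vdash\psi$; - $e\Vdash\forall X\in S\,\phi(X)$ iff $ea\Vdash\phi(S\downarrow a)$ for all $a\in\operatorname{immd}(S)$; - $e\Vdash\exists X\in S\,\phi(X)$ iff $(e)_0\in\operatorname{immd}(S)$ and $(e)_1\Vdash\phi(S\downarrow(e)_0)$; - $e\Vdash\forall X\,\phi(X)$ (resp. $\exists X\,\phi(X)$) iff $e\Vdash\phi(X)$ for every (resp. some) well-founded tree $X$. *Types.* Types, coded by numbers, and their extensions are generated inductively: $\mathsf N$ with $\operatorname{ext}(\mathsf N)=\mathbb N$; $\mathsf N_n$ with $\operatorname{ext}(\mathsf N_n)=\{k\mid k<n\}$; $A+B$ with extension $\{\mathbf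 p0x\mid x\in\operatorname{ext}(A)\}\cup\{\mathbf p1y\mid y\in\operatorname{ext}(B)\}$; and, if $A$ is a type and $Fx$ is a type for all $x\in\operatorname{ext}(A)$, $\prod_{x:A}Fx$ with extension $\{f\mid\forall x\in\operatorname{ext}(A)\ fx\in\operatorname{ext}(Fx)\}$ and $\sum_{x:A}Fx$ with extension $\{\mathbf pxu\mid x\in\operatorname{ext}(A),\,u\in\operatorname{ext}(Fx)\}$. The universe $\mathsf V$ is the least set of numbers such that $\sup(A,f)=(5,A,f)\in\mathsf V$ whenever $A$ is a type and $fx\in\mathsf V$ for all $x\in\operatorname{ext}(A)$. For elements of $\mathsf V$ let $\mathfrak t(\sup(A,f))=\{\langle\rangle\}\cup\{\langle x\rangle^\frown\sigma\mid x\in\operatorname{ext}(A),\ \sigma\in\mathfrak t(fx)\}$, and let $M=\{\langle\rangle\}\cup\{\langle x\rangle^\frown\sigma\mid x\in\mathsf V,\ \sigma\in\mathfrak t(x)\}$. *The theory $T$* is the intuitionistic theory in the language $\langle\in\rangle$ consisting of the axioms of $\mathsf{CZF}$ with full Separation (Extensionality, Pairing, Union, Infinity, $\in$-Induction, Separation,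 Strong Collection and Subset Collection for all formulas) and the assertion that there is a set $M$ satisfying (1)–(6) below, where (3) is required for finitely many bounded formulas at a time (one axiom for every finite list of bounded formulas). **Statement.** $\mathsf{Z}_2$ proves that $M$ is a well-founded tree. For each of the following statements about $M$ (in (3), for each bounded formula $\phi$) there is a number $e$ such that $\mathsf{Z}_2$ proves that $e$ realizes it: 1. $M$ is transitive: $\forall x\in M\,\forall y\in x\,(y\in M)$. 2. Union: $\forall a\in M\,\exists b\in M\,[\forall x\in a\,\forall y\in x\,(y\in b)\land\forall y\in b\,\exists x\in a\,(y\in x)]$. 3. Bounded Separation: $\forall \vec p\in M\,\forall a\in M\,\exists b\in M\,[\forall x\in b\,(x\in a\land\phi(x,\vec p))\land\forall x\in a\,(\phi(x,\vec p)\to x\in b)]$. 4. $\omega\in M$. 5. Second-order Strong Collection: for all $a\in M$ and all sets $R$ with $\forall x\in a\,\exists y\in M\,\langle x,y\rangle\in R$ there is $b\in M$ with $\forall x\in a\,\exists y\in b\,\langle x,y\rangle\in R$ and $\forall y\in b\,\exists x\in a\,\langle x,y\rangle\in R$. 6. Second-order Subset Collection: for all $a,b\in M$ there is $c\in M$ such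 that for all sets $R$ with $\forall x\in a\,\exists y\in b\,\langle x,y\rangle\in R$ there is $d\in c$ with $\forall x\in a\,\exists y\in d\,\langle x,y\rangle\in R$ and $\forall y\in d\,\exists x\in a\,\langle x,y\rangle\in R$. Consequently, for every axiom $\phi$ of $T$ there is a number $e$ such that $\mathsf{Z}_2$ proves $e\Vdash\phi$; and realizability interprets $T$ in $\mathsf{Z}_2$: there is a translation of sentences $\phi$ of set theory into sentences $\phi^*$ of second-order arithmetic, with $\phi^*$ equivalent over $\mathsf Z_2$ to $\exists e\,(e\Vdash\phi)$, such that $\mathsf{Z}_2\vdash\phi^*$ whenever $\phi$ is intuitionistically provable in $T$, and $\mathsf{Z}_2\vdash\neg\bot^*$. -/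

import Mathlib

universe u

/-! ## Second-order arithmetic -/

/-- Number terms of second-order arithmetic in the number variables `0, …, n-1`. -/
inductive SOTerm (n : ℕ) : Type
  | var (i : Fin n) : SOTerm n
  | zero : SOTerm n
  | succ (t : SOTerm n) : SOTerm n
  | add (s t : SOTerm n) : SOTerm n
  | mul (s t : SOTerm n) : SOTerm n

/-- Formulas of second-order arithmetic with free number variables `0, …, n-1` and free set
variables `0, …, m-1`. A number (set) quantifier binds the number variable `n` (the set
variable `m`). The logic is classical, so `⊥`, `→`, `∀` suffice. -/
inductive SOFormula : ℕ → ℕ → Type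
  | eq {n m : ℕ} (s t : SOTerm n) : SOFormula n m
  | lt {n m : ℕ} (s t : SOTerm n) : SOFormula n m
  | mem {n m : ℕ} (t : SOTerm n) (X : Fin m) : SOFormula n m
  | bot {n m : ℕ} : SOFormula n m
  | imp {n m : ℕ} (φ ψ : SOFormula n m) : SOFormula n m
  | allNum {n m : ℕ} (φ : SOFormula (n + 1) m) : SOFormula n m
  | allSet {n m : ℕ} (φ : SOFormula n (m + 1)) : SOFormula n m

/-- Extend an assignment of the variables `0, …, n-1` by a value of the variable `n`. -/
def extend {α : Type*} {n : ℕ} (ρ : Fin n → α) (x : α) : Fin (n + 1) → α :=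
  Fin.snoc (α := fun _ => α) ρ x

/-- A Henkin structure for the language of second-order arithmetic: a number sort, and a set
sort consisting of some (not necessarily all) sets of numbers. -/
structure Henkin where
  N : Type u
  zero : N
  succ : N → N
  add : N → N → N
  mul : N → N → N
  lt : N → N → Prop
  sets : Set (Set N)

namespace Henkin

variable (𝔐 : Henkin.{u})

def termVal {n : ℕ} (ρ : Fin n → 𝔐.N) : SOTerm n → 𝔐.N
  | .var i => ρ i
  | .zero => 𝔐.zero
  | .succ t => 𝔐.succ (termVal ρ t)
  | .add s t => 𝔐.add (termVal ρ s) (termVal ρ t)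
  | .mul s t => 𝔐.mul (termVal ρ s) (termVal ρ t)

/-- Truth of a formula of second-order arithmetic in a Henkin structure. -/
def Sat : {n m : ℕ} → SOFormula n m → (Fin n → 𝔐.N) → (Fin m → Set 𝔐.N) → Prop
  | _, _, .eq s t, ρ, _ => 𝔐.termVal ρ s = 𝔐.termVal ρ t
  | _, _, .lt s t, ρ, _ => 𝔐.lt (𝔐.termVal ρ s) (𝔐.termVal ρ t)
  | _, _, .mem t X, ρ, σ => 𝔐.termVal ρ t ∈ σ X
  | _, _, .bot, _, _ => False
  | _, _, .imp φ ψ, ρ, σ => Sat φ ρ σ → Sat ψ ρ σ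
  | _, _, .allNum φ, ρ, σ => ∀ x : 𝔐.N, Sat φ (extend ρ x) σ
  | _, _, .allSet φ, ρ, σ => ∀ X ∈ 𝔐.sets, Sat φ ρ (extend σ X)

open Classical in
/-- The bijective pairing `⟨x, y⟩ = y² + x` if `x < y`, and `x² + x + y` otherwise. -/
noncomputable def pair (x y : 𝔐.N) : 𝔐.N :=
  if 𝔐.lt x y then 𝔐.add (𝔐.mul y y) x else 𝔐.add (𝔐.add (𝔐.mul x x) x) y

/-- `(Z)_i = {m | ⟨i, m⟩ ∈ Z}`. -/
def row (Z : Set 𝔐.N) (i : 𝔐.N) : Set 𝔐.N := {m | 𝔐.pair i m ∈ Z}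

/-- `(Z)^n = {⟨i, m⟩ ∈ Z | i < n}`. -/
def rowsBelow (Z : Set 𝔐.N) (n : 𝔐.N) : Set 𝔐.N :=
  {z | z ∈ Z ∧ ∃ i m, z = 𝔐.pair i m ∧ 𝔐.lt i n}

/-- Models of full second-order arithmetic together with the choice schemes
`Σ¹_∞-AC` and `Σ¹_∞-DC`. All schemes allow number and set parameters. -/
structure IsModelZ2 : Prop where
  succ_ne_zero : ∀ x, 𝔐.succ x ≠ 𝔐.zero
  succ_inj : ∀ x y, 𝔐.succ x = 𝔐.succ y → x = y
  add_zero : ∀ x, 𝔐.add x 𝔐.zero = x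
  add_succ : ∀ x y, 𝔐.add x (𝔐.succ y) = 𝔐.succ (𝔐.add x y)
  mul_zero : ∀ x, 𝔐.mul x 𝔐.zero = 𝔐.zero
  mul_succ : ∀ x y, 𝔐.mul x (𝔐.succ y) = 𝔐.add (𝔐.mul x y) x
  not_lt_zero : ∀ x, ¬ 𝔐.lt x 𝔐.zero
  lt_succ : ∀ x y, 𝔐.lt x (𝔐.succ y) ↔ 𝔐.lt x y ∨ x = y
  induction : ∀ X ∈ 𝔐.sets, 𝔐.zero ∈ X → (∀ x ∈ X, 𝔐.succ x ∈ X) → ∀ x, x ∈ X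
  comprehension : ∀ {n m : ℕ} (φ : SOFormula (n + 1) m) (ρ : Fin n → 𝔐.N)
    (σ : Fin m → Set 𝔐.N), (∀ i, σ i ∈ 𝔐.sets) →
    {x | 𝔐.Sat φ (extend ρ x) σ} ∈ 𝔐.sets
  choice : ∀ {n m : ℕ} (φ : SOFormula (n + 1) (m + 1)) (ρ : Fin n → 𝔐.N)
    (σ : Fin m → Set 𝔐.N), (∀ i, σ i ∈ 𝔐.sets) →
    (∀ x, ∃ X ∈ 𝔐.sets, 𝔐.Sat φ (extend ρ x) (extend σ X)) →
    ∃ Z ∈ 𝔐.sets, ∀ x, 𝔐.Sat φ (extend ρ x) (extend σ (𝔐.row Z x))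
  dependentChoice : ∀ {n m : ℕ} (φ : SOFormula (n + 1) (m + 1 + 1)) (ρ : Fin n → 𝔐.N)
    (σ : Fin m → Set 𝔐.N), (∀ i, σ i ∈ 𝔐.sets) →
    (∀ x, ∀ X ∈ 𝔐.sets, ∃ Y ∈ 𝔐.sets, 𝔐.Sat φ (extend ρ x) (extend (extend σ X) Y)) →
    ∃ Z ∈ 𝔐.sets, ∀ x,
      𝔐.Sat φ (extend ρ x) (extend (extend σ (𝔐.rowsBelow Z x)) (𝔐.row Z x))

/-- The numeral of a standard natural number. -/
def num : ℕ → 𝔐.N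
  | 0 => 𝔐.zero
  | k + 1 => 𝔐.succ (num k)

/-! ## Finite sequences and trees, inside a structure

Every inductive definition below is the intersection of all closed sets *of the structure*,
that is, the usual definition of an inductively generated set in second-order arithmetic. -/

/-- A set of numbers read as a binary relation. -/
def rel₂ (Z : Set 𝔐.N) (x y : 𝔐.N) : Prop := 𝔐.pair x y ∈ Z

/-- A set of numbers read as a ternary relation. -/
def rel₃ (Z : Set 𝔐.N) (x y z : 𝔐.N) : Prop := 𝔐.pair x (𝔐.pair y z) ∈ Z

/-- The code of the empty sequence. -/
def nil : 𝔐.N := 𝔐.zero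

/-- The code of `⟨a⟩⌢s`. -/
noncomputable def cons (a s : 𝔐.N) : 𝔐.N := 𝔐.succ (𝔐.pair a s)

/-- The code of `⟨a⟩`. -/
noncomputable def single (a : 𝔐.N) : 𝔐.N := 𝔐.cons a 𝔐.nil

/-- `s⌢t = w`. -/
def Concat (s t w : 𝔐.N) : Prop :=
  ∀ Z ∈ 𝔐.sets, (∀ t, 𝔐.rel₃ Z 𝔐.nil t t) →
    (∀ a s t w, 𝔐.rel₃ Z s t w → 𝔐.rel₃ Z (𝔐.cons a s) t (𝔐.cons a w)) → 𝔐.rel₃ Z s t w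

/-- Trees: sets of sequences containing the empty one and closed under restrictions. -/
def IsTree (S : Set 𝔐.N) : Prop :=
  𝔐.nil ∈ S ∧ ∀ s t w, 𝔐.Concat s t w → w ∈ S → s ∈ S

/-- `S ↓ a = {s | ⟨a⟩⌢s ∈ S}`. -/
def down (S : Set 𝔐.N) (a : 𝔐.N) : Set 𝔐.N := {s | 𝔐.cons a s ∈ S}

/-- `immd(S) = {a | ⟨a⟩ ∈ S}`. -/
def immd (S : Set 𝔐.N) : Set 𝔐.N := {a | 𝔐.single a ∈ S}

/-- `s = ⟨f(0), …, f(n-1)⟩`, where `f` is the function with graph `F`. -/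
def InitialSegment (F : Set 𝔐.N) (n s : 𝔐.N) : Prop :=
  ∀ Z ∈ 𝔐.sets, 𝔐.rel₂ Z 𝔐.zero 𝔐.nil →
    (∀ n s a t, 𝔐.rel₂ Z n s → 𝔐.rel₂ F n a → 𝔐.Concat s (𝔐.single a) t →
      𝔐.rel₂ Z (𝔐.succ n) t) → 𝔐.rel₂ Z n s

/-- No function of the structure is an infinite path through `S`. -/
def WellFoundedTree (S : Set 𝔐.N) : Prop :=
  ¬ ∃ F ∈ 𝔐.sets, (∀ n, ∃! a, 𝔐.rel₂ F n a) ∧ ∀ n, ∃ s, 𝔐.InitialSegment F n s ∧ s ∈ S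

/-- `Set(X)`: `X` is a well-founded tree (of the structure). -/
def IsSet (X : Set 𝔐.N) : Prop := X ∈ 𝔐.sets ∧ 𝔐.IsTree X ∧ 𝔐.WellFoundedTree X

/-! ## Kleene's first algebra -/

/-- The rules that generate `{e}(x) = y`: constants, successor, identity, projections, pairing,
composition, primitive recursion, unbounded search and the enumeration (index) scheme. -/
inductive EvalStep (R : 𝔐.N → 𝔐.N → 𝔐.N → Prop) : 𝔐.N → 𝔐.N → 𝔐.N → Prop
  | const (k x : 𝔐.N) : EvalStep R (𝔐.pair (𝔐.num 0) k) x k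
  | succ (x : 𝔐.N) : EvalStep R (𝔐.pair (𝔐.num 1) 𝔐.zero) x (𝔐.succ x)
  | ident (x : 𝔐.N) : EvalStep R (𝔐.pair (𝔐.num 2) 𝔐.zero) x x
  | left (a b : 𝔐.N) : EvalStep R (𝔐.pair (𝔐.num 3) 𝔐.zero) (𝔐.pair a b) a
  | right (a b : 𝔐.N) : EvalStep R (𝔐.pair (𝔐.num 4) 𝔐.zero) (𝔐.pair a b) b
  | pair (f g x a b : 𝔐.N) : R f x a → R g x b →
      EvalStep R (𝔐.pair (𝔐.num 5) (𝔐.pair f g)) x (𝔐.pair a b)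
  | comp (f g x a b : 𝔐.N) : R g x a → R f a b →
      EvalStep R (𝔐.pair (𝔐.num 6) (𝔐.pair f g)) x b
  | precZero (f g a b : 𝔐.N) : R f a b →
      EvalStep R (𝔐.pair (𝔐.num 7) (𝔐.pair f g)) (𝔐.pair a 𝔐.zero) b
  | precSucc (f g a n b c : 𝔐.N) : R (𝔐.pair (𝔐.num 7) (𝔐.pair f g)) (𝔐.pair a n) b →
      R g (𝔐.pair a (𝔐.pair n b)) c →
      EvalStep R (𝔐.pair (𝔐.num 7) (𝔐.pair f g)) (𝔐.pair a (𝔐.succ n)) c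
  | searchStop (f a n : 𝔐.N) : R f (𝔐.pair a n) 𝔐.zero →
      EvalStep R (𝔐.pair (𝔐.num 8) f) (𝔐.pair a n) n
  | searchNext (f a n b c : 𝔐.N) : R f (𝔐.pair a n) (𝔐.succ b) →
      R (𝔐.pair (𝔐.num 8) f) (𝔐.pair a (𝔐.succ n)) c →
      EvalStep R (𝔐.pair (𝔐.num 8) f) (𝔐.pair a n) c
  | index (e x y : 𝔐.N) : R e x y →
      EvalStep R (𝔐.pair (𝔐.num 9) 𝔐.zero) (𝔐.pair e x) y

/-- Application in Kleene's first algebra: `e x ≃ y`, that is, `{e}(x) = y`. -/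
def App (e x y : 𝔐.N) : Prop :=
  ∀ Z ∈ 𝔐.sets, (∀ e x y, 𝔐.EvalStep (𝔐.rel₃ Z) e x y → 𝔐.rel₃ Z e x y) → 𝔐.rel₃ Z e x y

/-! ## The type structure, the universe `V` and the tree `M` -/

noncomputable def natCode : 𝔐.N := 𝔐.pair (𝔐.num 0) 𝔐.zero

noncomputable def finCode (n : 𝔐.N) : 𝔐.N := 𝔐.pair (𝔐.num 1) n

noncomputable def sumCode (A B : 𝔐.N) : 𝔐.N := 𝔐.pair (𝔐.num 2) (𝔐.pair A B)

noncomputable def piCode (A F : 𝔐.N) : 𝔐.N := 𝔐.pair (𝔐.num 3) (𝔐.pair A F)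

noncomputable def sigmaCode (A F : 𝔐.N) : 𝔐.N := 𝔐.pair (𝔐.num 4) (𝔐.pair A F)

noncomputable def supCode (A f : 𝔐.N) : 𝔐.N := 𝔐.pair (𝔐.num 5) (𝔐.pair A f)

/-- `TypeStep D E A P`: the number `A` codes a type formed from types in `D`, whose extensions
are given by `E`, and `P` is the extension that `A` has to have. -/
inductive TypeStep (D : 𝔐.N → Prop) (E : 𝔐.N → 𝔐.N → Prop) : 𝔐.N → (𝔐.N → Prop) → Prop
  | nat : TypeStep D E 𝔐.natCode (fun _ => True)
  | fin (n : 𝔐.N) : TypeStep D E (𝔐.finCode n) (fun k => 𝔐.lt k n)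
  | sum (A B : 𝔐.N) : D A → D B → TypeStep D E (𝔐.sumCode A B)
      (fun z => (∃ x, z = 𝔐.pair (𝔐.num 0) x ∧ E A x) ∨ ∃ y, z = 𝔐.pair (𝔐.num 1) y ∧ E B y)
  | pi (A F : 𝔐.N) : D A → (∀ x, E A x → ∃ B, 𝔐.App F x B ∧ D B) → TypeStep D E (𝔐.piCode A F)
      (fun f => ∀ x, E A x → ∃ B y, 𝔐.App F x B ∧ 𝔐.App f x y ∧ E B y)
  | sigma (A F : 𝔐.N) : D A → (∀ x, E A x → ∃ B, 𝔐.App F x B ∧ D B) →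
      TypeStep D E (𝔐.sigmaCode A F)
      (fun z => ∃ x w B, z = 𝔐.pair x w ∧ E A x ∧ 𝔐.App F x B ∧ E B w)

/-- `D` is a set of type codes closed under components, `E` assigns to each of them its extension,
and `D` is inductively generated: it lies in each set `X` of the structure which contains every
member of `D` whose components are in `X`. -/
def IsTypeStructure (D E : Set 𝔐.N) : Prop :=
  (∀ A ∈ D, 𝔐.TypeStep (fun B => B ∈ D) (𝔐.rel₂ E) A (𝔐.rel₂ E A)) ∧
  ∀ X ∈ 𝔐.sets,
    (∀ A ∈ D, 𝔐.TypeStep (fun B => B ∈ D ∧ B ∈ X) (𝔐.rel₂ E) A (𝔐.rel₂ E A) → A ∈ X) → D ⊆ X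

/-- `A` is (the code of) a type. -/
def IsType (A : 𝔐.N) : Prop :=
  ∃ D ∈ 𝔐.sets, ∃ E ∈ 𝔐.sets, 𝔐.IsTypeStructure D E ∧ A ∈ D

/-- The extension of the type `A`. -/
def ext (A : 𝔐.N) : Set 𝔐.N :=
  {x | ∃ D ∈ 𝔐.sets, ∃ E ∈ 𝔐.sets, 𝔐.IsTypeStructure D E ∧ A ∈ D ∧ 𝔐.rel₂ E A x}

/-- The universe `V`, inductively generated by: if `A` is a type and `f x ∈ V` for all
`x ∈ ext(A)`, then `sup(A, f) ∈ V`. -/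
def V : Set 𝔐.N :=
  {v | ∀ Z ∈ 𝔐.sets, (∀ A f, 𝔐.IsType A → (∀ x ∈ 𝔐.ext A, ∃ w ∈ Z, 𝔐.App f x w) →
    𝔐.supCode A f ∈ Z) → v ∈ Z}

/-- The tree `𝔱(v)` for `v ∈ V`, given by
`𝔱(sup(A, f)) = {⟨⟩} ∪ {⟨x⟩⌢s | x ∈ ext(A), s ∈ 𝔱(f x)}`. -/
def treeOf (v : 𝔐.N) : Set 𝔐.N :=
  {s | ∀ Z ∈ 𝔐.sets, (∀ v ∈ 𝔐.V, 𝔐.rel₂ Z v 𝔐.nil) →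
    (∀ A f x w s, 𝔐.supCode A f ∈ 𝔐.V → x ∈ 𝔐.ext A → 𝔐.App f x w → 𝔐.rel₂ Z w s →
      𝔐.rel₂ Z (𝔐.supCode A f) (𝔐.cons x s)) → 𝔐.rel₂ Z v s}

/-- The tree `M = {⟨⟩} ∪ {⟨x⟩⌢s | x ∈ V, s ∈ 𝔱(x)}`. -/
def treeM : Set 𝔐.N :=
  {t | t = 𝔐.nil ∨ ∃ x ∈ 𝔐.V, ∃ s ∈ 𝔐.treeOf x, t = 𝔐.cons x s}

end Henkin

/-! ## The language of set theory -/

/-- Formulas of set theory with free variables `0, …, n-1`. A quantifier binds the variable `n`;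
bounded quantifiers `∀ x ∈ i`, `∃ x ∈ i` are primitive. -/
inductive Form : ℕ → Type
  | bot {n : ℕ} : Form n
  | mem {n : ℕ} (i j : Fin n) : Form n
  | eq {n : ℕ} (i j : Fin n) : Form n
  | and {n : ℕ} (φ ψ : Form n) : Form n
  | or {n : ℕ} (φ ψ : Form n) : Form n
  | imp {n : ℕ} (φ ψ : Form n) : Form n
  | ball {n : ℕ} (i : Fin n) (φ : Form (n + 1)) : Form n
  | bex {n : ℕ} (i : Fin n) (φ : Form (n + 1)) : Form n
  | all {n : ℕ} (φ : Form (n + 1)) : Form n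
  | ex {n : ℕ} (φ : Form (n + 1)) : Form n

namespace Form

/-- Simultaneous (capture-free) substitution of variables for the free variables. -/
def rename : {n m : ℕ} → (Fin n → Fin m) → Form n → Form m
  | _, _, _, bot => bot
  | _, _, f, mem i j => mem (f i) (f j)
  | _, _, f, eq i j => eq (f i) (f j)
  | _, _, f, and φ ψ => and (φ.rename f) (ψ.rename f)
  | _, _, f, or φ ψ => or (φ.rename f) (ψ.rename f)
  | _, _, f, imp φ ψ => imp (φ.rename f) (ψ.rename f)
  | _, m, f, ball i φ => ball (f i) (φ.rename (extend (fun j => (f j).castSucc) (Fin.last m)))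
  | _, m, f, bex i φ => bex (f i) (φ.rename (extend (fun j => (f j).castSucc) (Fin.last m)))
  | _, m, f, all φ => all (φ.rename (extend (fun j => (f j).castSucc) (Fin.last m)))
  | _, m, f, ex φ => ex (φ.rename (extend (fun j => (f j).castSucc) (Fin.last m)))

/-- Regard a formula in `n` variables as one in `n + 1` variables. -/
def weaken {n : ℕ} (φ : Form n) : Form (n + 1) := φ.rename Fin.castSucc

/-- Substitute the variable `i` for the last variable. -/
def inst {n : ℕ} (φ : Form (n + 1)) (i : Fin n) : Form n := φ.rename (extend id i)

/-- Bounded formulas: no unbounded quantifiers. -/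
def Bounded : {n : ℕ} → Form n → Prop
  | _, bot => True
  | _, mem _ _ => True
  | _, eq _ _ => True
  | _, and φ ψ => φ.Bounded ∧ ψ.Bounded
  | _, or φ ψ => φ.Bounded ∧ ψ.Bounded
  | _, imp φ ψ => φ.Bounded ∧ ψ.Bounded
  | _, ball _ φ => φ.Bounded
  | _, bex _ φ => φ.Bounded
  | _, all _ => False
  | _, ex _ => False

def iff {n : ℕ} (φ ψ : Form n) : Form n := and (imp φ ψ) (imp ψ φ)

/-- The universal closure. -/
def closure : {n : ℕ} → Form n → Form 0
  | 0, φ => φ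
  | _ + 1, φ => closure (all φ)

/-- The variable with number `i`. -/
def v {n : ℕ} (i : ℕ) (h : i < n := by omega) : Fin n := ⟨i, h⟩

/-- For `φ(p₀, …, p_{k-1}, x₀, …, x_{j-1})`: keep the parameters `p` as the variables
`0, …, k-1` of the context and substitute the variables `w` for the `x`'s. -/
def at' {k j n : ℕ} (φ : Form (k + j)) (w : Fin j → Fin n) (h : k ≤ n := by omega) : Form n :=
  φ.rename (Fin.append (Fin.castLE h) w)

section Abbreviations

variable {n : ℕ}

/-- `x` is empty. -/
def isEmpty (x : Fin n) : Form n := ball x bot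

/-- `y = x ∪ {x}`. -/
def isSucc (x y : Fin n) : Form n :=
  and (ball y (or (mem (Fin.last n) x.castSucc) (eq (Fin.last n) x.castSucc)))
    (and (ball x (mem (Fin.last n) y.castSucc)) (mem x y))

/-- `w = ω`: `0 ∈ w`, `w` is closed under successors, and every member of `w` is `0` or the
successor of a member of `w`. -/
def isOmega (w : Fin n) : Form n :=
  and (bex w (isEmpty (Fin.last n)))
    (and (ball w (bex w.castSucc (isSucc (Fin.last n).castSucc (Fin.last (n + 1)))))
      (ball w (or (isEmpty (Fin.last n))
        (bex w.castSucc (isSucc (Fin.last (n + 1)) (Fin.last n).castSucc)))))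

/-- `z = {x, y}`. -/
def isPair (x y z : Fin n) : Form n :=
  and (mem x z) (and (mem y z)
    (ball z (or (eq (Fin.last n) x.castSucc) (eq (Fin.last n) y.castSucc))))

/-- `z = ⟨x, y⟩ = {{x}, {x, y}}`. -/
def isOrdPair (x y z : Fin n) : Form n :=
  bex z (bex z.castSucc
    (and (isPair x.castSucc.castSucc x.castSucc.castSucc (Fin.last n).castSucc)
      (and (isPair x.castSucc.castSucc y.castSucc.castSucc (Fin.last (n + 1)))
        (isPair (Fin.last n).castSucc (Fin.last (n + 1)) z.castSucc.castSucc))))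

/-- `⟨x, y⟩ ∈ R`. -/
def pairMem (x y R : Fin n) : Form n :=
  bex R (isOrdPair x.castSucc y.castSucc (Fin.last n))

/-- `R : a ⇉ b`, i.e. `∀ x ∈ a ∃ y ∈ b, ⟨x, y⟩ ∈ R`. -/
def multi (R a b : Fin n) : Form n :=
  ball a (bex b.castSucc
    (pairMem (Fin.last n).castSucc (Fin.last (n + 1)) R.castSucc.castSucc))

/-- `b` is a subimage of `R` on `a`, i.e. `∀ x ∈ a ∃ y ∈ b, ⟨x, y⟩ ∈ R` and
`∀ y ∈ b ∃ x ∈ a, ⟨x, y⟩ ∈ R`. -/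
def subimage (R a b : Fin n) : Form n :=
  and (multi R a b) (ball b (bex a.castSucc
    (pairMem (Fin.last (n + 1)) (Fin.last n).castSucc R.castSucc.castSucc)))

end Abbreviations

/-! ### Axioms of `CZF` with full Separation -/

/-- `∀ x y, (∀ z, z ∈ x ↔ z ∈ y) → x = y`. -/
def extensionality : Form 0 :=
  all (all (imp (all (iff (mem (v 2) (v 0)) (mem (v 2) (v 1)))) (eq (v 0) (v 1))))

/-- `∀ a b ∃ c ∀ x, x ∈ c ↔ x = a ∨ x = b`. -/
def pairing : Form 0 :=
  all (all (ex (all (iff (mem (v 3) (v 2)) (or (eq (v 3) (v 0)) (eq (v 3) (v 1)))))))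

/-- `∀ a ∃ b ∀ x, x ∈ b ↔ ∃ y ∈ a, x ∈ y`. -/
def union : Form 0 :=
  all (ex (all (iff (mem (v 2) (v 1)) (bex (v 0) (mem (v 2) (v 3))))))

/-- `ω` exists. -/
def infinity : Form 0 := ex (isOmega (v 0))

/-- `∀ p, (∀ x, (∀ y ∈ x, φ(p, y)) → φ(p, x)) → ∀ x, φ(p, x)`. -/
def setInduction {k : ℕ} (φ : Form (k + 1)) : Form 0 :=
  closure (n := k)
    (imp (all (imp (ball (v k) (φ.at' ![v (k + 1)])) (φ.at' ![v k]))) (all (φ.at' ![v k])))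

/-- `∀ p a ∃ b ∀ x, x ∈ b ↔ x ∈ a ∧ φ(p, x)`. -/
def separation {k : ℕ} (φ : Form (k + 1)) : Form 0 :=
  closure (n := k) (all (ex (all
    (iff (mem (v (k + 2)) (v (k + 1))) (and (mem (v (k + 2)) (v k)) (φ.at' ![v (k + 2)]))))))

/-- `∀ p a, (∀ x ∈ a ∃ y, φ(p, x, y)) →
∃ b, (∀ x ∈ a ∃ y ∈ b, φ(p, x, y)) ∧ ∀ y ∈ b ∃ x ∈ a, φ(p, x, y)`. -/
def strongCollection {k : ℕ} (φ : Form (k + 2)) : Form 0 :=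
  closure (n := k) (all (imp
    (ball (v k) (ex (φ.at' ![v (k + 1), v (k + 2)])))
    (ex (and
      (ball (v k) (bex (v (k + 1)) (φ.at' ![v (k + 2), v (k + 3)])))
      (ball (v (k + 1)) (bex (v k) (φ.at' ![v (k + 3), v (k + 2)])))))))

/-- `∀ p a b ∃ c ∀ u, (∀ x ∈ a ∃ y ∈ b, φ(p, x, y, u)) →
∃ d ∈ c, (∀ x ∈ a ∃ y ∈ d, φ(p, x, y, u)) ∧ ∀ y ∈ d ∃ x ∈ a, φ(p, x, y, u)`. -/
def subsetCollection {k : ℕ} (φ : Form (k + 3)) : Form 0 :=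
  closure (n := k) (all (all (ex (all (imp
    (ball (v k) (bex (v (k + 1)) (φ.at' ![v (k + 4), v (k + 5), v (k + 3)])))
    (bex (v (k + 2)) (and
      (ball (v k) (bex (v (k + 4)) (φ.at' ![v (k + 5), v (k + 6), v (k + 3)])))
      (ball (v (k + 4)) (bex (v k) (φ.at' ![v (k + 6), v (k + 5), v (k + 3)]))))))))))

/-! ### `M` is a transitive model of second-order `CZF` (the variable `0` is `M`) -/

/-- `∀ x ∈ M ∀ y ∈ x, y ∈ M`. -/
def transitiveM : Form 1 := ball (v 0) (ball (v 1) (mem (v 2) (v 0)))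

/-- `∀ a ∈ M ∃ b ∈ M, (∀ x ∈ a ∀ y ∈ x, y ∈ b) ∧ ∀ y ∈ b ∃ x ∈ a, y ∈ x`. -/
def unionM : Form 1 :=
  ball (v 0) (bex (v 0) (and
    (ball (v 1) (ball (v 3) (mem (v 4) (v 2))))
    (ball (v 2) (bex (v 1) (mem (v 3) (v 4))))))

/-- Prefix `∀ p₁ ∈ M … ∀ p_k ∈ M`. -/
def ballsM : (k : ℕ) → Form (k + 1) → Form 1
  | 0, φ => φ
  | k + 1, φ => ballsM k (ball (v 0) φ)

/-- `∀ p ∈ M ∀ a ∈ M ∃ b ∈ M, (∀ x ∈ b, x ∈ a ∧ φ(p, x)) ∧ ∀ x ∈ a, φ(p, x) → x ∈ b`. -/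
def separationM {k : ℕ} (φ : Form (k + 1)) : Form 1 :=
  let φx : Form (k + 4) :=
    φ.rename (Fin.append (fun i : Fin k => v (i + 1)) ![v (k + 3)])
  ballsM k (ball (v 0) (bex (v 0) (and
    (ball (v (k + 2)) (and (mem (v (k + 3)) (v (k + 1))) φx))
    (ball (v (k + 1)) (imp φx (mem (v (k + 3)) (v (k + 2))))))))

/-- `ω ∈ M`. -/
def omegaM : Form 1 := bex (v 0) (isOmega (v 1))

/-- `∀ a ∈ M ∀ R, R : a ⇉ M → ∃ b ∈ M`, `b` is a subimage of `R` on `a`. -/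
def strongCollectionM : Form 1 :=
  ball (v 0) (all (imp (multi (v 2) (v 1) (v 0)) (bex (v 0) (subimage (v 2) (v 1) (v 3)))))

/-- `∀ a ∈ M ∀ b ∈ M ∃ c ∈ M ∀ R, R : a ⇉ b → ∃ d ∈ c`, `d` is a subimage of `R` on `a`. -/
def subsetCollectionM : Form 1 :=
  ball (v 0) (ball (v 0) (bex (v 0) (all (imp (multi (v 4) (v 1) (v 2))
    (bex (v 3) (subimage (v 4) (v 1) (v 5)))))))

/-- Conjunction of a list of formulas, ending in `ψ`. -/
def conj {n : ℕ} (L : List (Form n)) (ψ : Form n) : Form n := L.foldr and ψ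

/-- `M` is a transitive model of second-order `CZF`, with bounded separation for the finitely
many (bounded) formulas in `L`. -/
def modelM (L : List (Σ k : ℕ, Form (k + 1))) : Form 1 :=
  and transitiveM (and unionM (and omegaM (conj (L.map fun φ => separationM φ.2)
    (and strongCollectionM subsetCollectionM))))

/-- The intermediate theory `T`, in the language `⟨∈⟩`. "There is a transitive set `M` closed under
bounded separation …" speaks about infinitely many formulas, so it is the scheme that says, for each
finite list of bounded formulas, that there is an `M` closed under separation for these. -/
inductive TheoryT : Form 0 → Prop
  | extensionality : TheoryT extensionality
  | pairing : TheoryT pairing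
  | union : TheoryT union
  | infinity : TheoryT infinity
  | setInduction {k : ℕ} (φ : Form (k + 1)) : TheoryT (setInduction φ)
  | separation {k : ℕ} (φ : Form (k + 1)) : TheoryT (separation φ)
  | strongCollection {k : ℕ} (φ : Form (k + 2)) : TheoryT (strongCollection φ)
  | subsetCollection {k : ℕ} (φ : Form (k + 3)) : TheoryT (subsetCollection φ)
  | exists_M (L : List (Σ k : ℕ, Form (k + 1))) (hL : ∀ φ ∈ L, φ.2.Bounded) :
      TheoryT (ex (modelM L))

end Form

/-- Natural deduction for intuitionistic first-order logic with equality, over the axioms `Ax`;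
`Derives Ax Γ φ` with `Γ`, `φ` in the free variables `0, …, n-1`. -/
inductive Derives (Ax : Form 0 → Prop) : {n : ℕ} → List (Form n) → Form n → Prop
  | ax {n : ℕ} {Γ : List (Form n)} {φ : Form 0} : Ax φ → Derives Ax Γ (φ.rename Fin.elim0)
  | hyp {n : ℕ} {Γ : List (Form n)} {φ : Form n} : φ ∈ Γ → Derives Ax Γ φ
  | botE {n : ℕ} {Γ : List (Form n)} {φ : Form n} : Derives Ax Γ .bot → Derives Ax Γ φ
  | andI {n : ℕ} {Γ : List (Form n)} {φ ψ : Form n} :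
      Derives Ax Γ φ → Derives Ax Γ ψ → Derives Ax Γ (.and φ ψ)
  | andE₁ {n : ℕ} {Γ : List (Form n)} {φ ψ : Form n} : Derives Ax Γ (.and φ ψ) → Derives Ax Γ φ
  | andE₂ {n : ℕ} {Γ : List (Form n)} {φ ψ : Form n} : Derives Ax Γ (.and φ ψ) → Derives Ax Γ ψ
  | orI₁ {n : ℕ} {Γ : List (Form n)} {φ ψ : Form n} : Derives Ax Γ φ → Derives Ax Γ (.or φ ψ)
  | orI₂ {n : ℕ} {Γ : List (Form n)} {φ ψ : Form n} : Derives Ax Γ ψ → Derives Ax Γ (.or φ ψ)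
  | orE {n : ℕ} {Γ : List (Form n)} {φ ψ χ : Form n} : Derives Ax Γ (.or φ ψ) →
      Derives Ax (φ :: Γ) χ → Derives Ax (ψ :: Γ) χ → Derives Ax Γ χ
  | impI {n : ℕ} {Γ : List (Form n)} {φ ψ : Form n} :
      Derives Ax (φ :: Γ) ψ → Derives Ax Γ (.imp φ ψ)
  | impE {n : ℕ} {Γ : List (Form n)} {φ ψ : Form n} :
      Derives Ax Γ (.imp φ ψ) → Derives Ax Γ φ → Derives Ax Γ ψ
  | allI {n : ℕ} {Γ : List (Form n)} {φ : Form (n + 1)} :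
      Derives Ax (Γ.map Form.weaken) φ → Derives Ax Γ (.all φ)
  | allE {n : ℕ} {Γ : List (Form n)} {φ : Form (n + 1)} (i : Fin n) :
      Derives Ax Γ (.all φ) → Derives Ax Γ (φ.inst i)
  | exI {n : ℕ} {Γ : List (Form n)} {φ : Form (n + 1)} (i : Fin n) :
      Derives Ax Γ (φ.inst i) → Derives Ax Γ (.ex φ)
  | exE {n : ℕ} {Γ : List (Form n)} {φ : Form (n + 1)} {ψ : Form n} : Derives Ax Γ (.ex φ) →
      Derives Ax (φ :: Γ.map Form.weaken) ψ.weaken → Derives Ax Γ ψ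
  | ballI {n : ℕ} {Γ : List (Form n)} {i : Fin n} {φ : Form (n + 1)} :
      Derives Ax (.mem (Fin.last n) i.castSucc :: Γ.map Form.weaken) φ → Derives Ax Γ (.ball i φ)
  | ballE {n : ℕ} {Γ : List (Form n)} {i : Fin n} {φ : Form (n + 1)} (j : Fin n) :
      Derives Ax Γ (.ball i φ) → Derives Ax Γ (.mem j i) → Derives Ax Γ (φ.inst j)
  | bexI {n : ℕ} {Γ : List (Form n)} {i : Fin n} {φ : Form (n + 1)} (j : Fin n) :
      Derives Ax Γ (.mem j i) → Derives Ax Γ (φ.inst j) → Derives Ax Γ (.bex i φ)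
  | bexE {n : ℕ} {Γ : List (Form n)} {i : Fin n} {φ : Form (n + 1)} {ψ : Form n} :
      Derives Ax Γ (.bex i φ) →
      Derives Ax (φ :: .mem (Fin.last n) i.castSucc :: Γ.map Form.weaken) ψ.weaken →
      Derives Ax Γ ψ
  | eqRefl {n : ℕ} {Γ : List (Form n)} (i : Fin n) : Derives Ax Γ (.eq i i)
  | eqSubst {n : ℕ} {Γ : List (Form n)} {φ : Form (n + 1)} (i j : Fin n) :
      Derives Ax Γ (.eq i j) → Derives Ax Γ (φ.inst i) → Derives Ax Γ (φ.inst j)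

/-! ## Lubarsky's realizability interpretation -/

namespace Henkin

variable (𝔐 : Henkin.{u})

/-- One step of the recursion for realizing equality between the subtrees `J ↓ s` and `J ↓ t` of a
tree `J`; here `R s' t' d` stands for `d ⊩ J ↓ s' = J ↓ t'`. -/
def EqStep (J : Set 𝔐.N) (R : 𝔐.N → 𝔐.N → 𝔐.N → Prop) (s t e : 𝔐.N) : Prop :=
  ∃ e₀ e₁, e = 𝔐.pair e₀ e₁ ∧
    (∀ a s', 𝔐.Concat s (𝔐.single a) s' → s' ∈ J →
      ∃ c d t', 𝔐.App e₀ a (𝔐.pair c d) ∧ 𝔐.Concat t (𝔐.single c) t' ∧ t' ∈ J ∧ R s' t' d) ∧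
    (∀ b t', 𝔐.Concat t (𝔐.single b) t' → t' ∈ J →
      ∃ c d s', 𝔐.App e₁ b (𝔐.pair c d) ∧ 𝔐.Concat s (𝔐.single c) s' ∧ s' ∈ J ∧ R t' s' d)

/-- The tree with the two immediate subtrees `S` (at `⟨0⟩`) and `T` (at `⟨1⟩`). -/
def join (S T : Set 𝔐.N) : Set 𝔐.N :=
  {x | x = 𝔐.nil ∨ (∃ s ∈ S, x = 𝔐.cons (𝔐.num 0) s) ∨ ∃ t ∈ T, x = 𝔐.cons (𝔐.num 1) t}

/-- `e ⊩ S = T`. The recursion on pairs of subtrees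
(`e ⊩ S = T` iff `(e)₀ a ⊩ S ↓ a ∈ T` for `a ∈ immd(S)` and `(e)₁ b ⊩ T ↓ b ∈ S` for
`b ∈ immd(T)`) is carried out on the nodes of the join of `S` and `T`. -/
def RealizesEq (S T : Set 𝔐.N) (e : 𝔐.N) : Prop :=
  ∀ Z ∈ 𝔐.sets, (∀ s t e, 𝔐.EqStep (𝔐.join S T) (𝔐.rel₃ Z) s t e → 𝔐.rel₃ Z s t e) →
    𝔐.rel₃ Z (𝔐.single (𝔐.num 0)) (𝔐.single (𝔐.num 1)) e

/-- `Realizes φ ρ e` is `e ⊩ φ` under the assignment `ρ` of trees to the free variables. -/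
def Realizes : {n : ℕ} → Form n → (Fin n → Set 𝔐.N) → 𝔐.N → Prop
  | _, .bot, _, _ => False
  | _, .mem i j, ρ, e =>
      ∃ c d, e = 𝔐.pair c d ∧ c ∈ 𝔐.immd (ρ j) ∧ 𝔐.RealizesEq (ρ i) (𝔐.down (ρ j) c) d
  | _, .eq i j, ρ, e => 𝔐.RealizesEq (ρ i) (ρ j) e
  | _, .and φ ψ, ρ, e => ∃ c d, e = 𝔐.pair c d ∧ Realizes φ ρ c ∧ Realizes ψ ρ d
  | _, .or φ ψ, ρ, e => ∃ c d, e = 𝔐.pair c d ∧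
      ((c = 𝔐.num 0 ∧ Realizes φ ρ d) ∨ (c = 𝔐.num 1 ∧ Realizes ψ ρ d))
  | _, .imp φ ψ, ρ, e => ∀ f, Realizes φ ρ f → ∃ y, 𝔐.App e f y ∧ Realizes ψ ρ y
  | _, .ball i φ, ρ, e => ∀ a ∈ 𝔐.immd (ρ i),
      ∃ y, 𝔐.App e a y ∧ Realizes φ (extend ρ (𝔐.down (ρ i) a)) y
  | _, .bex i φ, ρ, e => ∃ a d, e = 𝔐.pair a d ∧ a ∈ 𝔐.immd (ρ i) ∧
      Realizes φ (extend ρ (𝔐.down (ρ i) a)) d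
  | _, .all φ, ρ, e => ∀ X, 𝔐.IsSet X → Realizes φ (extend ρ X) e
  | _, .ex φ, ρ, e => ∃ X, 𝔐.IsSet X ∧ Realizes φ (extend ρ X) e

end Henkin

/-- Truth in all (Henkin) models of second-order arithmetic; by the completeness theorem this is
provability in second-order arithmetic. -/
def Z2Entails (θ : SOFormula 0 0) : Prop :=
  ∀ 𝔐 : Henkin.{u}, 𝔐.IsModelZ2 → 𝔐.Sat θ Fin.elim0 Fin.elim0

/-- There is a numeral `e` such that second-order arithmetic proves `e ⊩ φ`. -/
def Realized (φ : Form 0) : Prop :=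
  ∃ e : ℕ, ∀ 𝔐 : Henkin.{u}, 𝔐.IsModelZ2 → 𝔐.Realizes φ Fin.elim0 (𝔐.num e)

/-- There is a numeral `e` such that second-order arithmetic proves `e ⊩ φ(M)`, for the tree `M`
built from the universe `V`. -/
def RealizedAtM (φ : Form 1) : Prop :=
  ∃ e : ℕ, ∀ 𝔐 : Henkin.{u}, 𝔐.IsModelZ2 → 𝔐.Realizes φ (fun _ => 𝔐.treeM) (𝔐.num e)

/-- Realizability interprets the theory `Ax` in second-order arithmetic: some translation of
sentences into the language of second-order arithmetic expresses `∃ e, e ⊩ φ` in all models, sends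
all intuitionistic consequences of `Ax` to consequences of second-order arithmetic, and sends `⊥`
to a refutable sentence. -/
def RealizabilityInterprets (Ax : Form 0 → Prop) : Prop :=
  ∃ tr : Form 0 → SOFormula 0 0,
    (∀ φ, ∀ 𝔐 : Henkin.{u}, 𝔐.IsModelZ2 →
      (𝔐.Sat (tr φ) Fin.elim0 Fin.elim0 ↔ ∃ e, 𝔐.Realizes φ Fin.elim0 e)) ∧
    (∀ φ, Derives Ax [] φ → Z2Entails.{u} (tr φ)) ∧
    Z2Entails.{u} (.imp (tr .bot) .bot)

set_option synthInstance.maxSize 100000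
set_option synthInstance.maxHeartbeats 400000
set_option linter.unusedVariables false
set_option linter.unusedSectionVars false
set_option linter.unusedSimpArgs false

/-! ## Assignments and renaming of variables -/

section Extend

variable {α β : Type*} {n m : ℕ}

/-! The argument runs inside an arbitrary Henkin model of second-order arithmetic, while every
realizer is a standard numeral fixed before the model is given. A set of the realizability model is
a well-founded tree. A number realizes an implication or a bounded universal by computing on
realizers or on indices of immediate subtrees. Unbounded quantifiers carry no computational content.

Logic. Realized equality is a least fixed point on the nodes of a tree, and `realizesEq_iff`
recovers its recursion equation. Induction on well-founded trees (`IsSet.induct`) then gives fixed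
programs for reflexivity and transitivity, and induction on formulas extends them to substitutivity
(`exists_transport`). With these, every rule of intuitionistic logic with equality preserves
realizability (`exists_realizer_of_derives`).

The axioms of `CZF` with Separation. The required set is a tree whose immediate subtrees are indexed
by evidence for membership: by an index together with a realizer of the formula for Separation, by
pairs of indices for Union, by the realizers of totality themselves for Subset Collection. In Strong
Collection the realizer determines no witness set, so the witnesses are collected by the choice
scheme. Set Induction is realized by a self-referential program.

The set `M`. Its elements are the trees of codes in `V`, whose index sets are extensions of types.
The type formers mirror the realizability clauses: conjunction and bounded existence are sums,
implication and bounded universals are products, disjunction is a disjoint union. Realized equality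
between two elements of `V` is computed as a type by recursion on both. Hence the realizers of a
bounded formula with parameters in `V` form a type, computable from codes of the parameters
(`exists_typeOf_bounded`). Bounded Separation in `M` follows by taking a sum type as the new index
type. Strong and Subset Collection hold for arbitrary sets `R`: a realizer of totality of `R` is
itself a program that computes the indices of the images, so `R` does not enter the construction.
Subset Collection indexes its set by the function type from one index type to the other.

Two devices carry the formal weight. The class `Dfn` lets typeclass search check that a predicate
written in Lean is definable, so that the comprehension, induction and choice of the model apply to
it. The terms `PTerm`, with the weakest-precondition semantics `wp` and the soundness lemma
`exists_app_code`, replace hand computation with Kleene indices. -/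

@[simp]
theorem extend_last (ρ : Fin n → α) (x : α) : extend ρ x (Fin.last n) = x := by
  simp [extend]

@[simp]
theorem extend_castSucc (ρ : Fin n → α) (x : α) (i : Fin n) : extend ρ x i.castSucc = ρ i := by
  simp [extend]

theorem extend_eq_iff (ρ : Fin n → α) (x : α) (τ : Fin (n + 1) → α) :
    extend ρ x = τ ↔ (∀ i, ρ i = τ i.castSucc) ∧ x = τ (Fin.last n) := by
  constructor
  · rintro rfl; simp
  · rintro ⟨h, rfl⟩
    funext i
    refine Fin.lastCases ?_ (fun i => ?_) i <;> simp [h]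

@[simp]
theorem extend_init (ρ : Fin (n + 1) → α) :
    extend (fun j => ρ j.castSucc) (ρ (Fin.last n)) = ρ := by
  simp [extend_eq_iff]

theorem extend_comp_lift (ρ : Fin m → α) (x : α) (f : Fin n → Fin m) :
    (fun i => extend ρ x (extend (fun j => (f j).castSucc) (Fin.last m) i))
      = extend (fun i => ρ (f i)) x := by
  symm; simp [extend_eq_iff]

theorem comp_extend (g : α → β) (ρ : Fin n → α) (x : α) :
    (fun i => g (extend ρ x i)) = extend (fun i => g (ρ i)) (g x) := by
  symm; simp [extend_eq_iff]

theorem append_extend (a : Fin m → α) (ρ : Fin n → α) (x : α) :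
    Fin.append a (extend ρ x) = extend (Fin.append a ρ) x := Fin.append_snoc a ρ x

theorem extend_mem {S : Set α} {ρ : Fin n → α} (h : ∀ i, ρ i ∈ S) {x : α} (hx : x ∈ S)
    (i : Fin (n + 1)) : extend ρ x i ∈ S := by
  refine Fin.lastCases ?_ (fun i => ?_) i <;> simp [h, hx]

theorem append_mem {S : Set α} {ρ : Fin n → α} (h : ∀ i, ρ i ∈ S) {τ : Fin m → α}
    (h' : ∀ i, τ i ∈ S) (i : Fin (n + m)) : Fin.append ρ τ i ∈ S := by
  refine Fin.addCases (fun i => ?_) (fun i => ?_) i <;> simp [h, h']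

end Extend

def SOTerm.rename {n n' : ℕ} (f : Fin n → Fin n') : SOTerm n → SOTerm n'
  | .var i => .var (f i)
  | .zero => .zero
  | .succ t => .succ (t.rename f)
  | .add s t => .add (s.rename f) (t.rename f)
  | .mul s t => .mul (s.rename f) (t.rename f)

def SOFormula.rename : {n m n' m' : ℕ} → (Fin n → Fin n') → (Fin m → Fin m') →
    SOFormula n m → SOFormula n' m'
  | _, _, _, _, f, _, .eq s t => .eq (s.rename f) (t.rename f)
  | _, _, _, _, f, _, .lt s t => .lt (s.rename f) (t.rename f)
  | _, _, _, _, f, g, .mem t X => .mem (t.rename f) (g X)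
  | _, _, _, _, _, _, .bot => .bot
  | _, _, _, _, f, g, .imp φ ψ => .imp (φ.rename f g) (ψ.rename f g)
  | _, _, n', _, f, g, .allNum φ =>
      .allNum (φ.rename (extend (fun j => (f j).castSucc) (Fin.last n')) g)
  | _, _, _, m', f, g, .allSet φ =>
      .allSet (φ.rename f (extend (fun j => (g j).castSucc) (Fin.last m')))

namespace Henkin

theorem termVal_rename (𝔐 : Henkin.{u}) {n n' : ℕ} (f : Fin n → Fin n') (ρ : Fin n' → 𝔐.N)
    (t : SOTerm n) : 𝔐.termVal ρ (t.rename f) = 𝔐.termVal (fun i => ρ (f i)) t := by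
  induction t <;> simp_all [SOTerm.rename, termVal]

theorem sat_rename (𝔐 : Henkin.{u}) {n m : ℕ} (φ : SOFormula n m) :
    ∀ {n' m' : ℕ} (f : Fin n → Fin n') (g : Fin m → Fin m') (ρ : Fin n' → 𝔐.N)
      (σ : Fin m' → Set 𝔐.N),
      𝔐.Sat (φ.rename f g) ρ σ ↔ 𝔐.Sat φ (fun i => ρ (f i)) (fun i => σ (g i)) := by
  induction φ <;> intros <;> simp_all [SOFormula.rename, Sat, termVal_rename, extend_comp_lift]

/-! ## Definability

A family `K` of structures; `Dfn K par n m P` says that one formula defines the predicate `P` in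
all members of the family. If `par` holds, the formula may use parameters from the structures. -/

section Definability

variable {I : Type*}

/-- `P` is definable, uniformly in the family `K`. -/
class Dfn (K : I → Henkin.{u}) (par : Prop) (n m : ℕ)
    (P : ∀ i, (Fin n → (K i).N) → (Fin m → Set (K i).N) → Prop) : Prop where
  out : ∃ (k l : ℕ) (φ : SOFormula (k + n) (l + m)) (a : ∀ i, Fin k → (K i).N)
    (A : ∀ i, Fin l → Set (K i).N), (par ∨ k = 0 ∧ l = 0) ∧ (∀ i j, A i j ∈ (K i).sets) ∧
    ∀ i ρ σ, (∀ j, σ j ∈ (K i).sets) →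
      ((K i).Sat φ (Fin.append (a i) ρ) (Fin.append (A i) σ) ↔ P i ρ σ)

/-- The number-valued function `f` has a definable graph. -/
class DfnF (K : I → Henkin.{u}) (par : Prop) (n m : ℕ)
    (f : ∀ i, (Fin n → (K i).N) → (Fin m → Set (K i).N) → (K i).N) : Prop where
  out : Dfn K par (n + 1) m (fun i ρ σ => ρ (Fin.last n) = f i (fun j => ρ j.castSucc) σ)

/-- The set-valued function `X` is definable. -/
class DfnS (K : I → Henkin.{u}) (par : Prop) (n m : ℕ)
    (X : ∀ i, (Fin n → (K i).N) → (Fin m → Set (K i).N) → Set (K i).N) : Prop where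
  out : Dfn K par (n + 1) m (fun i ρ σ => ρ (Fin.last n) ∈ X i (fun j => ρ j.castSucc) σ)

/-- A tuple of definable set-valued functions. -/
class DfnV (K : I → Henkin.{u}) (par : Prop) (n m : ℕ) {k : ℕ}
    (X : ∀ i, (Fin n → (K i).N) → (Fin m → Set (K i).N) → Fin k → Set (K i).N) : Prop where
  out : ∀ j, DfnS K par n m (fun i ρ σ => X i ρ σ j)

variable {K : I → Henkin.{u}} {par : Prop} {n m : ℕ}

theorem Dfn.of_formula {P : ∀ i, (Fin n → (K i).N) → (Fin m → Set (K i).N) → Prop}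
    (φ : SOFormula n m)
    (h : ∀ i ρ σ, (∀ j, σ j ∈ (K i).sets) → ((K i).Sat φ ρ σ ↔ P i ρ σ)) : Dfn K par n m P := by
  refine ⟨0, 0, φ.rename (Fin.natAdd 0) (Fin.natAdd 0), fun _ => Fin.elim0, fun _ => Fin.elim0,
    Or.inr ⟨rfl, rfl⟩, fun _ j => j.elim0, fun i ρ σ hσ => ?_⟩
  rw [sat_rename]
  simpa using h i ρ σ hσ

/-- Agreement is required only when the set variables take values in the structure. A condition such
as `X ∈ sets` for definable `X` is then definable because it is always true. -/
theorem Dfn.congr {P Q : ∀ i, (Fin n → (K i).N) → (Fin m → Set (K i).N) → Prop}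
    (h : Dfn K par n m P) (hPQ : ∀ i ρ σ, (∀ j, σ j ∈ (K i).sets) → (P i ρ σ ↔ Q i ρ σ)) :
    Dfn K par n m Q := by
  obtain ⟨k, l, φ, a, A, hp, hA, h⟩ := h
  exact ⟨k, l, φ, a, A, hp, hA, fun i ρ σ hσ => (h i ρ σ hσ).trans (hPQ i ρ σ hσ)⟩

theorem Dfn.rename {n' m' : ℕ} {P : ∀ i, (Fin n → (K i).N) → (Fin m → Set (K i).N) → Prop}
    (h : Dfn K par n m P) (f : Fin n → Fin n') (g : Fin m → Fin m') :
    Dfn K par n' m' (fun i ρ σ => P i (fun j => ρ (f j)) (fun j => σ (g j))) := by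
  obtain ⟨k, l, φ, a, A, hp, hA, h⟩ := h
  refine ⟨k, l, φ.rename (Fin.append (Fin.castAdd n') (fun j => Fin.natAdd k (f j)))
    (Fin.append (Fin.castAdd m') (fun j => Fin.natAdd l (g j))), a, A, hp, hA,
    fun i ρ σ hσ => ?_⟩
  rw [sat_rename, ← h i _ _ (fun j => hσ _)]
  refine iff_of_eq (congrArg₂ _ ?_ ?_) <;> funext j <;>
    refine Fin.addCases (fun j => ?_) (fun j => ?_) j <;> simp

/-- Two definitions may use different parameters. Concatenating the parameter tuples, and renaming
variables accordingly, lets them be combined under one connective; if parameters are forbidden, both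
tuples are empty and so is the concatenation. -/
theorem Dfn.exists_common {P Q : ∀ i, (Fin n → (K i).N) → (Fin m → Set (K i).N) → Prop}
    (hP : Dfn K par n m P) (hQ : Dfn K par n m Q) :
    ∃ (k l : ℕ) (φ ψ : SOFormula (k + n) (l + m)) (a : ∀ i, Fin k → (K i).N)
    (A : ∀ i, Fin l → Set (K i).N), (par ∨ k = 0 ∧ l = 0) ∧ (∀ i j, A i j ∈ (K i).sets) ∧
    (∀ i ρ σ, (∀ j, σ j ∈ (K i).sets) →
      ((K i).Sat φ (Fin.append (a i) ρ) (Fin.append (A i) σ) ↔ P i ρ σ)) ∧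
    ∀ i ρ σ, (∀ j, σ j ∈ (K i).sets) →
      ((K i).Sat ψ (Fin.append (a i) ρ) (Fin.append (A i) σ) ↔ Q i ρ σ) := by
  obtain ⟨k, l, φ, a, A, hp, hA, h⟩ := hP
  obtain ⟨k', l', φ', a', A', hp', hA', h'⟩ := hQ
  refine ⟨k + k', l + l',
    φ.rename (Fin.append (fun j => Fin.castAdd n (Fin.castAdd k' j)) (Fin.natAdd _))
      (Fin.append (fun j => Fin.castAdd m (Fin.castAdd l' j)) (Fin.natAdd _)),
    φ'.rename (Fin.append (fun j => Fin.castAdd n (Fin.natAdd k j)) (Fin.natAdd _))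
      (Fin.append (fun j => Fin.castAdd m (Fin.natAdd l j)) (Fin.natAdd _)),
    fun i => Fin.append (a i) (a' i), fun i => Fin.append (A i) (A' i), ?_,
    fun i => append_mem (hA i) (hA' i), fun i ρ σ hσ => ?_, fun i ρ σ hσ => ?_⟩
  · rcases hp with hp | ⟨rfl, rfl⟩
    · exact Or.inl hp
    · rcases hp' with hp | ⟨rfl, rfl⟩
      · exact Or.inl hp
      · exact Or.inr ⟨rfl, rfl⟩
  · rw [sat_rename, ← h i _ _ hσ]
    refine iff_of_eq (congrArg₂ _ ?_ ?_) <;> funext j <;>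
      refine Fin.addCases (fun j => ?_) (fun j => ?_) j <;> simp
  · rw [sat_rename, ← h' i _ _ hσ]
    refine iff_of_eq (congrArg₂ _ ?_ ?_) <;> funext j <;>
      refine Fin.addCases (fun j => ?_) (fun j => ?_) j <;> simp

/-- Implication, falsity and the two universal quantifiers are the primitive steps. The other
connectives reduce to them classically, and instance search then plays the role of writing out a
second-order formula. -/
instance Dfn.imp {P Q : ∀ i, (Fin n → (K i).N) → (Fin m → Set (K i).N) → Prop}
    [hP : Dfn K par n m P] [hQ : Dfn K par n m Q] :
    Dfn K par n m (fun i ρ σ => P i ρ σ → Q i ρ σ) := by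
  obtain ⟨k, l, φ, ψ, a, A, hp, hA, h, h'⟩ := hP.exists_common hQ
  refine ⟨k, l, φ.imp ψ, a, A, hp, hA, fun i ρ σ hσ => ?_⟩
  simp [Sat, h i ρ σ hσ, h' i ρ σ hσ]

instance Dfn.allNum {P : ∀ i, (Fin n → (K i).N) → (K i).N → (Fin m → Set (K i).N) → Prop}
    [hP : Dfn K par (n + 1) m (fun i ρ σ => P i (fun j => ρ j.castSucc) (ρ (Fin.last n)) σ)] :
    Dfn K par n m (fun i ρ σ => ∀ x : (K i).N, P i ρ x σ) := by
  obtain ⟨k, l, φ, a, A, hp, hA, h⟩ := hP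
  refine ⟨k, l, φ.allNum, a, A, hp, hA, fun i ρ σ hσ => forall_congr' fun x => ?_⟩
  have := h i (extend ρ x) σ hσ
  rw [append_extend] at this
  simpa using this

instance Dfn.allSet {P : ∀ i, (Fin n → (K i).N) → (Fin m → Set (K i).N) → Set (K i).N → Prop}
    [hP : Dfn K par n (m + 1) (fun i ρ σ => P i ρ (fun j => σ j.castSucc) (σ (Fin.last m)))] :
    Dfn K par n m (fun i ρ σ => ∀ X ∈ (K i).sets, P i ρ σ X) := by
  obtain ⟨k, l, φ, a, A, hp, hA, h⟩ := hP
  refine ⟨k, l, φ.allSet, a, A, hp, hA, fun i ρ σ hσ => forall₂_congr fun X hX => ?_⟩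
  have := h i ρ (extend σ X) (extend_mem hσ hX)
  rw [append_extend] at this
  simpa using this

instance Dfn.false : Dfn K par n m (fun _ _ _ => False) :=
  .of_formula .bot fun _ _ _ _ => by simp [Sat]

instance Dfn.true : Dfn K par n m (fun _ _ _ => True) :=
  .of_formula (.imp .bot .bot) fun _ _ _ _ => by simp [Sat]

section Connectives

variable {P Q : ∀ i, (Fin n → (K i).N) → (Fin m → Set (K i).N) → Prop}

instance Dfn.not [hP : Dfn K par n m P] : Dfn K par n m (fun i ρ σ => ¬ P i ρ σ) :=
  Dfn.imp (Q := fun _ _ _ => False)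

instance Dfn.and [hP : Dfn K par n m P] [hQ : Dfn K par n m Q] :
    Dfn K par n m (fun i ρ σ => P i ρ σ ∧ Q i ρ σ) :=
  Dfn.congr (P := fun i ρ σ => ¬ (P i ρ σ → ¬ Q i ρ σ)) inferInstance fun _ _ _ _ => by tauto

instance Dfn.or [hP : Dfn K par n m P] [hQ : Dfn K par n m Q] :
    Dfn K par n m (fun i ρ σ => P i ρ σ ∨ Q i ρ σ) :=
  Dfn.congr (P := fun i ρ σ => ¬ P i ρ σ → Q i ρ σ) inferInstance fun _ _ _ _ => by tauto

instance Dfn.iff [hP : Dfn K par n m P] [hQ : Dfn K par n m Q] :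
    Dfn K par n m (fun i ρ σ => P i ρ σ ↔ Q i ρ σ) :=
  Dfn.congr (P := fun i ρ σ => (P i ρ σ → Q i ρ σ) ∧ (Q i ρ σ → P i ρ σ)) inferInstance
    fun _ _ _ _ => by tauto

end Connectives

instance Dfn.exNum {P : ∀ i, (Fin n → (K i).N) → (K i).N → (Fin m → Set (K i).N) → Prop}
    [hP : Dfn K par (n + 1) m (fun i ρ σ => P i (fun j => ρ j.castSucc) (ρ (Fin.last n)) σ)] :
    Dfn K par n m (fun i ρ σ => ∃ x : (K i).N, P i ρ x σ) :=
  Dfn.congr (P := fun i ρ σ => ¬ ∀ x, ¬ P i ρ x σ) inferInstance fun _ _ _ _ => by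
    simp

instance Dfn.exSet {P : ∀ i, (Fin n → (K i).N) → (Fin m → Set (K i).N) → Set (K i).N → Prop}
    [hP : Dfn K par n (m + 1) (fun i ρ σ => P i ρ (fun j => σ j.castSucc) (σ (Fin.last m)))] :
    Dfn K par n m (fun i ρ σ => ∃ X ∈ (K i).sets, P i ρ σ X) :=
  Dfn.congr (P := fun i ρ σ => ¬ ∀ X ∈ (K i).sets, ¬ P i ρ σ X) inferInstance fun _ _ _ _ => by
    simp

/-! ### Definable functions -/

theorem Dfn.of_terms_eq (s t : SOTerm n) :
    Dfn K par n m (fun i ρ _ => (K i).termVal ρ s = (K i).termVal ρ t) :=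
  .of_formula (.eq s t) fun _ _ _ _ => by simp [Sat]

instance DfnF.var (j : Fin n) : DfnF K par n m (fun _ ρ _ => ρ j) :=
  ⟨Dfn.of_terms_eq (.var (Fin.last n)) (.var j.castSucc)⟩

instance DfnF.zero : DfnF K par n m (fun i _ _ => (K i).zero) :=
  ⟨Dfn.of_terms_eq (.var (Fin.last n)) .zero⟩

/-- An arbitrary element of each structure is a parameter, hence the value `True` for `par`. In the
parameter-free setting only uniformly definable constants such as numerals are available. -/
instance DfnF.const (c : ∀ i, (K i).N) : DfnF K True n m (fun i _ _ => c i) :=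
  ⟨⟨1, 0, .eq (.var (Fin.last _)) (.var ⟨0, by omega⟩), fun i _ => c i, fun _ => Fin.elim0,
    Or.inl trivial, fun _ j => j.elim0, fun i ρ σ _ => by
      have h1 : (Fin.last (1 + n) : Fin (1 + (n + 1))) = Fin.natAdd 1 (Fin.last n) := by
        ext; simp
      have h2 : (⟨0, by omega⟩ : Fin (1 + (n + 1))) = Fin.castAdd (n + 1) 0 := by
        ext; simp
      simp only [Sat, termVal]
      erw [h1, h2, Fin.append_right, Fin.append_left]⟩⟩

/-- Substitution of definable functions for a block of number variables. -/
theorem Dfn.substNum {n' : ℕ} : ∀ {P : ∀ i, (Fin n → (K i).N) → (Fin n' → (K i).N) →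
      (Fin m → Set (K i).N) → Prop}
    (_ : Dfn K par (n + n') m
      (fun i ρ σ => P i (fun j => ρ (Fin.castAdd n' j)) (fun j => ρ (Fin.natAdd n j)) σ))
    (f : Fin n' → ∀ i, (Fin n → (K i).N) → (Fin m → Set (K i).N) → (K i).N)
    (_ : ∀ j, DfnF K par n m (f j)),
    Dfn K par n m (fun i ρ σ => P i ρ (fun j => f j i ρ σ) σ) := by
  induction n' with
  | zero =>
    intro P hP f _
    refine hP.congr fun i ρ σ _ => iff_of_eq ?_
    congr 1; funext j; exact j.elim0
  | succ n' ih =>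
    intro P hP f hf
    have hlast : Dfn K par (n + (n' + 1)) m
        (fun i ρ σ => ρ (Fin.last (n + n')) = f (Fin.last n') i (fun j => ρ (Fin.castAdd _ j)) σ) :=
      ((hf (Fin.last n')).out.rename
        (extend (fun j => Fin.castAdd (n' + 1) j) (Fin.last (n + n'))) id).congr fun i ρ σ _ => by
          simp
    -- The last function of the block is eliminated through its graph: `P` at the value of `f` is
    -- written as "some `x` equals that value and `P` holds at `x`".
    refine (ih (P := fun i ρ τ σ => ∃ x, x = f (Fin.last n') i ρ σ ∧ P i ρ (extend τ x) σ)
      (Dfn.exNum (hP := ?_)) (fun j => f j.castSucc) (fun j => hf _)).congr fun i ρ σ _ => ?_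
    · refine (Dfn.and (hP := hlast) (hQ := hP)).congr fun i ρ σ _ => ?_
      refine and_congr Iff.rfl (iff_of_eq ?_)
      congr 1
      symm
      rw [extend_eq_iff]
      exact ⟨fun j => rfl, rfl⟩
    · simp only [exists_eq_left]
      refine iff_of_eq ?_
      congr 1
      simp [extend_eq_iff]

theorem Dfn.subst₁ {P : ∀ i, (K i).N → Prop} (hP : Dfn K par 1 0 (fun i ρ _ => P i (ρ 0)))
    {f : ∀ i, (Fin n → (K i).N) → (Fin m → Set (K i).N) → (K i).N} [hf : DfnF K par n m f] :
    Dfn K par n m (fun i ρ σ => P i (f i ρ σ)) :=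
  Dfn.substNum (P := fun i _ τ _ => P i (τ 0)) (hP.rename (Fin.natAdd n) Fin.elim0)
    (fun _ => f) (fun _ => hf)

section Binary

variable {f g h : ∀ i, (Fin n → (K i).N) → (Fin m → Set (K i).N) → (K i).N}
  [hf : DfnF K par n m f] [hg : DfnF K par n m g] [hh : DfnF K par n m h]

include hf hg

theorem Dfn.subst₂ {P : ∀ i, (K i).N → (K i).N → Prop}
    (hP : Dfn K par 2 0 (fun i ρ _ => P i (ρ 0) (ρ 1))) :
    Dfn K par n m (fun i ρ σ => P i (f i ρ σ) (g i ρ σ)) :=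
  Dfn.substNum (P := fun i _ τ _ => P i (τ 0) (τ 1)) (hP.rename (Fin.natAdd n) Fin.elim0)
    ![f, g] (fun j => by fin_cases j; exacts [hf, hg])

include hh in
theorem Dfn.subst₃ {P : ∀ i, (K i).N → (K i).N → (K i).N → Prop}
    (hP : Dfn K par 3 0 (fun i ρ _ => P i (ρ 0) (ρ 1) (ρ 2))) :
    Dfn K par n m (fun i ρ σ => P i (f i ρ σ) (g i ρ σ) (h i ρ σ)) :=
  Dfn.substNum (P := fun i _ τ _ => P i (τ 0) (τ 1) (τ 2)) (hP.rename (Fin.natAdd n) Fin.elim0)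
    ![f, g, h] (fun j => by fin_cases j; exacts [hf, hg, hh])

instance Dfn.eq : Dfn K par n m (fun i ρ σ => f i ρ σ = g i ρ σ) :=
  Dfn.subst₂ (Dfn.of_terms_eq (.var 0) (.var 1))

instance Dfn.lt : Dfn K par n m (fun i ρ σ => (K i).lt (f i ρ σ) (g i ρ σ)) :=
  Dfn.subst₂ (.of_formula (.lt (.var 0) (.var 1)) fun _ _ _ _ => Iff.rfl)

theorem DfnF.subst₂ {F : ∀ i, (K i).N → (K i).N → (K i).N}
    (hF : Dfn K par 3 0 (fun i ρ _ => ρ 2 = F i (ρ 0) (ρ 1))) :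
    DfnF K par n m (fun i ρ σ => F i (f i ρ σ) (g i ρ σ)) :=
  ⟨Dfn.subst₃ (f := fun i ρ σ => f i (fun j => ρ j.castSucc) σ)
    (g := fun i ρ σ => g i (fun j => ρ j.castSucc) σ) (h := fun i ρ σ => ρ (Fin.last n))
    (P := fun i x y z => z = F i x y)
    (hf := ⟨(hf.out.rename (extend (fun j => j.castSucc.castSucc) (Fin.last _)) id).congr
      fun i ρ σ _ => by simp⟩)
    (hg := ⟨(hg.out.rename (extend (fun j => j.castSucc.castSucc) (Fin.last _)) id).congr
      fun i ρ σ _ => by simp⟩) hF⟩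

instance DfnF.add : DfnF K par n m (fun i ρ σ => (K i).add (f i ρ σ) (g i ρ σ)) :=
  DfnF.subst₂ (Dfn.of_terms_eq (.var 2) (.add (.var 0) (.var 1)))

instance DfnF.mul : DfnF K par n m (fun i ρ σ => (K i).mul (f i ρ σ) (g i ρ σ)) :=
  DfnF.subst₂ (Dfn.of_terms_eq (.var 2) (.mul (.var 0) (.var 1)))

-- The graph of the pairing, with its case distinction spelled as two implications so that only
-- primitive symbols occur.
omit hf hg in
theorem Dfn.pairGraph : Dfn K par 3 0 (fun i ρ _ => ((K i).lt (ρ 0) (ρ 1) → ρ 2 =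
      (K i).add ((K i).mul (ρ 1) (ρ 1)) (ρ 0)) ∧ (¬ (K i).lt (ρ 0) (ρ 1) → ρ 2 =
      (K i).add ((K i).add ((K i).mul (ρ 0) (ρ 0)) (ρ 0)) (ρ 1))) := inferInstance

instance DfnF.pair : DfnF K par n m (fun i ρ σ => (K i).pair (f i ρ σ) (g i ρ σ)) :=
  DfnF.subst₂ (Dfn.pairGraph.congr fun i ρ σ _ => by
    unfold Henkin.pair
    split_ifs with h <;> simp [h])

omit hg in
instance DfnF.succ : DfnF K par n m (fun i ρ σ => (K i).succ (f i ρ σ)) :=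
  DfnF.subst₂ (g := f) (F := fun i x _ => (K i).succ x)
    (Dfn.of_terms_eq (.var 2) (.succ (.var 0)))

omit hf hg in
instance DfnF.num (k : ℕ) : DfnF K par n m (fun i _ _ => (K i).num k) := by
  induction k with
  | zero => exact DfnF.zero
  | succ k ih => exact DfnF.succ

instance DfnF.cons : DfnF K par n m (fun i ρ σ => (K i).cons (f i ρ σ) (g i ρ σ)) :=
  DfnF.succ

omit hf hg in
instance DfnF.nil : DfnF K par n m (fun i _ _ => (K i).nil) := DfnF.zero

omit hg in
instance DfnF.single : DfnF K par n m (fun i ρ σ => (K i).single (f i ρ σ)) :=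
  DfnF.cons

end Binary

/-! ### Definable sets -/

section Sets

variable {f g h : ∀ i, (Fin n → (K i).N) → (Fin m → Set (K i).N) → (K i).N}
  {X Y : ∀ i, (Fin n → (K i).N) → (Fin m → Set (K i).N) → Set (K i).N}

instance DfnS.var (j : Fin m) : DfnS K par n m (fun _ _ σ => σ j) :=
  ⟨.of_formula (.mem (.var (Fin.last n)) j) fun _ _ _ _ => by simp [Sat, termVal]⟩

instance DfnS.const (S : ∀ i, Set (K i).N) [hS : ∀ i, Fact (S i ∈ (K i).sets)] :
    DfnS K True n m (fun i _ _ => S i) :=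
  ⟨⟨0, 1, .mem (.var (Fin.last _)) ⟨0, by omega⟩, fun _ => Fin.elim0, fun i _ => S i,
    Or.inl trivial, fun i j => (hS i).out, fun i ρ σ _ => by
      have h1 : (Fin.last (0 + n) : Fin (0 + (n + 1))) = Fin.natAdd 0 (Fin.last n) := by
        ext; simp
      have h2 : (⟨0, by omega⟩ : Fin (1 + m)) = Fin.castAdd m 0 := by
        ext; simp
      simp only [Sat, termVal]
      erw [h1, h2, Fin.append_right, Fin.append_left]⟩⟩

instance Dfn.mem [hf : DfnF K par n m f] [hX : DfnS K par n m X] :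
    Dfn K par n m (fun i ρ σ => f i ρ σ ∈ X i ρ σ) :=
  Dfn.substNum (n' := 1) (P := fun i ρ τ σ => τ 0 ∈ X i ρ σ) hX.out (fun _ => f) (fun _ => hf)

instance DfnS.setOf {P : ∀ i, (Fin n → (K i).N) → (Fin m → Set (K i).N) → (K i).N → Prop}
    [hP : Dfn K par (n + 1) m (fun i ρ σ => P i (fun j => ρ j.castSucc) σ (ρ (Fin.last n)))] :
    DfnS K par n m (fun i ρ σ => {x | P i ρ σ x}) := ⟨hP⟩

instance DfnF.weaken [hf : DfnF K par n m f] :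
    DfnF K par (n + 1) m (fun i ρ σ => f i (fun j => ρ j.castSucc) σ) :=
  ⟨(hf.out.rename (extend (fun j => j.castSucc.castSucc) (Fin.last _)) id).congr
      fun i ρ σ _ => by simp⟩

instance DfnS.weaken [hX : DfnS K par n m X] :
    DfnS K par (n + 1) m (fun i ρ σ => X i (fun j => ρ j.castSucc) σ) :=
  ⟨(hX.out.rename (extend (fun j => j.castSucc.castSucc) (Fin.last _)) id).congr
      fun i ρ σ _ => by simp⟩

instance DfnS.row [DfnF K par n m f] [DfnS K par n m X] :
    DfnS K par n m (fun i ρ σ => (K i).row (X i ρ σ) (f i ρ σ)) := by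
  unfold Henkin.row; infer_instance

instance DfnS.down [DfnF K par n m f] [DfnS K par n m X] :
    DfnS K par n m (fun i ρ σ => (K i).down (X i ρ σ) (f i ρ σ)) := by
  unfold Henkin.down; infer_instance

instance DfnS.immd [DfnS K par n m X] :
    DfnS K par n m (fun i ρ σ => (K i).immd (X i ρ σ)) := by
  unfold Henkin.immd; infer_instance

instance Dfn.rel₂ [DfnF K par n m f] [DfnF K par n m g] [DfnS K par n m X] :
    Dfn K par n m (fun i ρ σ => (K i).rel₂ (X i ρ σ) (f i ρ σ) (g i ρ σ)) := by
  unfold Henkin.rel₂; infer_instance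

instance Dfn.rel₃ [DfnF K par n m f] [DfnF K par n m g] [DfnF K par n m h] [DfnS K par n m X] :
    Dfn K par n m (fun i ρ σ => (K i).rel₃ (X i ρ σ) (f i ρ σ) (g i ρ σ) (h i ρ σ)) := by
  unfold Henkin.rel₃; infer_instance

instance Dfn.setEq [DfnS K par n m X] [DfnS K par n m Y] :
    Dfn K par n m (fun i ρ σ => X i ρ σ = Y i ρ σ) :=
  Dfn.congr (P := fun i ρ σ => ∀ x, x ∈ X i ρ σ ↔ x ∈ Y i ρ σ) inferInstance
    fun _ _ _ _ => Set.ext_iff.symm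

instance Dfn.existsUnique {P : ∀ i, (Fin n → (K i).N) → (K i).N → (Fin m → Set (K i).N) → Prop}
    [hP : Dfn K par (n + 1) m (fun i ρ σ => P i (fun j => ρ j.castSucc) (ρ (Fin.last n)) σ)] :
    Dfn K par n m (fun i ρ σ => ∃! x : (K i).N, P i ρ x σ) := by
  have : Dfn K par (n + 1 + 1) m
      (fun i ρ σ => P i (fun j => ρ j.castSucc.castSucc) (ρ (Fin.last (n + 1))) σ) :=
    (hP.rename (extend (fun j => j.castSucc.castSucc) (Fin.last (n + 1))) id).congr
      fun i ρ σ _ => by simp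
  unfold ExistsUnique
  exact Dfn.exNum (hP := Dfn.and (hQ := Dfn.allNum
    (P := fun i ρ x σ => P i (fun j => ρ j.castSucc) x σ → x = ρ (Fin.last n))))

end Sets

/-! ### Comprehension for definable predicates -/

section Model

variable [hK : ∀ i, Fact (K i).IsModelZ2]

include hK

theorem Dfn.comprehension {P : ∀ i, (Fin n → (K i).N) → (Fin m → Set (K i).N) → (K i).N → Prop}
    (hP : Dfn K par (n + 1) m (fun i ρ σ => P i (fun j => ρ j.castSucc) σ (ρ (Fin.last n))))
    (i : I) (ρ : Fin n → (K i).N) (σ : Fin m → Set (K i).N) (hσ : ∀ j, σ j ∈ (K i).sets) :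
    {x | P i ρ σ x} ∈ (K i).sets := by
  obtain ⟨k, l, φ, a, A, hp, hA, h⟩ := hP
  convert (hK i).out.comprehension φ (Fin.append (a i) ρ) (Fin.append (A i) σ)
    (append_mem (hA i) hσ) using 3 with x
  rw [← append_extend, h i _ _ hσ]
  simp

theorem DfnS.mem_sets {X : ∀ i, (Fin n → (K i).N) → (Fin m → Set (K i).N) → Set (K i).N}
    (hX : DfnS K par n m X) (i : I) (ρ : Fin n → (K i).N) (σ : Fin m → Set (K i).N)
    (hσ : ∀ j, σ j ∈ (K i).sets) : X i ρ σ ∈ (K i).sets :=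
  Dfn.comprehension (P := fun i ρ σ x => x ∈ X i ρ σ) hX.out i ρ σ hσ

/-- Substitution of definable sets for a block of set variables. -/
theorem Dfn.substSet {m' : ℕ} : ∀ {P : ∀ i, (Fin n → (K i).N) → (Fin m → Set (K i).N) →
      (Fin m' → Set (K i).N) → Prop}
    (_ : Dfn K par n (m + m')
      (fun i ρ σ => P i ρ (fun j => σ (Fin.castAdd m' j)) (fun j => σ (Fin.natAdd m j))))
    (X : Fin m' → ∀ i, (Fin n → (K i).N) → (Fin m → Set (K i).N) → Set (K i).N)
    (_ : ∀ j, DfnS K par n m (X j)),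
    Dfn K par n m (fun i ρ σ => P i ρ σ (fun j => X j i ρ σ)) := by
  induction m' with
  | zero =>
    intro P hP X _
    refine hP.congr fun i ρ σ _ => iff_of_eq ?_
    congr 1; funext j; exact j.elim0
  | succ m' ih =>
    intro P hP X hX
    have hlast : Dfn K par n (m + (m' + 1))
        (fun i ρ σ => ∀ x, x ∈ σ (Fin.last (m + m')) ↔
          x ∈ X (Fin.last m') i ρ (fun j => σ (Fin.castAdd (m' + 1) j))) :=
      Dfn.allNum (P := fun i ρ x σ => x ∈ σ (Fin.last (m + m')) ↔
          x ∈ X (Fin.last m') i ρ (fun j => σ (Fin.castAdd (m' + 1) j)))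
        (hP := Dfn.iff (hQ := (hX (Fin.last m')).out.rename id (Fin.castAdd (m' + 1))))
    refine (ih (P := fun i ρ σ τ => ∃ Y ∈ (K i).sets, (∀ x, x ∈ Y ↔ x ∈ X (Fin.last m') i ρ σ) ∧
      P i ρ σ (extend τ Y))
      (Dfn.exSet (hP := ?_)) (fun j => X j.castSucc) (fun j => hX _)).congr fun i ρ σ hσ => ?_
    · refine (Dfn.and (hP := hlast) (hQ := hP)).congr fun i ρ σ _ => ?_
      refine and_congr Iff.rfl (iff_of_eq ?_)
      congr 1
      symm
      rw [extend_eq_iff]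
      exact ⟨fun j => rfl, rfl⟩
    · simp only [← Set.ext_iff]
      constructor
      · rintro ⟨Y, _, rfl, h⟩
        convert h using 1
        symm
        simp [extend_eq_iff]
      -- This is where comprehension is needed: a quantifier over sets of the structure can stand
      -- for substitution only because the definable set belongs to the structure.
      · refine fun h => ⟨X (Fin.last m') i ρ σ, (hX _).mem_sets i ρ σ hσ, rfl, ?_⟩
        convert h using 1
        simp [extend_eq_iff]

section Subst

variable {f g h : ∀ i, (Fin n → (K i).N) → (Fin m → Set (K i).N) → (K i).N}
  {X Y : ∀ i, (Fin n → (K i).N) → (Fin m → Set (K i).N) → Set (K i).N}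

theorem Dfn.substVec {n' m' : ℕ} {P : ∀ i, (Fin n' → (K i).N) → (Fin m' → Set (K i).N) → Prop}
    (hP : Dfn K par n' m' P)
    (f : Fin n' → ∀ i, (Fin n → (K i).N) → (Fin m → Set (K i).N) → (K i).N)
    (X : ∀ i, (Fin n → (K i).N) → (Fin m → Set (K i).N) → Fin m' → Set (K i).N)
    (hf : ∀ j, DfnF K par n m (f j)) (hX : DfnV K par n m X) :
    Dfn K par n m (fun i ρ σ => P i (fun j => f j i ρ σ) (X i ρ σ)) := by
  refine Dfn.substSet (P := fun i ρ σ τ => P i (fun j => f j i ρ σ) τ) ?_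
    (fun j i ρ σ => X i ρ σ j) hX.out
  have hf' : ∀ j, DfnF K par n (m + m')
      (fun i ρ σ => f j i ρ (fun j => σ (Fin.castAdd m' j))) :=
    fun j => ⟨(hf j).out.rename id (Fin.castAdd m')⟩
  exact Dfn.substNum (n' := n') (P := fun i ρ τ σ => P i τ (fun j => σ (Fin.natAdd m j)))
    (hP.rename (Fin.natAdd n) (Fin.natAdd m)) _ hf'

theorem Dfn.substSet₁ {P : ∀ i, Set (K i).N → Prop} (hP : Dfn K par 0 1 (fun i _ σ => P i (σ 0)))
    [hX : DfnS K par n m X] :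
    Dfn K par n m (fun i ρ σ => P i (X i ρ σ)) :=
  Dfn.substVec hP Fin.elim0 (fun i ρ σ _ => X i ρ σ) (fun j => j.elim0) ⟨fun _ => hX⟩

end Subst

end Model

instance DfnV.comp {k : ℕ} (g : Fin k → Fin m) :
    DfnV K par n m (fun _ _ σ j => σ (g j)) := ⟨fun _ => inferInstance⟩

instance DfnV.const {k : ℕ} (S : ∀ i, Fin k → Set (K i).N)
    [hS : Fact (∀ i j, S i j ∈ (K i).sets)] : DfnV K True n m (fun i _ _ => S i) :=
  ⟨fun j => have : ∀ i, Fact (S i j ∈ (K i).sets) := fun i => ⟨hS.out i j⟩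
    DfnS.const (fun i => S i j)⟩

instance DfnV.extend {k : ℕ}
    {s : ∀ i, (Fin n → (K i).N) → (Fin m → Set (K i).N) → Fin k → Set (K i).N}
    {X : ∀ i, (Fin n → (K i).N) → (Fin m → Set (K i).N) → Set (K i).N}
    [hs : DfnV K par n m s] [hX : DfnS K par n m X] :
    DfnV K par n m (fun i ρ σ => extend (s i ρ σ) (X i ρ σ)) := by
  refine ⟨fun j => ?_⟩
  refine Fin.lastCases ?_ (fun j => ?_) j
  · simpa using hX
  · simpa using hs.out j

instance DfnS.app {k : ℕ}
    {s : ∀ i, (Fin n → (K i).N) → (Fin m → Set (K i).N) → Fin k → Set (K i).N}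
    [hs : DfnV K par n m s] (j : Fin k) : DfnS K par n m (fun i ρ σ => s i ρ σ j) := hs.out j

end Definability

end Henkin

namespace Henkin

/-! ## A single model -/

section Model

variable (𝔐 : Henkin.{u})

/-- Definability of a unary predicate in a single structure, with parameters. -/
abbrev Def₁ (P : 𝔐.N → Prop) : Prop := Dfn (fun _ : Unit => 𝔐) True 1 0 (fun _ ρ _ => P (ρ 0))

/-- Definability of a binary relation in a single structure, with parameters. -/
abbrev Def₂ (P : 𝔐.N → 𝔐.N → Prop) : Prop :=
  Dfn (fun _ : Unit => 𝔐) True 2 0 (fun _ ρ _ => P (ρ 0) (ρ 1))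

/-- Definability of a ternary relation in a single structure, with parameters. -/
abbrev Def₃ (P : 𝔐.N → 𝔐.N → 𝔐.N → Prop) : Prop :=
  Dfn (fun _ : Unit => 𝔐) True 3 0 (fun _ ρ _ => P (ρ 0) (ρ 1) (ρ 2))

variable {𝔐} [hM : Fact 𝔐.IsModelZ2]

theorem setOf_mem_sets (P : 𝔐.N → Prop) (hP : 𝔐.Def₁ P := by infer_instance) :
    {x | P x} ∈ 𝔐.sets :=
  Dfn.comprehension (K := fun _ : Unit => 𝔐) (P := fun _ _ _ x => P x) hP () Fin.elim0 Fin.elim0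
    (fun j => j.elim0)

/-- The choice scheme for a predicate given semantically. The rows of `Z` belong to the structure by
comprehension, so the defining formula still means `P` when evaluated at them. -/
theorem choice_def (P : 𝔐.N → Set 𝔐.N → Prop)
    (hP : Dfn (fun _ : Unit => 𝔐) True 1 1 (fun _ ρ σ => P (ρ 0) (σ 0)) := by infer_instance)
    (h : ∀ x, ∃ X ∈ 𝔐.sets, P x X) : ∃ Z ∈ 𝔐.sets, ∀ x, P x (𝔐.row Z x) := by
  have hrow : ∀ Z ∈ 𝔐.sets, ∀ x, 𝔐.row Z x ∈ 𝔐.sets := fun Z hZ x =>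
    haveI : Fact (Z ∈ 𝔐.sets) := ⟨hZ⟩
    setOf_mem_sets (fun y => y ∈ 𝔐.row Z x)
  obtain ⟨k, l, φ, a, A, -, hA, hφ⟩ := hP
  have key : ∀ x, ∀ X ∈ 𝔐.sets, 𝔐.Sat φ (extend (Fin.append (a ()) Fin.elim0) x)
      (extend (Fin.append (A ()) Fin.elim0) X) ↔ P x X := fun x X hX => by
    have := hφ () (fun _ => x) (fun _ => X) (fun _ => hX)
    rw [← append_extend, ← append_extend]
    convert this using 3 <;> · funext j; fin_cases j; exact extend_last _ _
  obtain ⟨Z, hZ, h'⟩ := hM.out.choice φ (Fin.append (a ()) Fin.elim0)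
    (Fin.append (A ()) Fin.elim0) (append_mem (hA ()) (fun j => j.elim0)) fun x => by
      obtain ⟨X, hX, h⟩ := h x
      exact ⟨X, hX, (key x X hX).2 h⟩
  exact ⟨Z, hZ, fun x => (key x _ (hrow Z hZ x)).1 (h' x)⟩

/-! ## Arithmetic in a model -/

theorem induct (P : 𝔐.N → Prop) (hP : 𝔐.Def₁ P := by infer_instance) (h0 : P 𝔐.zero)
    (hs : ∀ x, P x → P (𝔐.succ x)) (x : 𝔐.N) : P x :=
  hM.out.induction _ (setOf_mem_sets P) h0 hs x

theorem eq_zero_or_succ (x : 𝔐.N) : x = 𝔐.zero ∨ ∃ y, x = 𝔐.succ y :=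
  induct (fun x => x = 𝔐.zero ∨ ∃ y, x = 𝔐.succ y) inferInstance (.inl rfl)
    (fun y _ => .inr ⟨y, rfl⟩) x

theorem succ_inj {x y : 𝔐.N} : 𝔐.succ x = 𝔐.succ y ↔ x = y :=
  ⟨hM.out.succ_inj x y, congrArg _⟩

theorem succ_ne_zero (x : 𝔐.N) : 𝔐.succ x ≠ 𝔐.zero := hM.out.succ_ne_zero x

theorem zero_ne_succ (x : 𝔐.N) : 𝔐.zero ≠ 𝔐.succ x := (hM.out.succ_ne_zero x).symm

theorem zero_add' (x : 𝔐.N) : 𝔐.add 𝔐.zero x = x :=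
  induct (fun x => 𝔐.add 𝔐.zero x = x) inferInstance (hM.out.add_zero _)
    (fun x h => by rw [hM.out.add_succ, h]) x

theorem succ_add' (x y : 𝔐.N) : 𝔐.add (𝔐.succ x) y = 𝔐.succ (𝔐.add x y) :=
  induct (fun y => 𝔐.add (𝔐.succ x) y = 𝔐.succ (𝔐.add x y)) inferInstance
    (by rw [hM.out.add_zero, hM.out.add_zero])
    (fun y h => by rw [hM.out.add_succ, hM.out.add_succ, h]) y

theorem add_comm' (x y : 𝔐.N) : 𝔐.add x y = 𝔐.add y x :=
  induct (fun y => 𝔐.add x y = 𝔐.add y x) inferInstance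
    (by rw [hM.out.add_zero, zero_add'])
    (fun y h => by rw [hM.out.add_succ, succ_add', h]) y

theorem add_assoc' (x y z : 𝔐.N) : 𝔐.add (𝔐.add x y) z = 𝔐.add x (𝔐.add y z) :=
  induct (fun z => 𝔐.add (𝔐.add x y) z = 𝔐.add x (𝔐.add y z)) inferInstance
    (by rw [hM.out.add_zero, hM.out.add_zero])
    (fun y h => by rw [hM.out.add_succ, hM.out.add_succ, hM.out.add_succ, h]) z

theorem zero_mul' (x : 𝔐.N) : 𝔐.mul 𝔐.zero x = 𝔐.zero :=
  induct (fun x => 𝔐.mul 𝔐.zero x = 𝔐.zero) inferInstance (hM.out.mul_zero _)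
    (fun x h => by rw [hM.out.mul_succ, h, hM.out.add_zero]) x

theorem succ_mul' (x y : 𝔐.N) : 𝔐.mul (𝔐.succ x) y = 𝔐.add (𝔐.mul x y) y :=
  induct (fun y => 𝔐.mul (𝔐.succ x) y = 𝔐.add (𝔐.mul x y) y) inferInstance
    (by rw [hM.out.mul_zero, hM.out.add_zero, hM.out.mul_zero])
    (fun y h => by
      rw [hM.out.mul_succ, hM.out.mul_succ, h, hM.out.add_succ, hM.out.add_succ, add_assoc',
        add_assoc', add_comm' y x]) y

theorem mul_comm' (x y : 𝔐.N) : 𝔐.mul x y = 𝔐.mul y x :=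
  induct (fun y => 𝔐.mul x y = 𝔐.mul y x) inferInstance
    (by rw [hM.out.mul_zero, zero_mul'])
    (fun y h => by rw [hM.out.mul_succ, succ_mul', h]) y

theorem mul_add' (x y z : 𝔐.N) : 𝔐.mul x (𝔐.add y z) = 𝔐.add (𝔐.mul x y) (𝔐.mul x z) :=
  induct (fun z => 𝔐.mul x (𝔐.add y z) = 𝔐.add (𝔐.mul x y) (𝔐.mul x z)) inferInstance
    (by rw [hM.out.mul_zero, hM.out.add_zero, hM.out.add_zero])
    (fun z h => by rw [hM.out.mul_succ, hM.out.add_succ, hM.out.mul_succ, h, add_assoc']) z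

theorem mul_assoc' (x y z : 𝔐.N) : 𝔐.mul (𝔐.mul x y) z = 𝔐.mul x (𝔐.mul y z) :=
  induct (fun z => 𝔐.mul (𝔐.mul x y) z = 𝔐.mul x (𝔐.mul y z)) inferInstance
    (by rw [hM.out.mul_zero, hM.out.mul_zero, hM.out.mul_zero])
    (fun z h => by rw [hM.out.mul_succ, hM.out.mul_succ, mul_add', h]) z

/-- With this structure on the possibly nonstandard numbers, `ring` can do the arithmetic behind the
pairing function. -/
noncomputable instance : CommSemiring 𝔐.N where
  zero := 𝔐.zero
  one := 𝔐.succ 𝔐.zero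
  add := 𝔐.add
  mul := 𝔐.mul
  add_assoc := add_assoc'
  zero_add := zero_add'
  add_zero := hM.out.add_zero
  add_comm := add_comm'
  nsmul := @nsmulRec _ ⟨𝔐.zero⟩ ⟨𝔐.add⟩
  nsmul_zero _ := rfl
  nsmul_succ _ _ := rfl
  mul_assoc := mul_assoc'
  mul_comm := mul_comm'
  mul_zero := hM.out.mul_zero
  zero_mul := zero_mul'
  one_mul x := show 𝔐.mul (𝔐.succ 𝔐.zero) x = x by rw [succ_mul', zero_mul', zero_add']
  mul_one x := show 𝔐.mul x (𝔐.succ 𝔐.zero) = x by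
    rw [hM.out.mul_succ, hM.out.mul_zero, zero_add']
  left_distrib := mul_add'
  right_distrib x y z := show 𝔐.mul (𝔐.add x y) z = 𝔐.add (𝔐.mul x z) (𝔐.mul y z) by
    rw [mul_comm', mul_add', mul_comm' z x, mul_comm' z y]

theorem add_eq_add (x y : 𝔐.N) : 𝔐.add x y = x + y := rfl

theorem mul_eq_mul (x y : 𝔐.N) : 𝔐.mul x y = x * y := rfl

theorem succ_eq_add_one (x : 𝔐.N) : 𝔐.succ x = x + 1 := by
  show 𝔐.succ x = 𝔐.add x (𝔐.succ 𝔐.zero)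
  rw [hM.out.add_succ, hM.out.add_zero]

theorem zero_eq_zero : 𝔐.zero = 0 := rfl

theorem add_right_cancel' (x y z : 𝔐.N) : 𝔐.add x z = 𝔐.add y z → x = y :=
  induct (fun z => 𝔐.add x z = 𝔐.add y z → x = y) inferInstance
    (by simp [hM.out.add_zero])
    (fun z h h' => h (hM.out.succ_inj _ _ (by simpa only [hM.out.add_succ] using h'))) z

/-- The axioms describe the order only by recursion on its right argument. The additive form reduces
all later order facts to semiring identities and cancellation. -/
theorem lt_iff_exists (x y : 𝔐.N) : 𝔐.lt x y ↔ ∃ z, y = 𝔐.add x (𝔐.succ z) := by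
  refine induct (fun y => ∀ x, 𝔐.lt x y ↔ ∃ z, y = 𝔐.add x (𝔐.succ z)) inferInstance
    (fun x => ?_) (fun y h x => ?_) y x
  · refine iff_of_false (hM.out.not_lt_zero x) ?_
    rintro ⟨z, hz⟩
    rw [hM.out.add_succ] at hz
    exact zero_ne_succ _ hz
  · rw [hM.out.lt_succ, h x]
    constructor
    · rintro (⟨z, rfl⟩ | rfl)
      · exact ⟨𝔐.succ z, by rw [hM.out.add_succ x (𝔐.succ z)]⟩
      · exact ⟨𝔐.zero, by rw [hM.out.add_succ, hM.out.add_zero]⟩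
    · rintro ⟨z, hz⟩
      rw [hM.out.add_succ, succ_inj] at hz
      subst hz
      rcases eq_zero_or_succ z with rfl | ⟨z, rfl⟩
      · right; rw [hM.out.add_zero]
      · exact .inl ⟨z, rfl⟩

theorem lt_iff_exists' (x y : 𝔐.N) : 𝔐.lt x y ↔ ∃ z, y = x + z + 1 := by
  rw [lt_iff_exists]
  simp only [succ_eq_add_one, add_eq_add, add_assoc]

instance : IsCancelAdd 𝔐.N :=
  have h : IsRightCancelAdd 𝔐.N := ⟨fun x y z h => add_right_cancel' y z x h⟩
  { add_right_cancel := h.add_right_cancel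
    add_left_cancel := fun x y z h' => h.add_right_cancel x (by
      simpa [add_comm] using h') }

theorem lt_trichotomy' (x y : 𝔐.N) : 𝔐.lt x y ∨ x = y ∨ 𝔐.lt y x := by
  refine induct (fun x => 𝔐.lt x y ∨ x = y ∨ 𝔐.lt y x) inferInstance ?_ (fun x h => ?_) x
  · rcases eq_zero_or_succ y with rfl | ⟨y, rfl⟩
    · simp
    · left; rw [lt_iff_exists']; exact ⟨y, by rw [zero_eq_zero, zero_add, succ_eq_add_one]⟩
  · rcases h with h | rfl | h
    · obtain ⟨z, rfl⟩ := (lt_iff_exists' _ _).1 h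
      rcases eq_zero_or_succ z with rfl | ⟨z, rfl⟩
      · right; left; rw [zero_eq_zero, add_zero, succ_eq_add_one]
      · left; rw [lt_iff_exists']; exact ⟨z, by rw [succ_eq_add_one, succ_eq_add_one]; ring⟩
    · right; right; rw [hM.out.lt_succ]; exact .inr rfl
    · right; right; rw [hM.out.lt_succ]; exact .inl h

theorem add_one_ne_self (x z : 𝔐.N) : x + z + 1 ≠ x := fun h => by
  have : z + 1 = 0 := by
    refine add_left_cancel (a := x) ?_
    rw [← add_assoc, h, add_zero]
  exact succ_ne_zero z (by rw [succ_eq_add_one, this]; rfl)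

noncomputable instance : LinearOrder 𝔐.N where
  lt := 𝔐.lt
  le x y := 𝔐.lt x y ∨ x = y
  le_refl x := .inr rfl
  le_trans x y z := by
    rintro (h | rfl) (h' | rfl)
    · left
      obtain ⟨a, rfl⟩ := (lt_iff_exists' _ _).1 h
      obtain ⟨b, rfl⟩ := (lt_iff_exists' _ _).1 h'
      exact (lt_iff_exists' _ _).2 ⟨a + b + 1, by ring⟩
    · exact .inl h
    · exact .inl h'
    · exact .inr rfl
  lt_iff_le_not_ge x y := by
    refine ⟨fun h => ⟨.inl h, ?_⟩, fun h => h.1.resolve_right fun e => h.2 (.inr e.symm)⟩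
    obtain ⟨a, rfl⟩ := (lt_iff_exists' _ _).1 h
    rintro (h | h)
    · obtain ⟨b, h⟩ := (lt_iff_exists' _ _).1 h
      refine add_one_ne_self x (a + b + 1) ?_
      rw [eq_comm]; convert h using 1; ring
    · exact add_one_ne_self _ _ h
  le_antisymm x y := by
    rintro (h | rfl) (h' | h')
    · obtain ⟨a, rfl⟩ := (lt_iff_exists' _ _).1 h
      obtain ⟨b, h⟩ := (lt_iff_exists' _ _).1 h'
      exfalso; refine add_one_ne_self x (a + b + 1) ?_
      rw [eq_comm]; convert h using 1; ring
    · exact h'.symm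
    · rfl
    · rfl
  le_total x y := by
    rcases lt_trichotomy' x y with h | h | h
    · exact .inl (.inl h)
    · exact .inl (.inr h)
    · exact .inr (.inl h)
  toDecidableLE := Classical.decRel _

theorem lt_eq_lt (x y : 𝔐.N) : 𝔐.lt x y ↔ x < y := Iff.rfl

theorem lt_add_one_iff' (x y : 𝔐.N) : x < y + 1 ↔ x ≤ y := by
  rw [← succ_eq_add_one]; exact hM.out.lt_succ x y

theorem le_iff_exists_add' (x y : 𝔐.N) : x ≤ y ↔ ∃ z, y = x + z := by
  rw [← lt_add_one_iff', ← lt_eq_lt, lt_iff_exists']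
  simp

theorem le_add_self' (x y : 𝔐.N) : x ≤ x + y := (le_iff_exists_add' _ _).2 ⟨y, rfl⟩

theorem add_one_le_iff' (x y : 𝔐.N) : x + 1 ≤ y ↔ x < y := by
  rw [le_iff_exists_add', ← lt_eq_lt, lt_iff_exists']
  simp only [add_assoc, add_comm (1 : 𝔐.N)]

theorem strong_induct (P : 𝔐.N → Prop) (hP : 𝔐.Def₁ P) (h : ∀ x, (∀ y, y < x → P y) → P x)
    (x : 𝔐.N) : P x := by
  have hP' : 𝔐.Def₁ (fun x => ∀ y, 𝔐.lt y x → P y) := by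
    have : Dfn (fun _ : Unit => 𝔐) True (1 + 1) 0 (fun _ ρ _ => P (ρ (Fin.last 1))) :=
      hP.rename (fun _ => Fin.last 1) id
    infer_instance
  refine h x (induct (fun x => ∀ y, 𝔐.lt y x → P y) hP' (fun y hy => ?_) (fun x ih y hy => ?_) x)
  · exact absurd hy (hM.out.not_lt_zero y)
  · rcases (hM.out.lt_succ _ _).1 hy with hy | rfl
    · exact ih y hy
    · exact h y ih

theorem exists_least (P : 𝔐.N → Prop) (hP : 𝔐.Def₁ P) {x : 𝔐.N} (hx : P x) :
    ∃ y, P y ∧ ∀ z, 𝔐.lt z y → ¬ P z := by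
  by_contra! hc
  refine strong_induct (fun x => ¬ P x) (Dfn.not (hP := hP)) (fun x ih hx => ?_) x hx
  obtain ⟨z, hz, hPz⟩ := hc x hx
  exact ih z hz hPz

/-! ### Pairing -/

/-- Internal induction: on passing from `z` to its successor, the remainder grows by one until it
equals twice the root; then the root grows by one and the remainder restarts at zero. The induction
statement is spelled with the primitive symbols, since definability search does not know the
semiring and order notation. -/
theorem exists_sqrt (z : 𝔐.N) : ∃ k r, z = k * k + r ∧ r ≤ k + k := by
  refine induct (fun z => ∃ k r, z = 𝔐.add (𝔐.mul k k) r ∧ 𝔐.lt r (𝔐.succ (𝔐.add k k)))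
    inferInstance ?_ ?_ z |>.imp fun k => Exists.imp fun r h => ⟨h.1, ?_⟩
  · exact ⟨0, 0, by simp [add_eq_add, mul_eq_mul, zero_eq_zero], by
      rw [lt_eq_lt, succ_eq_add_one, lt_add_one_iff']; exact le_add_self' _ _⟩
  · rintro z ⟨k, r, rfl, h⟩
    rw [lt_eq_lt, succ_eq_add_one, add_eq_add, lt_add_one_iff'] at h
    rcases h.lt_or_eq with h | rfl
    · refine ⟨k, r + 1, ?_, ?_⟩
      · simp only [add_eq_add, mul_eq_mul, succ_eq_add_one]; ring
      · rw [lt_eq_lt, succ_eq_add_one, add_eq_add, lt_add_one_iff', add_one_le_iff']; exact h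
    · refine ⟨k + 1, 0, ?_, ?_⟩
      · simp only [add_eq_add, mul_eq_mul, succ_eq_add_one]; ring
      · rw [lt_eq_lt, succ_eq_add_one, add_eq_add, lt_add_one_iff', le_iff_exists_add']
        exact ⟨_, (zero_add _).symm⟩
  · have := h.2
    rwa [lt_eq_lt, succ_eq_add_one, add_eq_add, lt_add_one_iff'] at this

theorem sqrt_unique {k l r s : 𝔐.N} (h : k * k + r = l * l + s) (hr : r ≤ k + k)
    (hs : s ≤ l + l) : k = l ∧ r = s := by
  have key : ∀ k l r s : 𝔐.N, k * k + r = l * l + s → r ≤ k + k → ¬ k < l := by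
    intro k l r s h hr hkl
    obtain ⟨a, rfl⟩ := (lt_iff_exists' _ _).1 hkl
    obtain ⟨b, hb⟩ := (le_iff_exists_add' _ _).1 hr
    -- With `l = k + a + 1` and `k + k = r + b`, the number `l * l + s` exceeds `k * k + r` by
    -- exactly this amount plus one.
    refine add_one_ne_self (k * k + r) (b + s + a * a + (a + a) * (k + 1)) ?_
    conv_rhs => rw [h]
    calc _ = k * k + (r + b) + s + a * a + (a + a) * (k + 1) + 1 := by ring
      _ = _ := by rw [← hb]; ring
  obtain rfl : k = l := le_antisymm (not_lt.1 (key l k s r h.symm hs)) (not_lt.1 (key k l r s h hr))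
  exact ⟨rfl, add_left_cancel h⟩

/-- Both branches of the pairing produce a square plus a remainder at most twice the root. Root and
remainder are therefore determined by the code, and the branch shows in whether the remainder is
below the root; injectivity follows. -/
theorem pair_eq (x y : 𝔐.N) : ∃ k r, 𝔐.pair x y = k * k + r ∧ r ≤ k + k ∧
    ((x < y ∧ k = y ∧ r = x) ∨ (¬ x < y ∧ k = x ∧ r = x + y)) := by
  unfold pair
  split_ifs with h
  · refine ⟨y, x, rfl, ?_, .inl ⟨h, rfl, rfl⟩⟩
    exact (le_of_lt (show x < y from h)).trans (le_add_self' _ _)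
  · refine ⟨x, x + y, add_assoc _ _ _, ?_, .inr ⟨h, rfl, rfl⟩⟩
    obtain ⟨c, rfl⟩ := (le_iff_exists_add' _ _).1 (not_lt.1 (show ¬ x < y from h))
    exact (le_iff_exists_add' _ _).2 ⟨c, by ring⟩

theorem pair_inj {x y x' y' : 𝔐.N} : 𝔐.pair x y = 𝔐.pair x' y' ↔ x = x' ∧ y = y' := by
  refine ⟨fun h => ?_, by rintro ⟨rfl, rfl⟩; rfl⟩
  obtain ⟨k, r, e, hr, hc⟩ := pair_eq x y
  obtain ⟨k', r', e', hr', hc'⟩ := pair_eq x' y'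
  rw [e, e'] at h
  obtain ⟨rfl, rfl⟩ := sqrt_unique h hr hr'
  rcases hc with ⟨h, rfl, rfl⟩ | ⟨h, rfl, rfl⟩ <;> rcases hc' with ⟨h', rfl, rfl⟩ | ⟨h', rfl, h2⟩
  · exact ⟨rfl, rfl⟩
  · exact absurd (h.trans_le (h2 ▸ le_add_self' _ _)) (lt_irrefl _)
  · exact absurd (h'.trans_le (le_add_self' _ _)) (lt_irrefl _)
  · exact ⟨rfl, add_left_cancel h2⟩

/-- A remainder `r` below the root `k` comes from the pair of `r` and `k`. Otherwise `r = k + c`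
with `c` at most `k`, and the pair is `k` and `c`. -/
theorem exists_pair (z : 𝔐.N) : ∃ x y, z = 𝔐.pair x y := by
  obtain ⟨k, r, rfl, h⟩ := exists_sqrt z
  by_cases hr : r < k
  · exact ⟨r, k, by unfold pair; rw [if_pos (show 𝔐.lt r k from hr)]; rfl⟩
  · obtain ⟨c, rfl⟩ := (le_iff_exists_add' _ _).1 (not_lt.1 hr)
    refine ⟨k, c, ?_⟩
    have : ¬ k < c := by
      intro hlt
      obtain ⟨a, rfl⟩ := (lt_iff_exists' _ _).1 hlt
      obtain ⟨b, hb⟩ := (le_iff_exists_add' _ _).1 h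
      refine add_one_ne_self (k + k) (a + b) ?_
      conv_rhs => rw [hb]
      ring
    unfold pair
    rw [if_neg (show ¬ 𝔐.lt k c from this)]
    exact (add_assoc _ _ _).symm

theorem right_le_pair (x y : 𝔐.N) : y ≤ 𝔐.pair x y := by
  have hsq : ∀ y : 𝔐.N, y ≤ y * y := fun y => by
    rcases eq_zero_or_succ y with rfl | ⟨y, rfl⟩
    · simp [zero_eq_zero]
    · rw [succ_eq_add_one]; exact (le_iff_exists_add' _ _).2 ⟨y * (y + 1), by ring⟩
  obtain ⟨k, r, e, hr, ⟨h, rfl, rfl⟩ | ⟨h, rfl, rfl⟩⟩ := pair_eq x y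
  · rw [e]; exact (hsq _).trans (le_add_self' _ _)
  · rw [e]; exact (le_iff_exists_add' _ _).2 ⟨k * k + k, by ring⟩

/-- The first projection of the pairing. -/
noncomputable def fst (z : 𝔐.N) : 𝔐.N := (exists_pair z).choose

/-- The second projection of the pairing. -/
noncomputable def snd (z : 𝔐.N) : 𝔐.N := (exists_pair z).choose_spec.choose

theorem pair_fst_snd (z : 𝔐.N) : 𝔐.pair (fst z) (snd z) = z :=
  (exists_pair z).choose_spec.choose_spec.symm

@[simp]
theorem fst_pair (x y : 𝔐.N) : fst (𝔐.pair x y) = x := (pair_inj.1 (pair_fst_snd _)).1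

@[simp]
theorem snd_pair (x y : 𝔐.N) : snd (𝔐.pair x y) = y := (pair_inj.1 (pair_fst_snd _)).2

@[simp]
theorem num_inj {j k : ℕ} : 𝔐.num j = 𝔐.num k ↔ j = k := by
  induction j generalizing k with
  | zero => cases k <;> simp [num, zero_ne_succ]
  | succ j ih => cases k <;> simp [num, succ_ne_zero, succ_inj, ih]

theorem num_lt_num {j k : ℕ} : 𝔐.lt (𝔐.num j) (𝔐.num k) ↔ j < k := by
  induction k with
  | zero => exact iff_of_false (hM.out.not_lt_zero _) (Nat.not_lt_zero _)
  | succ k ih => rw [num, hM.out.lt_succ, ih, num_inj]; omega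

theorem num_add (j k : ℕ) : 𝔐.num (j + k) = 𝔐.add (𝔐.num j) (𝔐.num k) := by
  induction k with
  | zero => exact (hM.out.add_zero _).symm
  | succ k ih => rw [← add_assoc, num, num, hM.out.add_succ, ih]

theorem num_mul (j k : ℕ) : 𝔐.num (j * k) = 𝔐.mul (𝔐.num j) (𝔐.num k) := by
  induction k with
  | zero => exact (hM.out.mul_zero _).symm
  | succ k ih => rw [num, hM.out.mul_succ, ← ih, ← num_add, Nat.mul_succ]

/-- The internal pairing restricted to numerals is `Nat.pair`. Program codes can thus be computed
once, as natural numbers, and used in every model. -/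
theorem num_pair (j k : ℕ) : 𝔐.num (Nat.pair j k) = 𝔐.pair (𝔐.num j) (𝔐.num k) := by
  unfold Nat.pair pair
  simp only [num_lt_num]
  split_ifs <;> simp only [num_add, num_mul]

end Model

end Henkin

namespace Henkin

/-! ## Finite sequences and trees -/

section Family

variable {I : Type*} {K : I → Henkin.{u}} {par : Prop} {n m : ℕ}
  {f g h : ∀ i, (Fin n → (K i).N) → (Fin m → Set (K i).N) → (K i).N}
  {X Y : ∀ i, (Fin n → (K i).N) → (Fin m → Set (K i).N) → Set (K i).N}

theorem Dfn.concat₀ : Dfn K par 3 0 (fun i ρ _ => (K i).Concat (ρ 0) (ρ 1) (ρ 2)) := by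
  unfold Concat; infer_instance

instance Dfn.concat [DfnF K par n m f] [DfnF K par n m g] [DfnF K par n m h] :
    Dfn K par n m (fun i ρ σ => (K i).Concat (f i ρ σ) (g i ρ σ) (h i ρ σ)) :=
  Dfn.subst₃ Dfn.concat₀

theorem Dfn.initialSegment₀ :
    Dfn K par 2 1 (fun i ρ σ => (K i).InitialSegment (σ 0) (ρ 0) (ρ 1)) := by
  unfold InitialSegment; infer_instance

variable [hK : ∀ i, Fact (K i).IsModelZ2]

instance Dfn.initialSegment [hf : DfnF K par n m f] [hg : DfnF K par n m g]
    [hX : DfnS K par n m X] :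
    Dfn K par n m (fun i ρ σ => (K i).InitialSegment (X i ρ σ) (f i ρ σ) (g i ρ σ)) :=
  Dfn.substVec Dfn.initialSegment₀ ![f, g] (fun i ρ σ _ => X i ρ σ)
    (fun j => by fin_cases j; exacts [hf, hg]) ⟨fun _ => hX⟩

instance Dfn.memSets [hX : DfnS K par n m X] :
    Dfn K par n m (fun i ρ σ => X i ρ σ ∈ (K i).sets) :=
  Dfn.true.congr fun i ρ σ hσ => iff_of_true trivial (hX.mem_sets i ρ σ hσ)

instance Dfn.isTree [hX : DfnS K par n m X] :
    Dfn K par n m (fun i ρ σ => (K i).IsTree (X i ρ σ)) :=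
  Dfn.substSet₁ (by unfold IsTree; infer_instance)

instance Dfn.wellFoundedTree [hX : DfnS K par n m X] :
    Dfn K par n m (fun i ρ σ => (K i).WellFoundedTree (X i ρ σ)) :=
  Dfn.substSet₁ (by unfold WellFoundedTree; infer_instance)

instance Dfn.isSet [hX : DfnS K par n m X] :
    Dfn K par n m (fun i ρ σ => (K i).IsSet (X i ρ σ)) := by
  unfold IsSet; infer_instance

end Family

section Model

variable {𝔐 : Henkin.{u}} [hM : Fact 𝔐.IsModelZ2]

/-- Inductive definitions in the model are intersections over sets of coded pairs. This turns a
definable relation into such a set, so that it may serve as the induction predicate. -/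
theorem exists_rel₂ (P : 𝔐.N → 𝔐.N → Prop) (hP : 𝔐.Def₂ P := by infer_instance) :
    ∃ Z ∈ 𝔐.sets, ∀ x y, 𝔐.rel₂ Z x y ↔ P x y := by
  have : 𝔐.Def₁ (fun z => ∃ x y, z = 𝔐.pair x y ∧ P x y) := by
    have : Dfn (fun _ : Unit => 𝔐) True (1 + 1 + 1) 0
        (fun _ ρ _ => P (ρ (Fin.last 1).castSucc) (ρ (Fin.last 2))) :=
      (hP.rename ![(Fin.last 1).castSucc, Fin.last 2] id)
    infer_instance
  refine ⟨_, setOf_mem_sets _ this, fun x y => ?_⟩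
  simp only [rel₂, Set.mem_ofPred_eq, pair_inj]
  exact ⟨fun ⟨_, _, ⟨rfl, rfl⟩, h⟩ => h, fun h => ⟨_, _, ⟨rfl, rfl⟩, h⟩⟩

theorem exists_rel₃ (P : 𝔐.N → 𝔐.N → 𝔐.N → Prop) (hP : 𝔐.Def₃ P := by infer_instance) :
    ∃ Z ∈ 𝔐.sets, ∀ x y z, 𝔐.rel₃ Z x y z ↔ P x y z := by
  have : 𝔐.Def₁ (fun w => ∃ x y z, w = 𝔐.pair x (𝔐.pair y z) ∧ P x y z) := by
    have : Dfn (fun _ : Unit => 𝔐) True (1 + 1 + 1 + 1) 0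
        (fun _ ρ _ => P (ρ (Fin.last 1).castSucc.castSucc) (ρ (Fin.last 2).castSucc)
          (ρ (Fin.last 3))) :=
      (hP.rename ![(Fin.last 1).castSucc.castSucc, (Fin.last 2).castSucc, Fin.last 3] id)
    infer_instance
  refine ⟨_, setOf_mem_sets _ this, fun x y z => ?_⟩
  simp only [rel₃, Set.mem_ofPred_eq, pair_inj]
  exact ⟨fun ⟨_, _, _, ⟨rfl, rfl, rfl⟩, h⟩ => h, fun h => ⟨_, _, _, ⟨rfl, rfl, rfl⟩, h⟩⟩

theorem cons_inj {a b s t : 𝔐.N} : 𝔐.cons a s = 𝔐.cons b t ↔ a = b ∧ s = t := by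
  rw [cons, cons, succ_inj, pair_inj]

theorem cons_ne_nil (a s : 𝔐.N) : 𝔐.cons a s ≠ 𝔐.nil := succ_ne_zero _

theorem nil_ne_cons (a s : 𝔐.N) : 𝔐.nil ≠ 𝔐.cons a s := zero_ne_succ _

theorem eq_nil_or_cons (s : 𝔐.N) : s = 𝔐.nil ∨ ∃ a t, s = 𝔐.cons a t := by
  rcases eq_zero_or_succ s with h | ⟨z, rfl⟩
  · exact .inl h
  · obtain ⟨a, t, rfl⟩ := exists_pair z
    exact .inr ⟨a, t, rfl⟩

/-- The tail of a sequence has a smaller code, because the second component of a pair is at most the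
pair and `cons` adds one. -/
theorem seq_induct (P : 𝔐.N → Prop) (hP : 𝔐.Def₁ P := by infer_instance) (h0 : P 𝔐.nil)
    (hs : ∀ a s, P s → P (𝔐.cons a s)) (s : 𝔐.N) : P s := by
  refine strong_induct P hP (fun s ih => ?_) s
  rcases eq_nil_or_cons s with rfl | ⟨a, t, rfl⟩
  · exact h0
  · refine hs a t (ih t ?_)
    rw [cons, succ_eq_add_one, lt_add_one_iff']
    exact right_le_pair a t

/-! ### Concatenation -/

theorem Concat.nil (t : 𝔐.N) : 𝔐.Concat 𝔐.nil t t := fun _ _ h _ => h t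

theorem Concat.cons {s t w : 𝔐.N} (a : 𝔐.N) (h : 𝔐.Concat s t w) :
    𝔐.Concat (𝔐.cons a s) t (𝔐.cons a w) := fun Z hZ h₁ h₂ => h₂ a s t w (h Z hZ h₁ h₂)

/-- Inversion for an intersection of closed sets: the relation on the right is definable and itself
closed under the two generating rules, so it contains the least such relation. The same device gives
the later inversion lemmas. -/
theorem Concat.cases {s t w : 𝔐.N} (h : 𝔐.Concat s t w) :
    (s = 𝔐.nil ∧ w = t) ∨ ∃ a s' w', s = 𝔐.cons a s' ∧ w = 𝔐.cons a w' ∧ 𝔐.Concat s' t w' := by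
  obtain ⟨Z, hZ, hP⟩ := exists_rel₃ (fun s t w => (s = 𝔐.nil ∧ w = t) ∨
    ∃ a s' w', s = 𝔐.cons a s' ∧ w = 𝔐.cons a w' ∧ 𝔐.Concat s' t w')
  rw [← hP]
  refine h Z hZ (fun t => (hP _ _ _).2 (.inl ⟨rfl, rfl⟩)) (fun a s t w h => ?_)
  refine (hP _ _ _).2 (.inr ⟨a, s, w, rfl, rfl, ?_⟩)
  rcases (hP _ _ _).1 h with ⟨rfl, rfl⟩ | ⟨a, s', w', rfl, rfl, h'⟩
  · exact Concat.nil _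
  · exact h'.cons a

theorem concat_nil_iff {t w : 𝔐.N} : 𝔐.Concat 𝔐.nil t w ↔ w = t := by
  refine ⟨fun h => ?_, fun h => h ▸ Concat.nil t⟩
  rcases h.cases with ⟨-, h⟩ | ⟨a, s', w', h, -⟩
  · exact h
  · exact absurd h (nil_ne_cons _ _)

theorem concat_cons_iff {a s t w : 𝔐.N} :
    𝔐.Concat (𝔐.cons a s) t w ↔ ∃ w', w = 𝔐.cons a w' ∧ 𝔐.Concat s t w' := by
  constructor
  · intro h
    rcases h.cases with ⟨e, -⟩ | ⟨a, s', w', e, rfl, h'⟩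
    · exact absurd e (cons_ne_nil _ _)
    · obtain ⟨rfl, rfl⟩ := cons_inj.1 e
      exact ⟨w', rfl, h'⟩
  · rintro ⟨w', rfl, h⟩
    exact h.cons a

theorem existsUnique_concat (s t : 𝔐.N) : ∃! w, 𝔐.Concat s t w := by
  refine seq_induct (fun s => ∃! w, 𝔐.Concat s t w) inferInstance ?_ (fun a s h => ?_) s
  · exact ⟨t, Concat.nil t, fun w => concat_nil_iff.1⟩
  · obtain ⟨w, hw, h⟩ := h
    refine ⟨_, hw.cons a, fun w' h' => ?_⟩
    obtain ⟨w'', rfl, h''⟩ := concat_cons_iff.1 h'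
    rw [h w'' h'']

/-- The concatenation of two sequences. -/
noncomputable def cat (s t : 𝔐.N) : 𝔐.N := (existsUnique_concat s t).choose

theorem concat_iff {s t w : 𝔐.N} : 𝔐.Concat s t w ↔ w = cat s t :=
  ⟨fun h => (existsUnique_concat s t).choose_spec.2 w h,
    fun h => h ▸ (existsUnique_concat s t).choose_spec.1⟩

@[simp]
theorem nil_cat (t : 𝔐.N) : cat 𝔐.nil t = t := (concat_iff.1 (Concat.nil t)).symm

@[simp]
theorem cons_cat (a s t : 𝔐.N) : cat (𝔐.cons a s) t = 𝔐.cons a (cat s t) :=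
  (concat_iff.1 ((concat_iff.2 rfl).cons a)).symm

@[simp]
theorem single_cat (a t : 𝔐.N) : cat (𝔐.single a) t = 𝔐.cons a t := by
  rw [single, cons_cat, nil_cat]

instance DfnF.cat {I : Type*} {K : I → Henkin.{u}} {par : Prop} {n m : ℕ}
    [hK : ∀ i, Fact (K i).IsModelZ2]
    {f g : ∀ i, (Fin n → (K i).N) → (Fin m → Set (K i).N) → (K i).N}
    [DfnF K par n m f] [DfnF K par n m g] :
    DfnF K par n m (fun i ρ σ => cat (f i ρ σ) (g i ρ σ)) :=
  DfnF.subst₂ (F := fun i x y => Henkin.cat x y) (Dfn.concat₀.congr fun _ _ _ _ => concat_iff)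

theorem cat_assoc (s t w : 𝔐.N) : cat (cat s t) w = cat s (cat t w) :=
  seq_induct (fun s => cat (cat s t) w = cat s (cat t w)) inferInstance (by simp)
    (fun a s h => by simp [h]) s

/-! ### Trees -/

/-- The subtree of `S` above the node `s`. -/
def sub (S : Set 𝔐.N) (s : 𝔐.N) : Set 𝔐.N := {w | cat s w ∈ S}

instance DfnS.sub {I : Type*} {K : I → Henkin.{u}} {par : Prop} {n m : ℕ}
    [hK : ∀ i, Fact (K i).IsModelZ2]
    {f : ∀ i, (Fin n → (K i).N) → (Fin m → Set (K i).N) → (K i).N}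
    {X : ∀ i, (Fin n → (K i).N) → (Fin m → Set (K i).N) → Set (K i).N}
    [DfnF K par n m f] [DfnS K par n m X] :
    DfnS K par n m (fun i ρ σ => Henkin.sub (X i ρ σ) (f i ρ σ)) := by
  unfold Henkin.sub; infer_instance

@[simp]
theorem sub_nil (S : Set 𝔐.N) : sub S 𝔐.nil = S := by ext; simp [sub]

theorem sub_cons (S : Set 𝔐.N) (a s : 𝔐.N) : sub S (𝔐.cons a s) = sub (𝔐.down S a) s := by
  ext; simp [sub, down]

theorem sub_single (S : Set 𝔐.N) (a : 𝔐.N) : sub S (𝔐.single a) = 𝔐.down S a := by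
  rw [single, sub_cons, sub_nil]

theorem sub_sub (S : Set 𝔐.N) (s t : 𝔐.N) : sub (sub S s) t = sub S (cat s t) := by
  ext; simp [sub, cat_assoc]

theorem mem_immd {S : Set 𝔐.N} {a : 𝔐.N} : a ∈ 𝔐.immd S ↔ 𝔐.cons a 𝔐.nil ∈ S := Iff.rfl

theorem mem_immd_sub {S : Set 𝔐.N} {s a : 𝔐.N} :
    a ∈ 𝔐.immd (sub S s) ↔ cat s (𝔐.single a) ∈ S := Iff.rfl

theorem isTree_iff {S : Set 𝔐.N} :
    𝔐.IsTree S ↔ 𝔐.nil ∈ S ∧ ∀ s t, cat s t ∈ S → s ∈ S := by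
  simp only [IsTree, concat_iff]
  exact and_congr Iff.rfl ⟨fun h s t => h s t _ rfl, fun h s t w e hw => h s t (e ▸ hw)⟩

theorem IsTree.mem_immd {S : Set 𝔐.N} (hS : 𝔐.IsTree S) {a s : 𝔐.N} (h : 𝔐.cons a s ∈ S) :
    a ∈ 𝔐.immd S :=
  (isTree_iff.1 hS).2 (𝔐.single a) s (by simpa using h)

theorem initialSegment_zero {F : Set 𝔐.N} [hF : Fact (F ∈ 𝔐.sets)] {s : 𝔐.N} :
    𝔐.InitialSegment F 𝔐.zero s ↔ s = 𝔐.nil := by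
  constructor
  · intro h
    obtain ⟨Z, hZ, hP⟩ := exists_rel₂ (fun n s => n = 𝔐.zero → s = 𝔐.nil)
    refine (hP _ _).1 (h Z hZ ((hP _ _).2 fun _ => rfl) fun n s a t _ _ _ => ?_) rfl
    exact (hP _ _).2 fun h => absurd h (succ_ne_zero _)
  · rintro rfl Z _ h _
    exact h

theorem InitialSegment.succ {F : Set 𝔐.N} {n s a : 𝔐.N} (h : 𝔐.InitialSegment F n s)
    (ha : 𝔐.rel₂ F n a) : 𝔐.InitialSegment F (𝔐.succ n) (cat s (𝔐.single a)) :=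
  fun Z hZ h₁ h₂ => h₂ n s a _ (h Z hZ h₁ h₂) ha (concat_iff.2 rfl)

/-- The closed set used here also records that the pair is an initial segment; without this the
predecessor in the inversion would not be known to be one. -/
theorem initialSegment_succ {F : Set 𝔐.N} [hF : Fact (F ∈ 𝔐.sets)] {n t : 𝔐.N} :
    𝔐.InitialSegment F (𝔐.succ n) t ↔
      ∃ s a, 𝔐.InitialSegment F n s ∧ 𝔐.rel₂ F n a ∧ t = cat s (𝔐.single a) := by
  constructor
  · intro h
    obtain ⟨Z, hZ, hP⟩ := exists_rel₂ (fun n t => 𝔐.InitialSegment F n t ∧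
      ∀ k, n = 𝔐.succ k → ∃ s a, 𝔐.InitialSegment F k s ∧ 𝔐.rel₂ F k a ∧ t = cat s (𝔐.single a))
    refine ((hP _ _).1 (h Z hZ ((hP _ _).2 ⟨initialSegment_zero.2 rfl, fun k hk => ?_⟩)
      fun n s a t h₁ h₂ h₃ => ?_)).2 n rfl
    · exact absurd hk (zero_ne_succ _)
    · obtain rfl := concat_iff.1 h₃
      have := ((hP _ _).1 h₁).1
      refine (hP _ _).2 ⟨this.succ h₂, fun k hk => ?_⟩
      obtain rfl := succ_inj.1 hk
      exact ⟨s, a, this, h₂, rfl⟩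
  · rintro ⟨s, a, h₁, h₂, rfl⟩
    exact h₁.succ h₂

/-- An infinite path starting with `a` is an infinite path of the subtree at `⟨a⟩`. -/
theorem initialSegment_shift {F G : Set 𝔐.N} [hF : Fact (F ∈ 𝔐.sets)] [hG : Fact (G ∈ 𝔐.sets)]
    {a : 𝔐.N} (h0 : ∀ b, 𝔐.rel₂ F 𝔐.zero b ↔ b = a)
    (hs : ∀ n b, 𝔐.rel₂ F (𝔐.succ n) b ↔ 𝔐.rel₂ G n b) (n t : 𝔐.N) :
    𝔐.InitialSegment F (𝔐.succ n) t ↔ ∃ s, t = 𝔐.cons a s ∧ 𝔐.InitialSegment G n s := by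
  refine induct (fun n => ∀ t, 𝔐.InitialSegment F (𝔐.succ n) t ↔
    ∃ s, t = 𝔐.cons a s ∧ 𝔐.InitialSegment G n s) inferInstance (fun t => ?_)
    (fun n ih t => ?_) n t
  · rw [initialSegment_succ]
    simp [initialSegment_zero, h0, single]
  · rw [initialSegment_succ]
    simp only [ih, hs]
    constructor
    · rintro ⟨_, b, ⟨s, rfl, h₁⟩, h₂, rfl⟩
      exact ⟨_, cons_cat _ _ _, h₁.succ h₂⟩
    · rintro ⟨_, rfl, h⟩
      obtain ⟨s, b, h₁, h₂, rfl⟩ := initialSegment_succ.1 h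
      exact ⟨_, b, ⟨s, rfl, h₁⟩, h₂, (cons_cat _ _ _).symm⟩

theorem down_mem_sets {X : Set 𝔐.N} (hX : X ∈ 𝔐.sets) (a : 𝔐.N) : 𝔐.down X a ∈ 𝔐.sets :=
  have : Fact (X ∈ 𝔐.sets) := ⟨hX⟩
  setOf_mem_sets (fun s => s ∈ 𝔐.down X a)

theorem IsSet.down {S : Set 𝔐.N} (hS : 𝔐.IsSet S) {a : 𝔐.N} (ha : a ∈ 𝔐.immd S) :
    𝔐.IsSet (𝔐.down S a) := by
  refine ⟨down_mem_sets hS.1 a, ⟨ha, fun s t w h hw => hS.2.1.2 _ _ _ (h.cons a) hw⟩, ?_⟩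
  rintro ⟨F, hF, hfun, hpath⟩
  have : Fact (F ∈ 𝔐.sets) := ⟨hF⟩
  -- `G` is `F` with `a` put in front, so a path through the subtree becomes a path through the
  -- whole tree.
  obtain ⟨G, hG, hP⟩ := exists_rel₂ (fun n b => (n = 𝔐.zero ∧ b = a) ∨
    ∃ k, n = 𝔐.succ k ∧ 𝔐.rel₂ F k b)
  have : Fact (G ∈ 𝔐.sets) := ⟨hG⟩
  have h0 : ∀ b, 𝔐.rel₂ G 𝔐.zero b ↔ b = a := fun b => by simp [hP, zero_ne_succ]
  have hs : ∀ n b, 𝔐.rel₂ G (𝔐.succ n) b ↔ 𝔐.rel₂ F n b := fun n b => by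
    simp [hP, succ_ne_zero, succ_inj]
  refine hS.2.2 ⟨G, hG, fun n => ?_, fun n => ?_⟩
  · rcases eq_zero_or_succ n with rfl | ⟨n, rfl⟩
    · simp [h0]
    · simpa only [hs] using hfun n
  · rcases eq_zero_or_succ n with rfl | ⟨n, rfl⟩
    · exact ⟨_, initialSegment_zero.2 rfl, hS.2.1.1⟩
    · obtain ⟨s, h₁, h₂⟩ := hpath n
      exact ⟨_, (initialSegment_shift h0 hs n _).2 ⟨s, rfl, h₁⟩, h₂⟩

/-- A tree all of whose immediate subtrees are well-founded is well-founded. -/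
theorem isSet_of_down {S : Set 𝔐.N} (hS : S ∈ 𝔐.sets) (hnil : 𝔐.nil ∈ S)
    (himmd : ∀ a s, 𝔐.cons a s ∈ S → a ∈ 𝔐.immd S)
    (h : ∀ a ∈ 𝔐.immd S, 𝔐.IsSet (𝔐.down S a)) : 𝔐.IsSet S := by
  refine ⟨hS, isTree_iff.2 ⟨hnil, fun s t hst => ?_⟩, ?_⟩
  · rcases eq_nil_or_cons s with rfl | ⟨a, s, rfl⟩
    · exact hnil
    · rw [cons_cat] at hst
      exact (isTree_iff.1 (h a (himmd _ _ hst)).2.1).2 s t hst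
  · rintro ⟨F, hF, hfun, hpath⟩
    have : Fact (F ∈ 𝔐.sets) := ⟨hF⟩
    -- `G` is `F` with its first entry dropped: a path through the tree runs, after one step, inside
    -- the immediate subtree at that entry.
    obtain ⟨G, hG, hP⟩ := exists_rel₂ (fun n b => 𝔐.rel₂ F (𝔐.succ n) b)
    have : Fact (G ∈ 𝔐.sets) := ⟨hG⟩
    obtain ⟨a, ha, huniq⟩ := hfun 𝔐.zero
    have h0 : ∀ b, 𝔐.rel₂ F 𝔐.zero b ↔ b = a := fun b => ⟨huniq b, fun e => e ▸ ha⟩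
    have hs := initialSegment_shift h0 (fun n b => (hP n b).symm)
    have hpath' : ∀ n, ∃ s, 𝔐.InitialSegment G n s ∧ 𝔐.cons a s ∈ S := fun n => by
      obtain ⟨t, h₁, h₂⟩ := hpath (𝔐.succ n)
      obtain ⟨s, rfl, h₃⟩ := (hs n t).1 h₁
      exact ⟨s, h₃, h₂⟩
    obtain ⟨s, -, hmem⟩ := hpath' 𝔐.zero
    refine (h a (himmd _ _ hmem)).2.2 ⟨G, hG, fun n => ?_, hpath'⟩
    simpa only [hP] using hfun (𝔐.succ n)

/-- Bar induction on the nodes of a well-founded tree. -/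
theorem IsSet.node_induct {S : Set 𝔐.N} (hS : 𝔐.IsSet S) (P : 𝔐.N → Prop) (hP : 𝔐.Def₁ P)
    (h : ∀ s ∈ S, (∀ a, cat s (𝔐.single a) ∈ S → P (cat s (𝔐.single a))) → P s) : P 𝔐.nil := by
  have : Fact (S ∈ 𝔐.sets) := ⟨hS.1⟩
  have : Fact ({s | P s} ∈ 𝔐.sets) := ⟨setOf_mem_sets P hP⟩
  -- Suppose `P` fails at the root. The set `B` of nodes where `P` fails has no terminal element,
  -- and following it upwards yields an infinite path.
  by_contra hnil
  obtain ⟨B, hB, hBS⟩ : ∃ B ∈ 𝔐.sets, ∀ s, s ∈ B ↔ s ∈ S ∧ s ∉ {s | P s} :=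
    ⟨_, setOf_mem_sets (fun s => s ∈ S ∧ s ∉ {s | P s}), fun _ => Iff.rfl⟩
  have : Fact (B ∈ 𝔐.sets) := ⟨hB⟩
  -- Taking the least bad child makes the successor unique, so the path is defined without any
  -- choice.
  have hnext : ∀ s ∈ B, ∃ a, cat s (𝔐.single a) ∈ B ∧
      ∀ b, 𝔐.lt b a → cat s (𝔐.single b) ∉ B := fun s hs => by
    have : ∃ a, cat s (𝔐.single a) ∈ B := by
      by_contra! hc
      refine ((hBS s).1 hs).2 (h s ((hBS s).1 hs).1 fun a ha => ?_)
      by_contra hPa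
      exact hc a ((hBS _).2 ⟨ha, hPa⟩)
    obtain ⟨a, ha⟩ := this
    exact exists_least (fun a => cat s (𝔐.single a) ∈ B) inferInstance ha
  obtain ⟨N, hN, hNP⟩ := exists_rel₂ (fun s a => cat s (𝔐.single a) ∈ B ∧
      ∀ b, 𝔐.lt b a → cat s (𝔐.single b) ∉ B)
  have : Fact (N ∈ 𝔐.sets) := ⟨hN⟩
  have hNuniq : ∀ s a b, 𝔐.rel₂ N s a → 𝔐.rel₂ N s b → a = b := fun s a b ha hb => by
    rw [hNP] at ha hb
    rcases lt_trichotomy' a b with h | h | h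
    · exact absurd ha.1 (hb.2 a h)
    · exact h
    · exact absurd hb.1 (ha.2 b h)
  -- `H` is the graph of the iteration of `N` from the root, as the least relation closed under one
  -- step. `hHinv` inverts it, and internal induction shows that it is a total function.
  obtain ⟨H, hH, hHP⟩ := exists_rel₂ (fun n s => ∀ Z ∈ 𝔐.sets, 𝔐.rel₂ Z 𝔐.zero 𝔐.nil →
    (∀ n s a, 𝔐.rel₂ Z n s → 𝔐.rel₂ N s a → 𝔐.rel₂ Z (𝔐.succ n) (cat s (𝔐.single a))) →
    𝔐.rel₂ Z n s)
  have : Fact (H ∈ 𝔐.sets) := ⟨hH⟩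
  have hH0 : 𝔐.rel₂ H 𝔐.zero 𝔐.nil := (hHP _ _).2 fun Z _ h _ => h
  have hHs : ∀ n s a, 𝔐.rel₂ H n s → 𝔐.rel₂ N s a →
      𝔐.rel₂ H (𝔐.succ n) (cat s (𝔐.single a)) := fun n s a h₁ h₂ =>
    (hHP _ _).2 fun Z hZ z₀ zs => zs n s a ((hHP _ _).1 h₁ Z hZ z₀ zs) h₂
  have hHinv : ∀ n t, 𝔐.rel₂ H n t → (n = 𝔐.zero ∧ t = 𝔐.nil) ∨
      ∃ k s a, n = 𝔐.succ k ∧ 𝔐.rel₂ H k s ∧ 𝔐.rel₂ N s a ∧ t = cat s (𝔐.single a) := by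
    intro n t ht
    obtain ⟨Z, hZ, hZP⟩ := exists_rel₂ (fun n t => 𝔐.rel₂ H n t ∧ ((n = 𝔐.zero ∧ t = 𝔐.nil) ∨
      ∃ k s a, n = 𝔐.succ k ∧ 𝔐.rel₂ H k s ∧ 𝔐.rel₂ N s a ∧ t = cat s (𝔐.single a)))
    refine ((hZP _ _).1 ((hHP _ _).1 ht Z hZ ?_ fun n s a h₁ h₂ => ?_)).2
    · exact (hZP _ _).2 ⟨hH0, .inl ⟨rfl, rfl⟩⟩
    · rw [hZP] at h₁ ⊢
      exact ⟨hHs n s a h₁.1 h₂, .inr ⟨n, s, a, rfl, h₁.1, h₂, rfl⟩⟩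
  have hHtot : ∀ n, ∃! s, 𝔐.rel₂ H n s := by
    refine Henkin.induct (fun n => ∃! s, 𝔐.rel₂ H n s) inferInstance ⟨_, hH0, fun s hs => ?_⟩
      fun n ⟨s, hs, huniq⟩ => ?_
    · rcases hHinv _ _ hs with ⟨-, h⟩ | ⟨k, -, -, hk, -⟩
      · exact h
      · exact absurd hk (zero_ne_succ _)
    · have hsB : s ∈ B := by
        rcases hHinv _ _ hs with ⟨-, rfl⟩ | ⟨k, t, a, -, -, ha, rfl⟩
        · exact (hBS _).2 ⟨hS.2.1.1, hnil⟩
        · exact ((hNP _ _).1 ha).1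
      obtain ⟨a, ha⟩ := hnext s hsB
      rw [← hNP] at ha
      refine ⟨_, hHs n s a hs ha, fun t ht => ?_⟩
      rcases hHinv _ _ ht with ⟨h, -⟩ | ⟨k, s', a', hk, hs', ha', rfl⟩
      · exact absurd h (succ_ne_zero _)
      · obtain rfl := succ_inj.1 hk
        obtain rfl := huniq _ hs'
        rw [hNuniq _ _ _ ha ha']
  have hHB : ∀ n s, 𝔐.rel₂ H n s → s ∈ B := by
    intro n s hs
    rcases hHinv _ _ hs with ⟨-, rfl⟩ | ⟨k, t, a, -, -, ha, rfl⟩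
    · exact (hBS _).2 ⟨hS.2.1.1, hnil⟩
    · exact ((hNP _ _).1 ha).1
  -- `H` lists the nodes along the path. The definition of well-foundedness speaks of the sequence
  -- of labels, which is `F`.
  obtain ⟨F, hF, hFP⟩ := exists_rel₂ (fun n a => ∃ s, 𝔐.rel₂ H n s ∧ 𝔐.rel₂ N s a)
  have : Fact (F ∈ 𝔐.sets) := ⟨hF⟩
  refine hS.2.2 ⟨F, hF, fun n => ?_, fun n => ?_⟩
  · obtain ⟨s, hs, huniq⟩ := hHtot n
    obtain ⟨a, ha⟩ := hnext s (hHB n s hs)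
    rw [← hNP] at ha
    refine ⟨a, (hFP _ _).2 ⟨s, hs, ha⟩, fun b hb => ?_⟩
    obtain ⟨s', hs', hb⟩ := (hFP _ _).1 hb
    obtain rfl := huniq s' hs'
    exact hNuniq _ _ _ hb ha
  · obtain ⟨s, hs, -⟩ := hHtot n
    refine ⟨s, ?_, ((hBS _).1 (hHB n s hs)).1⟩
    refine Henkin.induct (fun n => ∀ s, 𝔐.rel₂ H n s → 𝔐.InitialSegment F n s) inferInstance
      (fun s hs => ?_) (fun n ih t ht => ?_) n s hs
    · rcases hHinv _ _ hs with ⟨-, h⟩ | ⟨k, -, -, hk, -⟩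
      · exact initialSegment_zero.2 h
      · exact absurd hk (zero_ne_succ _)
    · rcases hHinv _ _ ht with ⟨h, -⟩ | ⟨k, s, a, hk, hs, ha, rfl⟩
      · exact absurd h (succ_ne_zero _)
      · obtain rfl := succ_inj.1 hk
        exact (ih s hs).succ ((hFP _ _).2 ⟨s, hs, ha⟩)

theorem IsSet.sub {S : Set 𝔐.N} (hS : 𝔐.IsSet S) {s : 𝔐.N} (hs : s ∈ S) :
    𝔐.IsSet (sub S s) := by
  refine seq_induct (fun s => ∀ S ∈ 𝔐.sets, 𝔐.IsSet S → s ∈ S → 𝔐.IsSet (Henkin.sub S s))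
    inferInstance (fun S _ hS _ => ?_) (fun a s ih S _ hS hs => ?_) s S hS.1 hS hs
  · rwa [sub_nil]
  · rw [sub_cons]
    have := hS.down (hS.2.1.mem_immd hs)
    exact ih _ this.1 this hs

/-- Induction on well-founded trees. -/
theorem IsSet.induct {S : Set 𝔐.N} (hS : 𝔐.IsSet S) (Q : Set 𝔐.N → Prop)
    (hQ : Dfn (fun _ : Unit => 𝔐) True 0 1 (fun _ _ σ => Q (σ 0)) := by infer_instance)
    (h : ∀ X, 𝔐.IsSet X → (∀ a ∈ 𝔐.immd X, Q (𝔐.down X a)) → Q X) : Q S := by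
  have : Fact (S ∈ 𝔐.sets) := ⟨hS.1⟩
  -- Bar induction is about nodes; a node stands for the subtree above it, and the root for the
  -- whole tree.
  rw [← sub_nil S]
  refine hS.node_induct (fun s => Q (Henkin.sub S s)) (Dfn.substSet₁ (P := fun _ => Q) hQ)
    fun s hs ih => h _ (hS.sub hs) fun a ha => ?_
  rw [← sub_single, sub_sub]
  exact ih a ha

end Model

end Henkin

namespace Henkin

/-! ## Least fixed points of ternary operators -/

section Lfp

variable {𝔐 : Henkin.{u}} [hM : Fact 𝔐.IsModelZ2]

/-- The intersection of all sets of the structure that are closed under `Φ`. -/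
def Lfp₃ (Φ : (𝔐.N → 𝔐.N → 𝔐.N → Prop) → 𝔐.N → 𝔐.N → 𝔐.N → Prop) (x y z : 𝔐.N) : Prop :=
  ∀ Z ∈ 𝔐.sets, (∀ x y z, Φ (𝔐.rel₃ Z) x y z → 𝔐.rel₃ Z x y z) → 𝔐.rel₃ Z x y z

variable {Φ : (𝔐.N → 𝔐.N → 𝔐.N → Prop) → 𝔐.N → 𝔐.N → 𝔐.N → Prop}
  (hΦ : ∀ R S, (∀ x y z, R x y z → S x y z) → ∀ x y z, Φ R x y z → Φ S x y z)

include hΦ in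
theorem lfp₃_closed {x y z : 𝔐.N} (h : Φ (Lfp₃ Φ) x y z) : Lfp₃ Φ x y z := fun Z hZ hc =>
  hc _ _ _ (hΦ _ _ (fun _ _ _ h => h Z hZ hc) _ _ _ h)

/-- Definability of `P` makes it one of the closed sets over which the intersection is taken. -/
theorem lfp₃_induct (P : 𝔐.N → 𝔐.N → 𝔐.N → Prop) (hP : 𝔐.Def₃ P)
    (h : ∀ x y z, Φ P x y z → P x y z) {x y z : 𝔐.N} (hx : Lfp₃ Φ x y z) : P x y z := by
  obtain ⟨Z, hZ, hZP⟩ := exists_rel₃ P hP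
  have e : 𝔐.rel₃ Z = P := by funext x y z; exact propext (hZP x y z)
  rw [← e]
  exact hx Z hZ (by rwa [e])

-- The usual fixed-point argument: the image of the least fixed point under `Φ` is closed by
-- monotonicity. It competes in the intersection only if it is a set of the structure, whence the
-- hypothesis `hdef`.
include hΦ in
theorem lfp₃_unfold (hdef : 𝔐.Def₃ (Φ (Lfp₃ Φ))) {x y z : 𝔐.N} :
    Lfp₃ Φ x y z ↔ Φ (Lfp₃ Φ) x y z :=
  ⟨lfp₃_induct _ hdef fun _ _ _ h => hΦ _ _ (fun _ _ _ => lfp₃_closed hΦ) _ _ _ h,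
    lfp₃_closed hΦ⟩

end Lfp

/-! ## Kleene's first algebra -/

/-- A Lean inductive predicate is opaque to definability search. As a disjunction of existential
clauses the same relation is visibly definable, and it also serves for inversion. -/
theorem evalStep_iff {𝔐 : Henkin.{u}} {R : 𝔐.N → 𝔐.N → 𝔐.N → Prop} {e x y : 𝔐.N} :
    𝔐.EvalStep R e x y ↔
      (e = 𝔐.pair (𝔐.num 0) y) ∨
      (e = 𝔐.pair (𝔐.num 1) 𝔐.zero ∧ y = 𝔐.succ x) ∨
      (e = 𝔐.pair (𝔐.num 2) 𝔐.zero ∧ y = x) ∨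
      (e = 𝔐.pair (𝔐.num 3) 𝔐.zero ∧ ∃ b, x = 𝔐.pair y b) ∨
      (e = 𝔐.pair (𝔐.num 4) 𝔐.zero ∧ ∃ a, x = 𝔐.pair a y) ∨
      (∃ f g a b, e = 𝔐.pair (𝔐.num 5) (𝔐.pair f g) ∧ R f x a ∧ R g x b ∧ y = 𝔐.pair a b) ∨
      (∃ f g a, e = 𝔐.pair (𝔐.num 6) (𝔐.pair f g) ∧ R g x a ∧ R f a y) ∨
      (∃ f g a, e = 𝔐.pair (𝔐.num 7) (𝔐.pair f g) ∧ x = 𝔐.pair a 𝔐.zero ∧ R f a y) ∨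
      (∃ f g a n b, e = 𝔐.pair (𝔐.num 7) (𝔐.pair f g) ∧ x = 𝔐.pair a (𝔐.succ n) ∧
        R e (𝔐.pair a n) b ∧ R g (𝔐.pair a (𝔐.pair n b)) y) ∨
      (∃ f a, e = 𝔐.pair (𝔐.num 8) f ∧ x = 𝔐.pair a y ∧ R f x 𝔐.zero) ∨
      (∃ f a n b, e = 𝔐.pair (𝔐.num 8) f ∧ x = 𝔐.pair a n ∧ R f x (𝔐.succ b) ∧
        R e (𝔐.pair a (𝔐.succ n)) y) ∨
      (∃ f z, e = 𝔐.pair (𝔐.num 9) 𝔐.zero ∧ x = 𝔐.pair f z ∧ R f z y) := by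
  constructor
  · intro h
    cases h with
    | const k x => exact .inl rfl
    | succ x => exact .inr (.inl ⟨rfl, rfl⟩)
    | ident x => exact .inr (.inr (.inl ⟨rfl, rfl⟩))
    | left a b => exact .inr (.inr (.inr (.inl ⟨rfl, _, rfl⟩)))
    | right a b => exact .inr (.inr (.inr (.inr (.inl ⟨rfl, _, rfl⟩))))
    | pair f g x a b h₁ h₂ =>
      exact .inr (.inr (.inr (.inr (.inr (.inl ⟨f, g, a, b, rfl, h₁, h₂, rfl⟩)))))
    | comp f g x a b h₁ h₂ =>
      exact .inr (.inr (.inr (.inr (.inr (.inr (.inl ⟨f, g, a, rfl, h₁, h₂⟩))))))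
    | precZero f g a b h =>
      exact .inr (.inr (.inr (.inr (.inr (.inr (.inr (.inl ⟨f, g, a, rfl, rfl, h⟩)))))))
    | precSucc f g a n b c h₁ h₂ =>
      exact .inr (.inr (.inr (.inr (.inr (.inr (.inr (.inr
        (.inl ⟨f, g, a, n, b, rfl, rfl, h₁, h₂⟩))))))))
    | searchStop f a n h =>
      exact .inr (.inr (.inr (.inr (.inr (.inr (.inr (.inr (.inr (.inl ⟨f, a, rfl, rfl, h⟩)))))))))
    | searchNext f a n b c h₁ h₂ =>
      exact .inr (.inr (.inr (.inr (.inr (.inr (.inr (.inr (.inr (.inr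
        (.inl ⟨f, a, n, b, rfl, rfl, h₁, h₂⟩))))))))))
    | index e x y h =>
      exact .inr (.inr (.inr (.inr (.inr (.inr (.inr (.inr (.inr (.inr
        (.inr ⟨e, x, rfl, rfl, h⟩))))))))))
  · rintro (rfl | ⟨rfl, rfl⟩ | ⟨rfl, rfl⟩ | ⟨rfl, b, rfl⟩ | ⟨rfl, a, rfl⟩ |
      ⟨f, g, a, b, rfl, h₁, h₂, rfl⟩ | ⟨f, g, a, rfl, h₁, h₂⟩ | ⟨f, g, a, rfl, rfl, h⟩ |
      ⟨f, g, a, n, b, rfl, rfl, h₁, h₂⟩ | ⟨f, a, rfl, rfl, h⟩ | ⟨f, a, n, b, rfl, rfl, h₁, h₂⟩ |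
      ⟨f, z, rfl, rfl, h⟩)
    · exact .const _ _
    · exact .succ _
    · exact .ident _
    · exact .left _ _
    · exact .right _ _
    · exact .pair _ _ _ _ _ h₁ h₂
    · exact .comp _ _ _ _ _ h₁ h₂
    · exact .precZero _ _ _ _ h
    · exact .precSucc _ _ _ _ _ _ h₁ h₂
    · exact .searchStop _ _ _ h
    · exact .searchNext _ _ _ _ _ h₁ h₂
    · exact .index _ _ _ h

theorem EvalStep.mono {𝔐 : Henkin.{u}} (R S : 𝔐.N → 𝔐.N → 𝔐.N → Prop)
    (h : ∀ x y z, R x y z → S x y z) (x y z : 𝔐.N) (hR : 𝔐.EvalStep R x y z) :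
    𝔐.EvalStep S x y z := by
  cases hR with
  | const k x => exact .const _ _
  | succ x => exact .succ _
  | ident x => exact .ident _
  | left a b => exact .left _ _
  | right a b => exact .right _ _
  | pair f g x a b h₁ h₂ => exact .pair _ _ _ _ _ (h _ _ _ h₁) (h _ _ _ h₂)
  | comp f g x a b h₁ h₂ => exact .comp _ _ _ _ _ (h _ _ _ h₁) (h _ _ _ h₂)
  | precZero f g a b h₁ => exact .precZero _ _ _ _ (h _ _ _ h₁)
  | precSucc f g a n b c h₁ h₂ => exact .precSucc _ _ _ _ _ _ (h _ _ _ h₁) (h _ _ _ h₂)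
  | searchStop f a n h₁ => exact .searchStop _ _ _ (h _ _ _ h₁)
  | searchNext f a n b c h₁ h₂ => exact .searchNext _ _ _ _ _ (h _ _ _ h₁) (h _ _ _ h₂)
  | index e x y h₁ => exact .index _ _ _ (h _ _ _ h₁)

section Family

variable {I : Type*} {K : I → Henkin.{u}} {par : Prop} {n m : ℕ}
  {f g h : ∀ i, (Fin n → (K i).N) → (Fin m → Set (K i).N) → (K i).N}

theorem Dfn.app₀ : Dfn K par 3 0 (fun i ρ _ => (K i).App (ρ 0) (ρ 1) (ρ 2)) := by
  unfold App; simp only [evalStep_iff]; infer_instance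

instance Dfn.app [DfnF K par n m f] [DfnF K par n m g] [DfnF K par n m h] :
    Dfn K par n m (fun i ρ σ => (K i).App (f i ρ σ) (g i ρ σ) (h i ρ σ)) :=
  Dfn.subst₃ Dfn.app₀

end Family

section Model

variable {𝔐 : Henkin.{u}} [hM : Fact 𝔐.IsModelZ2]

theorem app_iff {e x y : 𝔐.N} : 𝔐.App e x y ↔ 𝔐.EvalStep 𝔐.App e x y :=
  lfp₃_unfold EvalStep.mono (by
    show Dfn (fun _ : Unit => 𝔐) True 3 0 (fun _ ρ _ => 𝔐.EvalStep 𝔐.App (ρ 0) (ρ 1) (ρ 2))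
    simp only [evalStep_iff]; infer_instance)

/-- Induction on the first computation, with the second inverted. The tags of the codes separate the
rules, and recursion and search are settled by whether the argument, respectively the tested value,
is zero. -/
theorem App.det {e x y y' : 𝔐.N} (h : 𝔐.App e x y) (h' : 𝔐.App e x y') : y = y' := by
  refine lfp₃_induct (Φ := 𝔐.EvalStep) (fun e x y => ∀ y', 𝔐.App e x y' → y = y') inferInstance
    (fun e x y ih y' h' => ?_) h y' h'
  rw [app_iff] at h'
  cases ih with
  | const k x => simp [evalStep_iff, pair_inj] at h'; exact h'
  | succ x => simp [evalStep_iff, pair_inj] at h'; exact h'.symm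
  | ident x => simp [evalStep_iff, pair_inj] at h'; exact h'.symm
  | left a b => simp [evalStep_iff, pair_inj] at h'; exact h'
  | right a b => simp [evalStep_iff, pair_inj] at h'; exact h'
  | pair f g x a b h₁ h₂ =>
    simp [evalStep_iff, pair_inj] at h'
    obtain ⟨a', h₁', b', h₂', rfl⟩ := h'
    rw [h₁ _ h₁', h₂ _ h₂']
  | comp f g x a b h₁ h₂ =>
    simp [evalStep_iff, pair_inj] at h'
    obtain ⟨a', h₁', h₂'⟩ := h'
    exact h₂ _ (h₁ _ h₁' ▸ h₂')
  | precZero f g a b h₁ =>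
    simp [evalStep_iff, pair_inj, zero_ne_succ] at h'
    exact h₁ _ h'
  | precSucc f g a n b c h₁ h₂ =>
    simp [evalStep_iff, pair_inj, succ_ne_zero, succ_inj] at h'
    obtain ⟨b', h₁', h₂'⟩ := h'
    exact h₂ _ (h₁ _ h₁' ▸ h₂')
  | searchStop f a n h₁ =>
    simp [evalStep_iff, pair_inj] at h'
    rcases h' with ⟨h, -⟩ | ⟨⟨b, hb⟩, -⟩
    · exact h
    · exact absurd (h₁ _ hb) (zero_ne_succ _)
  | searchNext f a n b c h₁ h₂ =>
    simp [evalStep_iff, pair_inj] at h'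
    rcases h' with ⟨rfl, h⟩ | ⟨-, h⟩
    · exact absurd (h₁ _ h) (succ_ne_zero _)
    · exact h₂ _ h
  | index e x y h₁ =>
    simp [evalStep_iff, pair_inj] at h'
    exact h₁ _ h'

end Model

end Henkin

/-! ## Terms for partial recursive functions -/

/-- Untyped lambda terms (with de Bruijn indices) over pairing, recursion and case distinction on
numbers. In `fix t` the index `0` of `t` is the argument, the index `1` the function itself. -/
inductive PTerm : Type
  | var (i : ℕ)
  | num (k : ℕ)
  | succ (t : PTerm)
  | pair (s t : PTerm)
  | fst (t : PTerm)
  | snd (t : PTerm)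
  | app (s t : PTerm)
  | lam (t : PTerm)
  | fix (t : PTerm)
  | natCase (c s t : PTerm)

namespace PTerm

/-- Code of a constant function. -/
def cConst (k : ℕ) : ℕ := Nat.pair 0 k
def cSucc : ℕ := Nat.pair 1 0
def cId : ℕ := Nat.pair 2 0
def cFst : ℕ := Nat.pair 3 0
def cSnd : ℕ := Nat.pair 4 0
def cPair (f g : ℕ) : ℕ := Nat.pair 5 (Nat.pair f g)
def cComp (f g : ℕ) : ℕ := Nat.pair 6 (Nat.pair f g)
def cPrec (f g : ℕ) : ℕ := Nat.pair 7 (Nat.pair f g)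
def cIndex : ℕ := Nat.pair 9 0

/-- Code of the function that computes, from a code `k` (computed by `f`) and a number `a`
(computed by `g`), a code of `x ↦ {k}(⟨x, a⟩)`. -/
def cSmn (f g : ℕ) : ℕ :=
  cPair (cConst 6) (cPair f (cPair (cConst 5) (cPair (cConst cId) (cPair (cConst 0) g))))

def cVar : ℕ → ℕ
  | 0 => cFst
  | i + 1 => cComp (cVar i) cSnd

/-- The code of the body of a recursive function. -/
def cFix (t : ℕ) : ℕ :=
  cComp t (cPair cFst (cPair (cSmn (cComp cFst cSnd) cSnd) (cComp cSnd cSnd)))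

/-- The code of a term, as a function of (the code of) its environment. -/
def code : PTerm → ℕ
  | var i => cVar i
  | num k => cConst k
  | succ t => cComp cSucc t.code
  | pair s t => cPair s.code t.code
  | fst t => cComp cFst t.code
  | snd t => cComp cSnd t.code
  | app s t => cComp cIndex (cPair s.code t.code)
  | lam t => cSmn (cConst t.code) cId
  | fix t => cSmn (cConst (cFix t.code)) (cPair (cConst (cFix t.code)) cId)
  -- One primitive recursion selects the code of a branch and another computes the predecessor; only
  -- then does the index scheme run the selected branch. The branch not taken therefore need not
  -- have a value. The zero branch binds no variable, so it first discards the predecessor by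
  -- `cSnd`.
  | natCase c s t =>
      cComp cIndex (cPair
        (cComp (cPrec (cConst (cComp s.code cSnd)) (cConst t.code)) (cPair (cConst 0) c.code))
        (cPair (cComp (cPrec (cConst 0) (cComp cFst cSnd)) (cPair (cConst 0) c.code)) cId))

/-- The standard number with `{smn k a}(x) = {k}(⟨x, a⟩)`. -/
def smn (k a : ℕ) : ℕ := Nat.pair 6 (Nat.pair k (Nat.pair 5 (Nat.pair cId (Nat.pair 0 a))))

/-- The value of a closed term in normal form. -/
def val : PTerm → ℕ
  | num k => k
  | pair s t => Nat.pair s.val t.val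
  | lam t => smn t.code 0
  | fix t => smn (cFix t.code) (Nat.pair (cFix t.code) 0)
  | _ => 0

end PTerm

/-! ### Evaluation of program terms inside a model. -/

namespace Henkin

open PTerm

section Model

variable {𝔐 : Henkin.{u}} [hM : Fact 𝔐.IsModelZ2]

/-- The code of an environment. -/
noncomputable def envCode : List 𝔐.N → 𝔐.N
  | [] => 𝔐.zero
  | a :: l => 𝔐.pair a (envCode l)

noncomputable def smn (k a : 𝔐.N) : 𝔐.N :=
  𝔐.pair (𝔐.num 6) (𝔐.pair k (𝔐.pair (𝔐.num 5)
    (𝔐.pair (𝔐.pair (𝔐.num 2) 𝔐.zero) (𝔐.pair (𝔐.num 0) a))))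

/-- The value of `lam t` in an environment. -/
noncomputable def clo (t : PTerm) (env : List 𝔐.N) : 𝔐.N := smn (𝔐.num t.code) (envCode env)

/-- The value of `fix t` in an environment. -/
noncomputable def fixv (t : PTerm) (env : List 𝔐.N) : 𝔐.N :=
  smn (𝔐.num (cFix t.code)) (𝔐.pair (𝔐.num (cFix t.code)) (envCode env))

/-- `wp t env Q`: the term `t` has a value in the environment `env`, and it satisfies `Q`. -/
def wp : PTerm → List 𝔐.N → (𝔐.N → Prop) → Prop
  | .var i, env, Q => Q (env.getD i 𝔐.zero)
  | .num k, _, Q => Q (𝔐.num k)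
  | .succ t, env, Q => wp t env (fun x => Q (𝔐.succ x))
  | .pair s t, env, Q => wp s env (fun x => wp t env (fun y => Q (𝔐.pair x y)))
  | .fst t, env, Q => wp t env (fun x => Q (Henkin.fst x))
  | .snd t, env, Q => wp t env (fun x => Q (Henkin.snd x))
  | .app s t, env, Q => wp s env (fun x => wp t env (fun y => ∃ z, 𝔐.App x y z ∧ Q z))
  | .lam t, env, Q => Q (clo t env)
  | .fix t, env, Q => Q (fixv t env)
  | .natCase c s t, env, Q => wp c env (fun x =>
      (x = 𝔐.zero → wp s env Q) ∧ ∀ y, x = 𝔐.succ y → wp t (y :: env) Q)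

theorem App.of_step {e x y : 𝔐.N} (h : 𝔐.EvalStep 𝔐.App e x y) : 𝔐.App e x y := app_iff.2 h

theorem zero_eq_pair : 𝔐.zero = 𝔐.pair 𝔐.zero 𝔐.zero :=
  num_pair (𝔐 := 𝔐) 0 0

theorem app_cConst (k : ℕ) (x : 𝔐.N) : 𝔐.App (𝔐.num (cConst k)) x (𝔐.num k) := by
  rw [cConst, num_pair]; exact .of_step (.const _ _)

theorem app_cSucc (x : 𝔐.N) : 𝔐.App (𝔐.num cSucc) x (𝔐.succ x) := by
  rw [cSucc, num_pair]; exact .of_step (.succ _)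

theorem app_cId (x : 𝔐.N) : 𝔐.App (𝔐.num cId) x x := by
  rw [cId, num_pair]; exact .of_step (.ident _)

theorem app_cFst (x : 𝔐.N) : 𝔐.App (𝔐.num cFst) x (Henkin.fst x) := by
  obtain ⟨a, b, rfl⟩ := exists_pair x
  rw [cFst, num_pair, fst_pair]; exact .of_step (.left _ _)

theorem app_cSnd (x : 𝔐.N) : 𝔐.App (𝔐.num cSnd) x (Henkin.snd x) := by
  obtain ⟨a, b, rfl⟩ := exists_pair x
  rw [cSnd, num_pair, snd_pair]; exact .of_step (.right _ _)

theorem app_cPair {f g : ℕ} {x a b : 𝔐.N} (hf : 𝔐.App (𝔐.num f) x a)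
    (hg : 𝔐.App (𝔐.num g) x b) : 𝔐.App (𝔐.num (cPair f g)) x (𝔐.pair a b) := by
  rw [cPair, num_pair, num_pair]; exact .of_step (.pair _ _ _ _ _ hf hg)

theorem app_cComp {f g : ℕ} {x a b : 𝔐.N} (hg : 𝔐.App (𝔐.num g) x a)
    (hf : 𝔐.App (𝔐.num f) a b) : 𝔐.App (𝔐.num (cComp f g)) x b := by
  rw [cComp, num_pair, num_pair]; exact .of_step (.comp _ _ _ _ _ hg hf)

theorem app_cIndex {e x y : 𝔐.N} (h : 𝔐.App e x y) : 𝔐.App (𝔐.num cIndex) (𝔐.pair e x) y := by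
  rw [cIndex, num_pair]; exact .of_step (.index _ _ _ h)

theorem app_cPrec_zero {f g : ℕ} {a b : 𝔐.N} (h : 𝔐.App (𝔐.num f) a b) :
    𝔐.App (𝔐.num (cPrec f g)) (𝔐.pair a 𝔐.zero) b := by
  rw [cPrec, num_pair, num_pair]; exact .of_step (.precZero _ _ _ _ h)

theorem app_cPrec_succ {f g : ℕ} {a n b c : 𝔐.N}
    (h : 𝔐.App (𝔐.num (cPrec f g)) (𝔐.pair a n) b)
    (h' : 𝔐.App (𝔐.num g) (𝔐.pair a (𝔐.pair n b)) c) :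
    𝔐.App (𝔐.num (cPrec f g)) (𝔐.pair a (𝔐.succ n)) c := by
  rw [cPrec, num_pair, num_pair] at *; exact .of_step (.precSucc _ _ _ _ _ _ h h')

theorem app_smn {k a x y : 𝔐.N} (h : 𝔐.App k (𝔐.pair x a) y) : 𝔐.App (smn k a) x y :=
  .of_step (.comp _ _ _ _ _ (.of_step (.pair _ _ _ _ _ (.of_step (.ident _))
    (.of_step (.const _ _)))) h)

theorem app_cSmn {f g : ℕ} {x k a : 𝔐.N} (hf : 𝔐.App (𝔐.num f) x k)
    (hg : 𝔐.App (𝔐.num g) x a) : 𝔐.App (𝔐.num (cSmn f g)) x (smn k a) := by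
  have h := app_cConst (𝔐 := 𝔐) cId x
  rw [cId, num_pair] at h
  exact app_cPair (app_cConst _ _) (app_cPair hf (app_cPair (app_cConst _ _)
    (app_cPair h (app_cPair (app_cConst _ _) hg))))

/-- Lookup never fails: zero is the pair of two zeros, so projecting past the end of the environment
returns the default value zero. -/
theorem app_cVar (i : ℕ) (env : List 𝔐.N) :
    𝔐.App (𝔐.num (cVar i)) (envCode env) (env.getD i 𝔐.zero) := by
  induction i generalizing env with
  | zero =>
    cases env with
    | nil =>
      have := app_cFst (𝔐 := 𝔐) 𝔐.zero
      rw [zero_eq_pair, fst_pair, ← zero_eq_pair] at this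
      simpa [envCode, cVar] using this
    | cons a env => simpa [envCode, cVar] using app_cFst (𝔐.pair a (envCode env))
  | succ i ih =>
    cases env with
    | nil =>
      have := app_cSnd (𝔐 := 𝔐) 𝔐.zero
      rw [zero_eq_pair, snd_pair, ← zero_eq_pair] at this
      exact app_cComp this (by simpa [envCode] using ih [])
    | cons a env =>
      have := app_cSnd (𝔐.pair a (envCode env))
      rw [snd_pair] at this
      exact app_cComp this (by simpa [envCode] using ih env)

/-- The recursion theorem by self-reproduction. The closure stores the code `cFix t.code` next to
its environment; from these two the body rebuilds the number `fixv t env` itself and puts it into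
the environment before running `t`. -/
theorem app_fixv {t : PTerm} {env : List 𝔐.N} {a y : 𝔐.N}
    (h : 𝔐.App (𝔐.num t.code) (envCode (a :: fixv t env :: env)) y) :
    𝔐.App (fixv t env) a y := by
  refine app_smn (app_cComp (a := 𝔐.pair a (𝔐.pair (fixv t env) (envCode env))) ?_ h)
  have h₁ := app_cFst (𝔐.pair a (𝔐.pair (𝔐.num (cFix t.code)) (envCode env)))
  have h₂ := app_cSnd (𝔐.pair a (𝔐.pair (𝔐.num (cFix t.code)) (envCode env)))
  have h₃ := app_cFst (𝔐.pair (𝔐.num (cFix t.code)) (envCode env))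
  have h₄ := app_cSnd (𝔐.pair (𝔐.num (cFix t.code)) (envCode env))
  simp only [fst_pair, snd_pair] at h₁ h₂ h₃ h₄
  exact app_cPair h₁ (app_cPair (app_cSmn (app_cComp h₂ h₃) h₂) (app_cComp h₂ h₄))

/-- Primitive recursion used as a zero test. Internal induction is needed even though the earlier
value is ignored, since the rule for successors requires that it exist. -/
theorem app_cPrec_const {j k : ℕ} (a n : 𝔐.N) :
    𝔐.App (𝔐.num (cPrec (cConst j) (cConst k))) (𝔐.pair a 𝔐.zero) (𝔐.num j) ∧
    𝔐.App (𝔐.num (cPrec (cConst j) (cConst k))) (𝔐.pair a (𝔐.succ n)) (𝔐.num k) := by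
  refine ⟨app_cPrec_zero (app_cConst _ _), ?_⟩
  refine induct (fun n => 𝔐.App (𝔐.num (cPrec (cConst j) (cConst k))) (𝔐.pair a (𝔐.succ n))
    (𝔐.num k)) inferInstance ?_ (fun n ih => ?_) n
  · exact app_cPrec_succ (app_cPrec_zero (app_cConst _ _)) (app_cConst _ _)
  · exact app_cPrec_succ ih (app_cConst _ _)

theorem app_cPrec_pred (a n : 𝔐.N) :
    𝔐.App (𝔐.num (cPrec (cConst 0) (cComp cFst cSnd))) (𝔐.pair a 𝔐.zero) 𝔐.zero ∧
    𝔐.App (𝔐.num (cPrec (cConst 0) (cComp cFst cSnd))) (𝔐.pair a (𝔐.succ n)) n := by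
  have hstep : ∀ n b : 𝔐.N, 𝔐.App (𝔐.num (cComp cFst cSnd)) (𝔐.pair a (𝔐.pair n b)) n :=
    fun n b => by
      have h₁ := app_cSnd (𝔐.pair a (𝔐.pair n b))
      have h₂ := app_cFst (𝔐.pair n b)
      simp only [fst_pair, snd_pair] at h₁ h₂
      exact app_cComp h₁ h₂
  have h0 : 𝔐.App (𝔐.num (cPrec (cConst 0) (cComp cFst cSnd))) (𝔐.pair a 𝔐.zero) 𝔐.zero :=
    app_cPrec_zero (app_cConst 0 a)
  refine ⟨h0, ?_⟩
  refine induct (fun n => 𝔐.App (𝔐.num (cPrec (cConst 0) (cComp cFst cSnd)))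
    (𝔐.pair a (𝔐.succ n)) n) inferInstance ?_ (fun n ih => ?_) n
  · exact app_cPrec_succ h0 (hstep _ _)
  · exact app_cPrec_succ ih (hstep _ _)

theorem wp_mono {t : PTerm} {env : List 𝔐.N} {Q Q' : 𝔐.N → Prop} (hQ : ∀ x, Q x → Q' x)
    (h : wp t env Q) : wp t env Q' := by
  induction t generalizing env Q Q' with
  | var i => exact hQ _ h
  | num k => exact hQ _ h
  | succ t ih => exact ih (fun x => hQ _) h
  | pair s t ihs iht => exact ihs (fun x => iht fun y => hQ _) h
  | fst t ih => exact ih (fun x => hQ _) h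
  | snd t ih => exact ih (fun x => hQ _) h
  | app s t ihs iht => exact ihs (fun x => iht fun y ⟨z, hz, h⟩ => ⟨z, hz, hQ _ h⟩) h
  | lam t ih => exact hQ _ h
  | fix t ih => exact hQ _ h
  | natCase c s t ihc ihs iht =>
    exact ihc (fun x hx => ⟨fun e => ihs hQ (hx.1 e), fun y e => iht hQ (hx.2 y e)⟩) h

/-- Soundness of compilation, by induction on terms: a weakest precondition that holds guarantees
that the compiled code terminates with a suitable value. Every correctness proof of a realizer
passes through this lemma. -/
theorem exists_app_code {t : PTerm} {env : List 𝔐.N} {Q : 𝔐.N → Prop} (h : wp t env Q) :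
    ∃ y, 𝔐.App (𝔐.num t.code) (envCode env) y ∧ Q y := by
  induction t generalizing env Q with
  | var i => exact ⟨_, app_cVar i env, h⟩
  | num k => exact ⟨_, app_cConst k _, h⟩
  | succ t ih =>
    obtain ⟨y, hy, h⟩ := ih h
    exact ⟨_, app_cComp hy (app_cSucc y), h⟩
  | pair s t ihs iht =>
    obtain ⟨x, hx, h⟩ := ihs h
    obtain ⟨y, hy, h⟩ := iht h
    exact ⟨_, app_cPair hx hy, h⟩
  | fst t ih =>
    obtain ⟨y, hy, h⟩ := ih h
    exact ⟨_, app_cComp hy (app_cFst y), h⟩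
  | snd t ih =>
    obtain ⟨y, hy, h⟩ := ih h
    exact ⟨_, app_cComp hy (app_cSnd y), h⟩
  | app s t ihs iht =>
    obtain ⟨x, hx, h⟩ := ihs h
    obtain ⟨y, hy, z, hz, h⟩ := iht h
    exact ⟨z, app_cComp (app_cPair hx hy) (app_cIndex hz), h⟩
  | lam t ih => exact ⟨_, app_cSmn (app_cConst _ _) (app_cId _), h⟩
  | fix t ih =>
    exact ⟨_, app_cSmn (app_cConst _ _) (app_cPair (app_cConst _ _) (app_cId _)), h⟩
  | natCase c s t ihc ihs iht =>
    obtain ⟨x, hx, h₀, h₁⟩ := ihc h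
    rcases eq_zero_or_succ x with rfl | ⟨p, rfl⟩
    · obtain ⟨y, hy, h⟩ := ihs (h₀ rfl)
      refine ⟨y, app_cComp (app_cPair (app_cComp (app_cPair (app_cConst 0 _) hx)
        (app_cPrec_const _ 𝔐.zero).1) (app_cPair (app_cComp (app_cPair (app_cConst 0 _) hx)
        (app_cPrec_pred _ 𝔐.zero).1) (app_cId _))) (app_cIndex (app_cComp (app_cSnd _) ?_)), h⟩
      rwa [snd_pair]
    · obtain ⟨y, hy, h⟩ := iht (h₁ p rfl)
      exact ⟨y, app_cComp (app_cPair (app_cComp (app_cPair (app_cConst 0 _) hx)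
        (app_cPrec_const _ p).2) (app_cPair (app_cComp (app_cPair (app_cConst 0 _) hx)
        (app_cPrec_pred _ p).2) (app_cId _))) (app_cIndex hy), h⟩

theorem exists_app_clo {t : PTerm} {env : List 𝔐.N} {a : 𝔐.N} {Q : 𝔐.N → Prop}
    (h : wp t (a :: env) Q) : ∃ y, 𝔐.App (clo t env) a y ∧ Q y := by
  obtain ⟨y, hy, h⟩ := exists_app_code h
  exact ⟨y, app_smn hy, h⟩

theorem exists_app_fixv {t : PTerm} {env : List 𝔐.N} {a : 𝔐.N} {Q : 𝔐.N → Prop}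
    (h : wp t (a :: fixv t env :: env) Q) : ∃ y, 𝔐.App (fixv t env) a y ∧ Q y := by
  obtain ⟨y, hy, h⟩ := exists_app_code h
  exact ⟨y, app_fixv hy, h⟩

theorem num_smn (k a : ℕ) : 𝔐.num (PTerm.smn k a) = smn (𝔐.num k) (𝔐.num a) := by
  simp only [PTerm.smn, Henkin.smn, num_pair, cId]; rfl

theorem num_val_lam (t : PTerm) : 𝔐.num (PTerm.lam t).val = clo t [] := num_smn _ _

theorem num_val_fix (t : PTerm) : 𝔐.num (PTerm.fix t).val = fixv t [] := by
  rw [fixv, val, num_smn, num_pair]; rfl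

theorem num_val_pair (s t : PTerm) :
    𝔐.num (PTerm.pair s t).val = 𝔐.pair (𝔐.num s.val) (𝔐.num t.val) := num_pair _ _

end Model

end Henkin

namespace Henkin

/-! ## Realizability -/

/-! ### Definability of the realizability relation. -/

section Family

variable {I : Type*} {K : I → Henkin.{u}} {par : Prop} {n m : ℕ}
  {f : ∀ i, (Fin n → (K i).N) → (Fin m → Set (K i).N) → (K i).N}
  {X Y : ∀ i, (Fin n → (K i).N) → (Fin m → Set (K i).N) → Set (K i).N}

theorem Dfn.realizesEq₀ :
    Dfn K par 1 2 (fun i ρ σ => (K i).RealizesEq (σ 0) (σ 1) (ρ 0)) := by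
  unfold RealizesEq EqStep join; infer_instance

variable [hK : ∀ i, Fact (K i).IsModelZ2]

instance Dfn.realizesEq [hf : DfnF K par n m f] [hX : DfnS K par n m X] [hY : DfnS K par n m Y] :
    Dfn K par n m (fun i ρ σ => (K i).RealizesEq (X i ρ σ) (Y i ρ σ) (f i ρ σ)) :=
  Dfn.substVec Dfn.realizesEq₀ (fun _ => f) (fun i ρ σ => ![X i ρ σ, Y i ρ σ])
    (fun _ => hf) ⟨fun j => by fin_cases j; exacts [hX, hY]⟩

instance DfnS.join [hX : DfnS K par n m X] [hY : DfnS K par n m Y] :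
    DfnS K par n m (fun i ρ σ => (K i).join (X i ρ σ) (Y i ρ σ)) := by
  have h₀ : Dfn K par 1 2 (fun i ρ σ => ρ 0 ∈ (K i).join (σ 0) (σ 1)) := by
    unfold Henkin.join; infer_instance
  have hX' := @DfnS.weaken _ K par n m X hX
  have hY' := @DfnS.weaken _ K par n m Y hY
  exact ⟨Dfn.substVec h₀ (fun _ _ ρ _ => ρ (Fin.last n))
    (fun i ρ σ => ![X i (fun j => ρ j.castSucc) σ, Y i (fun j => ρ j.castSucc) σ])
    (fun _ => inferInstance) ⟨fun j => by fin_cases j; exacts [hX', hY']⟩⟩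

/-- External induction on the formula, giving one second-order formula per set-theoretic formula.
The quantifiers over well-founded trees become set quantifiers because being a set of the structure
is part of `IsSet`. -/
theorem Dfn.realizes₀ {k : ℕ} (φ : Form k) :
    Dfn K par 1 k (fun i ρ σ => (K i).Realizes φ σ (ρ 0)) := by
  have lift : ∀ {k : ℕ} (φ : Form k),
      Dfn K par 1 k (fun i ρ σ => (K i).Realizes φ σ (ρ 0)) →
      ∀ {n m : ℕ} (f : ∀ i, (Fin n → (K i).N) → (Fin m → Set (K i).N) → (K i).N)
        (s : ∀ i, (Fin n → (K i).N) → (Fin m → Set (K i).N) → Fin k → Set (K i).N)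
        [DfnF K par n m f] [DfnV K par n m s],
        Dfn K par n m (fun i ρ σ => (K i).Realizes φ (s i ρ σ) (f i ρ σ)) :=
    fun {k} φ h {n m} f s hf hs => Dfn.substVec h (fun _ => f) s (fun _ => hf) hs
  induction φ with
  | bot => unfold Realizes; infer_instance
  | mem i j => unfold Realizes; infer_instance
  | eq i j => unfold Realizes; infer_instance
  | and φ ψ ihφ ihψ =>
    have := @lift _ _ ihφ
    have := @lift _ _ ihψ
    unfold Realizes; infer_instance
  | or φ ψ ihφ ihψ =>
    have := @lift _ _ ihφ
    have := @lift _ _ ihψ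
    unfold Realizes; infer_instance
  | imp φ ψ ihφ ihψ =>
    have := @lift _ _ ihφ
    have := @lift _ _ ihψ
    unfold Realizes; infer_instance
  | ball i φ ih =>
    have := @lift _ _ ih
    unfold Realizes; infer_instance
  | bex i φ ih =>
    have := @lift _ _ ih
    unfold Realizes; infer_instance
  | all φ ih =>
    have := @lift _ _ ih
    unfold Realizes
    have h : Dfn K par 1 _ (fun i ρ σ => ∀ X ∈ (K i).sets, (K i).IsSet X →
      (K i).Realizes φ (_root_.extend σ X) (ρ 0)) := inferInstance
    exact h.congr fun i ρ σ _ =>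
      ⟨fun h X hX => h X hX.1 hX, fun h X _ hX => h X hX⟩
  | ex φ ih =>
    have := @lift _ _ ih
    unfold Realizes
    have h : Dfn K par 1 _ (fun i ρ σ => ∃ X ∈ (K i).sets, (K i).IsSet X ∧
      (K i).Realizes φ (_root_.extend σ X) (ρ 0)) := inferInstance
    exact h.congr fun i ρ σ _ =>
      ⟨fun ⟨X, _, h⟩ => ⟨X, h⟩, fun ⟨X, h⟩ => ⟨X, h.1.1, h⟩⟩

instance Dfn.realizes {k : ℕ} (φ : Form k)
    {s : ∀ i, (Fin n → (K i).N) → (Fin m → Set (K i).N) → Fin k → Set (K i).N}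
    [hf : DfnF K par n m f] [hs : DfnV K par n m s] :
    Dfn K par n m (fun i ρ σ => (K i).Realizes φ (s i ρ σ) (f i ρ σ)) :=
  Dfn.substVec (Dfn.realizes₀ φ) (fun _ => f) s (fun _ => hf) hs

end Family

/-! ### The recursion equation of realized equality and the clauses for formulas. -/

section Model

variable {𝔐 : Henkin.{u}} [hM : Fact 𝔐.IsModelZ2]

theorem eqStep_iff {J : Set 𝔐.N} {R : 𝔐.N → 𝔐.N → 𝔐.N → Prop} {s t e : 𝔐.N} :
    𝔐.EqStep J R s t e ↔
      (∀ a, cat s (𝔐.single a) ∈ J → ∃ y, 𝔐.App (fst e) a y ∧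
        cat t (𝔐.single (fst y)) ∈ J ∧ R (cat s (𝔐.single a)) (cat t (𝔐.single (fst y))) (snd y)) ∧
      (∀ b, cat t (𝔐.single b) ∈ J → ∃ y, 𝔐.App (snd e) b y ∧
        cat s (𝔐.single (fst y)) ∈ J ∧
        R (cat t (𝔐.single b)) (cat s (𝔐.single (fst y))) (snd y)) := by
  simp only [EqStep, concat_iff]
  constructor
  · rintro ⟨e₀, e₁, rfl, h₁, h₂⟩
    simp only [fst_pair, snd_pair]
    refine ⟨fun a ha => ?_, fun b hb => ?_⟩
    · obtain ⟨c, d, t', h, rfl, h', h''⟩ := h₁ a _ rfl ha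
      exact ⟨_, h, by simpa using h', by simpa using h''⟩
    · obtain ⟨c, d, t', h, rfl, h', h''⟩ := h₂ b _ rfl hb
      exact ⟨_, h, by simpa using h', by simpa using h''⟩
  · rintro ⟨h₁, h₂⟩
    refine ⟨fst e, snd e, (pair_fst_snd e).symm, ?_, ?_⟩
    · rintro a _ rfl ha
      obtain ⟨y, hy, h⟩ := h₁ a ha
      exact ⟨fst y, snd y, _, by rwa [pair_fst_snd], rfl, h⟩
    · rintro a _ rfl ha
      obtain ⟨y, hy, h⟩ := h₂ a ha
      exact ⟨fst y, snd y, _, by rwa [pair_fst_snd], rfl, h⟩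

theorem EqStep.mono {J : Set 𝔐.N} (R S : 𝔐.N → 𝔐.N → 𝔐.N → Prop)
    (h : ∀ x y z, R x y z → S x y z) (s t e : 𝔐.N) (hR : 𝔐.EqStep J R s t e) :
    𝔐.EqStep J S s t e := by
  rw [eqStep_iff] at *
  exact ⟨fun a ha => (hR.1 a ha).imp fun y hy => ⟨hy.1, hy.2.1, h _ _ _ hy.2.2⟩,
    fun a ha => (hR.2 a ha).imp fun y hy => ⟨hy.1, hy.2.1, h _ _ _ hy.2.2⟩⟩

theorem Def₃.lfpEqStep (J : Set 𝔐.N) [hJ : Fact (J ∈ 𝔐.sets)] {n m : ℕ}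
    {f g h : ∀ i : Unit, (Fin n → 𝔐.N) → (Fin m → Set 𝔐.N) → 𝔐.N}
    [DfnF (fun _ : Unit => 𝔐) True n m f] [DfnF (fun _ : Unit => 𝔐) True n m g]
    [DfnF (fun _ : Unit => 𝔐) True n m h] :
    Dfn (fun _ : Unit => 𝔐) True n m
      (fun i ρ σ => Lfp₃ (𝔐.EqStep J) (f i ρ σ) (g i ρ σ) (h i ρ σ)) :=
  Dfn.subst₃ (K := fun _ : Unit => 𝔐) (P := fun _ => Lfp₃ (𝔐.EqStep J)) (by
    unfold Lfp₃ EqStep; infer_instance)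

theorem lfp_eqStep_iff {J : Set 𝔐.N} (hJ : J ∈ 𝔐.sets) {s t e : 𝔐.N} :
    Lfp₃ (𝔐.EqStep J) s t e ↔ 𝔐.EqStep J (Lfp₃ (𝔐.EqStep J)) s t e := by
  have : Fact (J ∈ 𝔐.sets) := ⟨hJ⟩
  have := @Def₃.lfpEqStep 𝔐 _ J _
  refine lfp₃_unfold EqStep.mono ?_
  show Dfn (fun _ : Unit => 𝔐) True 3 0
    (fun _ ρ _ => 𝔐.EqStep J (Lfp₃ (𝔐.EqStep J)) (ρ 0) (ρ 1) (ρ 2))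
  generalize Lfp₃ (𝔐.EqStep J) = L at this ⊢
  unfold EqStep
  infer_instance

/-- What realizes equality between two nodes depends only on the subtrees above them, not on the
ambient tree. Induction on the least fixed point for `J` copies each step to `J'`. -/
theorem lfp_eqStep_congr {J J' : Set 𝔐.N} (hJ : J ∈ 𝔐.sets) (hJ' : J' ∈ 𝔐.sets)
    {s t s' t' e : 𝔐.N} (h : Lfp₃ (𝔐.EqStep J) s t e) (hs : sub J s = sub J' s')
    (ht : sub J t = sub J' t') : Lfp₃ (𝔐.EqStep J') s' t' e := by
  have : Fact (J ∈ 𝔐.sets) := ⟨hJ⟩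
  have : Fact (J' ∈ 𝔐.sets) := ⟨hJ'⟩
  have := @Def₃.lfpEqStep 𝔐 _ J' _
  refine lfp₃_induct (Φ := 𝔐.EqStep J) (fun s t e => ∀ s' t', sub J s = sub J' s' →
    sub J t = sub J' t' → Lfp₃ (𝔐.EqStep J') s' t' e) inferInstance
    (fun s t e ih s' t' hs ht => ?_) h s' t' hs ht
  have key : ∀ {s s' : 𝔐.N}, sub J s = sub J' s' → ∀ a, (cat s (𝔐.single a) ∈ J ↔
      cat s' (𝔐.single a) ∈ J') ∧
      sub J (cat s (𝔐.single a)) = sub J' (cat s' (𝔐.single a)) := fun {s s'} h a => by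
    rw [← mem_immd_sub, ← mem_immd_sub, ← sub_sub, ← sub_sub, h]
    exact ⟨Iff.rfl, rfl⟩
  rw [lfp_eqStep_iff hJ', eqStep_iff]
  rw [eqStep_iff] at ih
  refine ⟨fun a ha => ?_, fun b hb => ?_⟩
  · obtain ⟨y, hy, h₁, h₂⟩ := ih.1 a ((key hs a).1.2 ha)
    exact ⟨y, hy, (key ht _).1.1 h₁, h₂ _ _ (key hs a).2 (key ht _).2⟩
  · obtain ⟨y, hy, h₁, h₂⟩ := ih.2 b ((key ht b).1.2 hb)
    exact ⟨y, hy, (key hs _).1.1 h₁, h₂ _ _ (key ht b).2 (key hs _).2⟩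

theorem join_mem_sets {S T : Set 𝔐.N} (hS : S ∈ 𝔐.sets) (hT : T ∈ 𝔐.sets) :
    𝔐.join S T ∈ 𝔐.sets := by
  have : Fact (S ∈ 𝔐.sets) := ⟨hS⟩
  have : Fact (T ∈ 𝔐.sets) := ⟨hT⟩
  exact setOf_mem_sets (fun x => x ∈ 𝔐.join S T)

@[simp]
theorem down_join_zero (S T : Set 𝔐.N) : 𝔐.down (𝔐.join S T) (𝔐.num 0) = S := by
  ext s; simp [down, join, cons_inj, cons_ne_nil]

@[simp]
theorem down_join_one (S T : Set 𝔐.N) : 𝔐.down (𝔐.join S T) (𝔐.num 1) = T := by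
  ext s; simp [down, join, cons_inj, cons_ne_nil]

/-- `e ⊩ S ∈ T`. -/
def RealizesMem (S T : Set 𝔐.N) (e : 𝔐.N) : Prop :=
  fst e ∈ 𝔐.immd T ∧ 𝔐.RealizesEq S (𝔐.down T (fst e)) (snd e)

/-- Unfolding the fixed point once leads to nodes inside the join of `S` and `T`, where the
recursion must be read as equality of the immediate subtrees in their own joins. Independence of the
ambient tree makes the two readings agree. -/
theorem realizesEq_iff {S T : Set 𝔐.N} (hS : S ∈ 𝔐.sets) (hT : T ∈ 𝔐.sets) {e : 𝔐.N} :
    𝔐.RealizesEq S T e ↔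
      (∀ a ∈ 𝔐.immd S, ∃ y, 𝔐.App (fst e) a y ∧ RealizesMem (𝔐.down S a) T y) ∧
      (∀ b ∈ 𝔐.immd T, ∃ y, 𝔐.App (snd e) b y ∧ RealizesMem (𝔐.down T b) S y) := by
  have hJ := join_mem_sets hS hT
  have h0 := sub_single (𝔐.join S T) (𝔐.num 0)
  have h1 := sub_single (𝔐.join S T) (𝔐.num 1)
  rw [down_join_zero] at h0
  rw [down_join_one] at h1
  -- Nodes of the given join whose subtrees are `A` and `B` may be exchanged for the two
  -- distinguished nodes of the join of `A` and `B`.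
  have transfer : ∀ {s t : 𝔐.N} {A B : Set 𝔐.N} {d : 𝔐.N}, A ∈ 𝔐.sets → B ∈ 𝔐.sets →
      sub (𝔐.join S T) s = A → sub (𝔐.join S T) t = B →
      (Lfp₃ (𝔐.EqStep (𝔐.join S T)) s t d ↔ 𝔐.RealizesEq A B d) := by
    intro s t A B d hA hB hs ht
    have hJ' := join_mem_sets hA hB
    have h0' := sub_single (𝔐.join A B) (𝔐.num 0)
    have h1' := sub_single (𝔐.join A B) (𝔐.num 1)
    rw [down_join_zero] at h0'
    rw [down_join_one] at h1'
    exact ⟨fun h => lfp_eqStep_congr hJ hJ' h (hs.trans h0'.symm) (ht.trans h1'.symm),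
      fun h => lfp_eqStep_congr hJ' hJ h (h0'.trans hs.symm) (h1'.trans ht.symm)⟩
  have hsub : ∀ {s : 𝔐.N} {A : Set 𝔐.N}, sub (𝔐.join S T) s = A → ∀ a,
      (cat s (𝔐.single a) ∈ 𝔐.join S T ↔ a ∈ 𝔐.immd A) ∧
      sub (𝔐.join S T) (cat s (𝔐.single a)) = 𝔐.down A a := by
    rintro s A rfl a
    exact ⟨Iff.rfl, by rw [← sub_sub, sub_single]⟩
  rw [← transfer hS hT h0 h1, lfp_eqStep_iff hJ, eqStep_iff]
  refine and_congr (forall_congr' fun a => ?_) (forall_congr' fun b => ?_)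
  · rw [(hsub h0 a).1]
    refine imp_congr_right fun ha => exists_congr fun y => and_congr_right fun _ => ?_
    rw [(hsub h1 _).1]
    exact and_congr_right fun _ => transfer (down_mem_sets hS _) (down_mem_sets hT _)
      (hsub h0 a).2 (hsub h1 _).2
  · rw [(hsub h1 b).1]
    refine imp_congr_right fun ha => exists_congr fun y => and_congr_right fun _ => ?_
    rw [(hsub h0 _).1]
    exact and_congr_right fun _ => transfer (down_mem_sets hT _) (down_mem_sets hS _)
      (hsub h1 b).2 (hsub h0 _).2

theorem exists_eq_pair_iff {P : 𝔐.N → 𝔐.N → Prop} {e : 𝔐.N} :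
    (∃ c d, e = 𝔐.pair c d ∧ P c d) ↔ P (fst e) (snd e) :=
  ⟨fun ⟨c, d, h, hP⟩ => by subst h; simpa using hP,
    fun h => ⟨_, _, (pair_fst_snd e).symm, h⟩⟩

section Clauses

variable {n : ℕ} {ρ : Fin n → Set 𝔐.N} {e : 𝔐.N}

theorem realizes_bot : ¬ 𝔐.Realizes .bot ρ e := id

theorem realizes_mem {i j : Fin n} : 𝔐.Realizes (.mem i j) ρ e ↔ RealizesMem (ρ i) (ρ j) e := by
  simp only [Realizes, exists_eq_pair_iff]; rfl

theorem realizes_eq {i j : Fin n} : 𝔐.Realizes (.eq i j) ρ e ↔ 𝔐.RealizesEq (ρ i) (ρ j) e :=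
  Iff.rfl

theorem realizes_and {φ ψ : Form n} :
    𝔐.Realizes (.and φ ψ) ρ e ↔ 𝔐.Realizes φ ρ (fst e) ∧ 𝔐.Realizes ψ ρ (snd e) := by
  simp only [Realizes, exists_eq_pair_iff]

theorem realizes_or {φ ψ : Form n} :
    𝔐.Realizes (.or φ ψ) ρ e ↔ (fst e = 𝔐.num 0 ∧ 𝔐.Realizes φ ρ (snd e)) ∨
      (fst e = 𝔐.num 1 ∧ 𝔐.Realizes ψ ρ (snd e)) := by
  simp only [Realizes, exists_eq_pair_iff]

theorem realizes_imp {φ ψ : Form n} : 𝔐.Realizes (.imp φ ψ) ρ e ↔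
    ∀ f, 𝔐.Realizes φ ρ f → ∃ y, 𝔐.App e f y ∧ 𝔐.Realizes ψ ρ y := Iff.rfl

theorem realizes_ball {i : Fin n} {φ : Form (n + 1)} : 𝔐.Realizes (.ball i φ) ρ e ↔
    ∀ a ∈ 𝔐.immd (ρ i), ∃ y, 𝔐.App e a y ∧ 𝔐.Realizes φ (extend ρ (𝔐.down (ρ i) a)) y := Iff.rfl

theorem realizes_bex {i : Fin n} {φ : Form (n + 1)} : 𝔐.Realizes (.bex i φ) ρ e ↔
    fst e ∈ 𝔐.immd (ρ i) ∧ 𝔐.Realizes φ (extend ρ (𝔐.down (ρ i) (fst e))) (snd e) := by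
  simp only [Realizes, exists_eq_pair_iff]

theorem realizes_all {φ : Form (n + 1)} : 𝔐.Realizes (.all φ) ρ e ↔
    ∀ X, 𝔐.IsSet X → 𝔐.Realizes φ (extend ρ X) e := Iff.rfl

theorem realizes_ex {φ : Form (n + 1)} : 𝔐.Realizes (.ex φ) ρ e ↔
    ∃ X, 𝔐.IsSet X ∧ 𝔐.Realizes φ (extend ρ X) e := Iff.rfl

theorem realizes_rename {m : ℕ} (φ : Form n) {f : Fin n → Fin m} {ρ : Fin m → Set 𝔐.N}
    {e : 𝔐.N} : 𝔐.Realizes (φ.rename f) ρ e ↔ 𝔐.Realizes φ (fun i => ρ (f i)) e := by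
  induction φ generalizing m e <;> simp_all [Form.rename, Realizes, extend_comp_lift]

theorem realizes_weaken {φ : Form n} {X : Set 𝔐.N} :
    𝔐.Realizes φ.weaken (extend ρ X) e ↔ 𝔐.Realizes φ ρ e := by
  simp [Form.weaken, realizes_rename]

theorem realizes_inst {φ : Form (n + 1)} {i : Fin n} :
    𝔐.Realizes (φ.inst i) ρ e ↔ 𝔐.Realizes φ (extend ρ (ρ i)) e := by
  simp [Form.inst, realizes_rename, comp_extend]

end Clauses

end Model

end Henkin

/-- `let x = s in t`. -/
def PTerm.letin (s t : PTerm) : PTerm := .app (.lam t) s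

namespace Henkin

section Equality

variable {𝔐 : Henkin.{u}} [hM : Fact 𝔐.IsModelZ2]

theorem wp_letin {s t : PTerm} {env : List 𝔐.N} {Q : 𝔐.N → Prop}
    (h : wp s env (fun x => wp t (x :: env) Q)) : wp (.letin s t) env Q := by
  show wp s env (fun y => ∃ z, 𝔐.App (clo t env) y z ∧ Q z)
  exact wp_mono (fun _ => exists_app_clo) h

theorem exists_app_val {t : PTerm} {a : 𝔐.N} {Q : 𝔐.N → Prop} (h : wp t [a] Q) :
    ∃ y, 𝔐.App (𝔐.num (PTerm.lam t).val) a y ∧ Q y := by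
  rw [num_val_lam]; exact exists_app_clo h

theorem wp_var_zero {a : 𝔐.N} {env : List 𝔐.N} {Q : 𝔐.N → Prop} :
    wp (.var 0) (a :: env) Q = Q a := rfl

theorem wp_var_succ {i : ℕ} {a : 𝔐.N} {env : List 𝔐.N} {Q : 𝔐.N → Prop} :
    wp (.var (i + 1)) (a :: env) Q = wp (.var i) env Q := rfl

theorem wp_num {k : ℕ} {env : List 𝔐.N} {Q : 𝔐.N → Prop} :
    wp (.num k) env Q = Q (𝔐.num k) := rfl

theorem wp_pair {s t : PTerm} {env : List 𝔐.N} {Q : 𝔐.N → Prop} :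
    wp (.pair s t) env Q = wp s env (fun x => wp t env (fun y => Q (𝔐.pair x y))) := rfl

theorem wp_fst {t : PTerm} {env : List 𝔐.N} {Q : 𝔐.N → Prop} :
    wp (.fst t) env Q = wp t env (fun x => Q (fst x)) := rfl

theorem wp_snd {t : PTerm} {env : List 𝔐.N} {Q : 𝔐.N → Prop} :
    wp (.snd t) env Q = wp t env (fun x => Q (snd x)) := rfl

theorem wp_app {s t : PTerm} {env : List 𝔐.N} {Q : 𝔐.N → Prop} :
    wp (.app s t) env Q =
      wp s env (fun x => wp t env (fun y => ∃ z, 𝔐.App x y z ∧ Q z)) := rfl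

theorem wp_lam {t : PTerm} {env : List 𝔐.N} {Q : 𝔐.N → Prop} :
    wp (.lam t) env Q = Q (clo t env) := rfl

/-! ### Equality -/

/-- The recursive program `r` sends an index `a` to the pair of `a` and the pair of `r` with itself;
the latter is again the reflexivity realizer, now used for the subtree at `a`. -/
def reflBody : PTerm := .pair (.var 0) (.pair (.var 1) (.var 1))

/-- A realizer of `∀ x, x = x`. -/
def reflIdx : ℕ := (PTerm.pair (.fix reflBody) (.fix reflBody)).val

theorem num_reflIdx :
    𝔐.num reflIdx = 𝔐.pair (fixv reflBody []) (fixv reflBody []) := by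
  rw [reflIdx, num_val_pair, num_val_fix]

theorem realizesEq_refl {S : Set 𝔐.N} (hS : 𝔐.IsSet S) : 𝔐.RealizesEq S S (𝔐.num reflIdx) := by
  refine hS.induct (fun S => 𝔐.RealizesEq S S (𝔐.num reflIdx)) inferInstance fun X hX ih => ?_
  have key : ∀ a ∈ 𝔐.immd X, ∃ y, 𝔐.App (fixv reflBody []) a y ∧
      RealizesMem (𝔐.down X a) X y := fun a ha => by
    refine exists_app_fixv ?_
    simp only [reflBody, wp_pair, wp_var_zero, wp_var_succ, RealizesMem, fst_pair, snd_pair]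
    rw [← reflBody, ← num_reflIdx]
    exact ⟨ha, ih a ha⟩
  rw [realizesEq_iff hX.1 hX.1, num_reflIdx, fst_pair, snd_pair]
  exact ⟨key, key⟩

theorem realizesMem_down {S : Set 𝔐.N} (hS : 𝔐.IsSet S) {a : 𝔐.N} (ha : a ∈ 𝔐.immd S) :
    RealizesMem (𝔐.down S a) S (𝔐.pair a (𝔐.num reflIdx)) := by
  simp only [RealizesMem, fst_pair, snd_pair]
  exact ⟨ha, realizesEq_refl (hS.down ha)⟩

theorem realizesEq_symm {S T : Set 𝔐.N} (hS : S ∈ 𝔐.sets) (hT : T ∈ 𝔐.sets) {e : 𝔐.N}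
    (h : 𝔐.RealizesEq S T e) : 𝔐.RealizesEq T S (𝔐.pair (snd e) (fst e)) := by
  rw [realizesEq_iff hT hS, fst_pair, snd_pair]
  rw [realizesEq_iff hS hT] at h
  exact h.symm

/-- Follow an index through the first equality and then the second, and call the program itself on
the two resulting equalities of subtrees; the other component goes in the opposite direction. In the
innermost scope `var 4` is the program itself. -/
def transBody : PTerm :=
  .pair
    (.lam (.letin (.app (.fst (.fst (.var 1))) (.var 0))
      (.letin (.app (.fst (.snd (.var 2))) (.fst (.var 0)))
        (.pair (.fst (.var 0)) (.app (.var 4) (.pair (.snd (.var 1)) (.snd (.var 0))))))))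
    (.lam (.letin (.app (.snd (.snd (.var 1))) (.var 0))
      (.letin (.app (.snd (.fst (.var 2))) (.fst (.var 0)))
        (.pair (.fst (.var 0)) (.app (.var 4) (.pair (.snd (.var 1)) (.snd (.var 0))))))))

/-- A realizer of the transitivity of equality. -/
def transIdx : ℕ := (PTerm.fix transBody).val

theorem num_transIdx : 𝔐.num transIdx = fixv transBody [] := num_val_fix _

/-- One unfolding of the recursion. The two hypotheses are the recursive calls for the two
directions; in the second one the outer trees have changed sides. -/
theorem realizesEq_trans_step {S T U : Set 𝔐.N} (hS : S ∈ 𝔐.sets) (hT : T ∈ 𝔐.sets)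
    (hU : U ∈ 𝔐.sets) {e f : 𝔐.N} (he : 𝔐.RealizesEq S T e) (hf : 𝔐.RealizesEq T U f)
    (h₁ : ∀ a ∈ 𝔐.immd S, ∀ c, ∀ c' ∈ 𝔐.immd U, ∀ d d', 𝔐.RealizesEq (𝔐.down S a) (𝔐.down T c) d →
      𝔐.RealizesEq (𝔐.down T c) (𝔐.down U c') d' →
      ∃ y, 𝔐.App (𝔐.num transIdx) (𝔐.pair d d') y ∧
        𝔐.RealizesEq (𝔐.down S a) (𝔐.down U c') y)
    (h₂ : ∀ b ∈ 𝔐.immd U, ∀ c, ∀ c' ∈ 𝔐.immd S, ∀ d d', 𝔐.RealizesEq (𝔐.down U b) (𝔐.down T c) d →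
      𝔐.RealizesEq (𝔐.down T c) (𝔐.down S c') d' →
      ∃ y, 𝔐.App (𝔐.num transIdx) (𝔐.pair d d') y ∧
        𝔐.RealizesEq (𝔐.down U b) (𝔐.down S c') y) :
    ∃ y, 𝔐.App (𝔐.num transIdx) (𝔐.pair e f) y ∧ 𝔐.RealizesEq S U y := by
  rw [realizesEq_iff hS hT] at he
  rw [realizesEq_iff hT hU] at hf
  rw [num_transIdx] at *
  refine exists_app_fixv ?_
  conv => simp only [transBody, wp_pair, wp_lam]
  rw [← transBody, realizesEq_iff hS hU, fst_pair, snd_pair]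
  refine ⟨fun a ha => exists_app_clo (wp_letin ?_), fun b hb => exists_app_clo (wp_letin ?_)⟩
  · obtain ⟨y, hy, hyT, hye⟩ := he.1 a ha
    simp only [wp_app, wp_fst, wp_snd, wp_var_zero, wp_var_succ, fst_pair, snd_pair]
    refine ⟨y, hy, wp_letin ?_⟩
    obtain ⟨z, hz, hzU, hze⟩ := hf.1 _ hyT
    simp only [wp_app, wp_fst, wp_snd, wp_var_zero, wp_var_succ, fst_pair, snd_pair]
    refine ⟨z, hz, ?_⟩
    obtain ⟨w, hw, hwe⟩ := h₁ a ha _ _ hzU _ _ hye hze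
    simp only [wp_pair, wp_app, wp_fst, wp_snd, wp_var_zero, wp_var_succ]
    exact ⟨w, hw, by simpa using hzU, by simpa using hwe⟩
  · obtain ⟨y, hy, hyT, hye⟩ := hf.2 b hb
    simp only [wp_app, wp_fst, wp_snd, wp_var_zero, wp_var_succ, fst_pair, snd_pair]
    refine ⟨y, hy, wp_letin ?_⟩
    obtain ⟨z, hz, hzU, hze⟩ := he.2 _ hyT
    simp only [wp_app, wp_fst, wp_snd, wp_var_zero, wp_var_succ, fst_pair, snd_pair]
    refine ⟨z, hz, ?_⟩
    obtain ⟨w, hw, hwe⟩ := h₂ b hb _ _ hzU _ _ hye hze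
    simp only [wp_pair, wp_app, wp_fst, wp_snd, wp_var_zero, wp_var_succ]
    exact ⟨w, hw, by simpa using hzU, by simpa using hwe⟩

/-- Because the recursive call swaps the outer trees, the induction on `S` proves the claim with `S`
on the left and with `S` on the right at the same time. The other two trees are arbitrary sets of
the structure. -/
theorem realizesEq_trans {S T U : Set 𝔐.N} (hS : 𝔐.IsSet S) (hT : T ∈ 𝔐.sets) (hU : U ∈ 𝔐.sets)
    {e f : 𝔐.N} (he : 𝔐.RealizesEq S T e) (hf : 𝔐.RealizesEq T U f) :
    ∃ y, 𝔐.App (𝔐.num transIdx) (𝔐.pair e f) y ∧ 𝔐.RealizesEq S U y := by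
  refine (hS.induct (fun S => ∀ T ∈ 𝔐.sets, ∀ U ∈ 𝔐.sets, ∀ e f,
    (𝔐.RealizesEq S T e → 𝔐.RealizesEq T U f →
      ∃ y, 𝔐.App (𝔐.num transIdx) (𝔐.pair e f) y ∧ 𝔐.RealizesEq S U y) ∧
    (𝔐.RealizesEq U T e → 𝔐.RealizesEq T S f →
      ∃ y, 𝔐.App (𝔐.num transIdx) (𝔐.pair e f) y ∧ 𝔐.RealizesEq U S y)) inferInstance
    fun S hS ih T hT U hU e f => ⟨fun he hf => ?_, fun he hf => ?_⟩) T hT U hU e f |>.1 he hf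
  · exact realizesEq_trans_step hS.1 hT hU he hf
      (fun a ha c c' hc' d d' => (ih a ha _ (down_mem_sets hT c) _ (down_mem_sets hU c') d d').1)
      (fun b hb c c' hc' d d' => (ih c' hc' _ (down_mem_sets hT c) _ (down_mem_sets hU b) d d').2)
  · exact realizesEq_trans_step hU hT hS.1 he hf
      (fun a ha c c' hc' d d' => (ih c' hc' _ (down_mem_sets hT c) _ (down_mem_sets hU a) d d').2)
      (fun b hb c c' hc' d d' => (ih b hb _ (down_mem_sets hT c) _ (down_mem_sets hU c') d d').1)

end Equality

end Henkin

namespace Henkin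

/-! ### Substitutivity of equality -/

section Trivial

variable {𝔐 : Henkin.{u}} [hM : Fact 𝔐.IsModelZ2]

/-- The tree of the empty set. -/
def emptyTree (𝔐 : Henkin.{u}) : Set 𝔐.N := {s | s = 𝔐.nil}

theorem immd_emptyTree : 𝔐.immd 𝔐.emptyTree = ∅ := by
  ext a; simp [immd, emptyTree, single, cons_ne_nil]

theorem isSet_emptyTree : 𝔐.IsSet 𝔐.emptyTree := by
  refine isSet_of_down (setOf_mem_sets (fun s => s = 𝔐.nil)) rfl (fun a s h => ?_) fun a ha => ?_
  · exact absurd h (cons_ne_nil _ _)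
  · rw [immd_emptyTree] at ha; exact ha.elim

/-- `d` transports along `e₁ : S = S'` and `e₂ : T = T'`. -/
def conjIdx : ℕ := (PTerm.lam (.app (.num transIdx) (.pair (.app (.num transIdx)
  (.pair (.pair (.snd (.fst (.var 0))) (.fst (.fst (.var 0)))) (.fst (.snd (.var 0)))))
  (.snd (.snd (.var 0)))))).val

theorem realizesEq_conj {S S' T T' : Set 𝔐.N} (hS : 𝔐.IsSet S) (hS' : 𝔐.IsSet S')
    (hT : T ∈ 𝔐.sets) (hT' : T' ∈ 𝔐.sets) {e₁ d e₂ : 𝔐.N} (h₁ : 𝔐.RealizesEq S S' e₁)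
    (h : 𝔐.RealizesEq S T d) (h₂ : 𝔐.RealizesEq T T' e₂) :
    ∃ y, 𝔐.App (𝔐.num conjIdx) (𝔐.pair e₁ (𝔐.pair d e₂)) y ∧ 𝔐.RealizesEq S' T' y := by
  obtain ⟨x, hx, hx'⟩ := realizesEq_trans hS' hS.1 hT (realizesEq_symm hS.1 hS'.1 h₁) h
  obtain ⟨y, hy, hy'⟩ := realizesEq_trans hS' hT hT' hx' h₂
  refine exists_app_val ?_
  simp only [wp, List.getD_cons_zero, List.getD_cons_succ, fst_pair, snd_pair]
  exact ⟨x, hx, y, hy, hy'⟩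

/-- `g` codes a list of realizers of `ρ i = ρ' i`. -/
def EqList : {n : ℕ} → (Fin n → Set 𝔐.N) → (Fin n → Set 𝔐.N) → 𝔐.N → Prop
  | 0, _, _, _ => True
  | n + 1, ρ, ρ', g => 𝔐.RealizesEq (ρ (Fin.last n)) (ρ' (Fin.last n)) (fst g) ∧
      EqList (fun i => ρ i.castSucc) (fun i => ρ' i.castSucc) (snd g)

theorem EqList.extend {n : ℕ} {ρ ρ' : Fin n → Set 𝔐.N} {g e : 𝔐.N} {X Y : Set 𝔐.N}
    (he : 𝔐.RealizesEq X Y e) (h : EqList ρ ρ' g) :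
    EqList (_root_.extend ρ X) (_root_.extend ρ' Y) (𝔐.pair e g) := by
  simpa [EqList] using And.intro he h

end Trivial

theorem exists_eqList_proj {n : ℕ} (i : Fin n) : ∃ s : ℕ, ∀ (𝔐 : Henkin.{u}) [Fact 𝔐.IsModelZ2]
    (ρ ρ' : Fin n → Set 𝔐.N) (g : 𝔐.N), EqList ρ ρ' g →
    ∃ y, 𝔐.App (𝔐.num s) g y ∧ 𝔐.RealizesEq (ρ i) (ρ' i) y := by
  induction n with
  | zero => exact i.elim0
  | succ n ih =>
    induction i using Fin.lastCases with
    | last =>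
      refine ⟨(PTerm.lam (.fst (.var 0))).val, fun 𝔐 _ ρ ρ' g h => exists_app_val ?_⟩
      simp only [wp, List.getD_cons_zero, List.getD_cons_succ, fst_pair, snd_pair]
      exact h.1
    | cast i =>
      obtain ⟨s, hs⟩ := ih i
      refine ⟨(PTerm.lam (.app (.num s) (.snd (.var 0)))).val,
        fun 𝔐 _ ρ ρ' g h => exists_app_val ?_⟩
      simp only [wp, List.getD_cons_zero, List.getD_cons_succ, fst_pair, snd_pair]
      exact hs 𝔐 _ _ _ h.2

theorem exists_eqList_symm (n : ℕ) : ∃ s : ℕ, ∀ (𝔐 : Henkin.{u}) [Fact 𝔐.IsModelZ2]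
    (ρ ρ' : Fin n → Set 𝔐.N) (g : 𝔐.N), (∀ i, ρ i ∈ 𝔐.sets) → (∀ i, ρ' i ∈ 𝔐.sets) →
    EqList ρ ρ' g → ∃ y, 𝔐.App (𝔐.num s) g y ∧ EqList ρ' ρ y := by
  induction n with
  | zero => exact ⟨(PTerm.lam (.var 0)).val, fun 𝔐 _ ρ ρ' g _ _ _ => exists_app_val trivial⟩
  | succ n ih =>
    obtain ⟨s, hs⟩ := ih
    refine ⟨(PTerm.lam (.pair (.pair (.snd (.fst (.var 0))) (.fst (.fst (.var 0))))
      (.app (.num s) (.snd (.var 0))))).val, fun 𝔐 _ ρ ρ' g hρ hρ' h => exists_app_val ?_⟩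
    simp only [wp, List.getD_cons_zero, List.getD_cons_succ, fst_pair, snd_pair]
    obtain ⟨y, hy, hy'⟩ := hs 𝔐 _ _ _ (fun i => hρ _) (fun i => hρ' _) h.2
    refine ⟨y, hy, ?_⟩
    simp only [EqList, fst_pair, snd_pair]
    exact ⟨realizesEq_symm (hρ _) (hρ' _) h.1, hy'⟩

theorem exists_eqList_refl (n : ℕ) : ∃ s : ℕ, ∀ (𝔐 : Henkin.{u}) [Fact 𝔐.IsModelZ2]
    (ρ : Fin n → Set 𝔐.N), (∀ i, 𝔐.IsSet (ρ i)) → EqList ρ ρ (𝔐.num s) := by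
  induction n with
  | zero => exact ⟨0, fun 𝔐 _ ρ _ => trivial⟩
  | succ n ih =>
    obtain ⟨s, hs⟩ := ih
    refine ⟨Nat.pair reflIdx s, fun 𝔐 _ ρ hρ => ?_⟩
    rw [num_pair]
    simp only [EqList, fst_pair, snd_pair]
    exact ⟨realizesEq_refl (hρ _), hs 𝔐 _ fun i => hρ _⟩

theorem isSet_extend {𝔐 : Henkin.{u}} {n : ℕ} {ρ : Fin n → Set 𝔐.N} (h : ∀ i, 𝔐.IsSet (ρ i))
    {X : Set 𝔐.N} (hX : 𝔐.IsSet X) (i : Fin (n + 1)) : 𝔐.IsSet (extend ρ X i) := by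
  induction i using Fin.lastCases with
  | last => simpa
  | cast i => simpa using h i

/-- Realizability respects equality, uniformly. -/
theorem exists_transport {n : ℕ} (φ : Form n) : ∃ s : ℕ, ∀ (𝔐 : Henkin.{u})
    [Fact 𝔐.IsModelZ2] (ρ ρ' : Fin n → Set 𝔐.N) (g f : 𝔐.N), (∀ i, 𝔐.IsSet (ρ i)) →
    (∀ i, 𝔐.IsSet (ρ' i)) → EqList ρ ρ' g → 𝔐.Realizes φ ρ f →
    ∃ y, 𝔐.App (𝔐.num s) (𝔐.pair g f) y ∧ 𝔐.Realizes φ ρ' y := by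
  induction φ with
  | bot => exact ⟨0, fun 𝔐 _ ρ ρ' g f _ _ _ h => (realizes_bot h).elim⟩
  | @mem n i j =>
    obtain ⟨p, hp⟩ := exists_eqList_proj.{u} i
    obtain ⟨q, hq⟩ := exists_eqList_proj.{u} j
    refine ⟨(PTerm.lam (.letin (.app (.fst (.app (.num q) (.fst (.var 0)))) (.fst (.snd (.var 0))))
      (.pair (.fst (.var 0)) (.app (.num conjIdx) (.pair (.app (.num p) (.fst (.var 1)))
        (.pair (.snd (.snd (.var 1))) (.snd (.var 0)))))))).val,
      fun 𝔐 _ ρ ρ' g f hρ hρ' hg hf => exists_app_val (wp_letin ?_)⟩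
    rw [realizes_mem] at hf
    obtain ⟨x, hx, hx'⟩ := hp 𝔐 _ _ _ hg
    obtain ⟨y, hy, hy'⟩ := hq 𝔐 _ _ _ hg
    rw [realizesEq_iff (hρ j).1 (hρ' j).1] at hy'
    obtain ⟨z, hz, hz', hz''⟩ := hy'.1 _ hf.1
    obtain ⟨w, hw, hw'⟩ := realizesEq_conj (hρ i) (hρ' i) (down_mem_sets (hρ j).1 _)
      (down_mem_sets (hρ' j).1 _) hx' hf.2 hz''
    simp only [wp, List.getD_cons_zero, List.getD_cons_succ, fst_pair, snd_pair]
    refine ⟨y, hy, z, hz, x, hx, w, hw, ?_⟩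
    rw [realizes_mem]
    simp only [RealizesMem, fst_pair, snd_pair]
    exact ⟨hz', hw'⟩
  | @eq n i j =>
    obtain ⟨p, hp⟩ := exists_eqList_proj.{u} i
    obtain ⟨q, hq⟩ := exists_eqList_proj.{u} j
    refine ⟨(PTerm.lam (.app (.num conjIdx) (.pair (.app (.num p) (.fst (.var 0)))
        (.pair (.snd (.var 0)) (.app (.num q) (.fst (.var 0))))))).val,
      fun 𝔐 _ ρ ρ' g f hρ hρ' hg hf => exists_app_val ?_⟩
    obtain ⟨x, hx, hx'⟩ := hp 𝔐 _ _ _ hg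
    obtain ⟨y, hy, hy'⟩ := hq 𝔐 _ _ _ hg
    obtain ⟨w, hw, hw'⟩ := realizesEq_conj (hρ i) (hρ' i) (hρ j).1 (hρ' j).1 hx' hf hy'
    simp only [wp, List.getD_cons_zero, List.getD_cons_succ, fst_pair, snd_pair]
    exact ⟨x, hx, y, hy, w, hw, hw'⟩
  | @and n φ ψ ihφ ihψ =>
    obtain ⟨p, hp⟩ := ihφ
    obtain ⟨q, hq⟩ := ihψ
    refine ⟨(PTerm.lam (.pair (.app (.num p) (.pair (.fst (.var 0)) (.fst (.snd (.var 0)))))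
      (.app (.num q) (.pair (.fst (.var 0)) (.snd (.snd (.var 0))))))).val,
      fun 𝔐 _ ρ ρ' g f hρ hρ' hg hf => exists_app_val ?_⟩
    rw [realizes_and] at hf
    obtain ⟨x, hx, hx'⟩ := hp 𝔐 _ _ _ _ hρ hρ' hg hf.1
    obtain ⟨y, hy, hy'⟩ := hq 𝔐 _ _ _ _ hρ hρ' hg hf.2
    simp only [wp, List.getD_cons_zero, List.getD_cons_succ, fst_pair, snd_pair]
    refine ⟨x, hx, y, hy, ?_⟩
    rw [realizes_and]
    simp only [fst_pair, snd_pair]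
    exact ⟨hx', hy'⟩
  | @or n φ ψ ihφ ihψ =>
    obtain ⟨p, hp⟩ := ihφ
    obtain ⟨q, hq⟩ := ihψ
    refine ⟨(PTerm.lam (.pair (.fst (.snd (.var 0))) (.natCase (.fst (.snd (.var 0)))
      (.app (.num p) (.pair (.fst (.var 0)) (.snd (.snd (.var 0)))))
      (.app (.num q) (.pair (.fst (.var 1)) (.snd (.snd (.var 1)))))))).val,
      fun 𝔐 _ ρ ρ' g f hρ hρ' hg hf => exists_app_val ?_⟩
    rw [realizes_or] at hf
    simp only [wp, List.getD_cons_zero, List.getD_cons_succ, fst_pair, snd_pair]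
    rcases hf with ⟨h0, h⟩ | ⟨h1, h⟩
    · rw [h0]
      obtain ⟨x, hx, hx'⟩ := hp 𝔐 _ _ _ _ hρ hρ' hg h
      refine ⟨fun _ => ⟨x, hx, ?_⟩, fun y hy => absurd hy.symm (succ_ne_zero _)⟩
      simpa [realizes_or] using hx'
    · rw [h1]
      obtain ⟨x, hx, hx'⟩ := hq 𝔐 _ _ _ _ hρ hρ' hg h
      refine ⟨fun h => absurd h (succ_ne_zero _), fun y hy => ⟨x, hx, ?_⟩⟩
      simpa [realizes_or] using hx'
  -- The premise has to be transported backwards, which is why the list of equalities is first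
  -- reversed.
  | @imp n φ ψ ihφ ihψ =>
    obtain ⟨p, hp⟩ := ihφ
    obtain ⟨q, hq⟩ := ihψ
    obtain ⟨r, hr⟩ := exists_eqList_symm.{u} n
    refine ⟨(PTerm.lam (.lam (.app (.num q) (.pair (.fst (.var 1)) (.app (.snd (.var 1))
      (.app (.num p) (.pair (.app (.num r) (.fst (.var 1))) (.var 0)))))))).val,
      fun 𝔐 _ ρ ρ' g f hρ hρ' hg hf => exists_app_val ?_⟩
    simp only [wp, List.getD_cons_zero, List.getD_cons_succ, fst_pair, snd_pair]
    refine fun a ha => exists_app_clo ?_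
    obtain ⟨x, hx, hx'⟩ := hr 𝔐 _ _ _ (fun i => (hρ i).1) (fun i => (hρ' i).1) hg
    obtain ⟨y, hy, hy'⟩ := hp 𝔐 _ _ _ _ hρ' hρ hx' ha
    obtain ⟨z, hz, hz'⟩ := hf y hy'
    simp only [wp, List.getD_cons_zero, List.getD_cons_succ, fst_pair, snd_pair]
    exact ⟨x, hx, y, hy, z, hz, hq 𝔐 _ _ _ _ hρ hρ' hg hz'⟩
  | @ball n i φ ih =>
    obtain ⟨p, hp⟩ := ih
    obtain ⟨q, hq⟩ := exists_eqList_proj.{u} i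
    refine ⟨(PTerm.lam (.lam (.letin (.app (.snd (.app (.num q) (.fst (.var 1)))) (.var 0))
      (.app (.num p) (.pair (.pair (.pair (.snd (.snd (.var 0))) (.fst (.snd (.var 0))))
        (.fst (.var 2))) (.app (.snd (.var 2)) (.fst (.var 0)))))))).val,
      fun 𝔐 _ ρ ρ' g f hρ hρ' hg hf => exists_app_val ?_⟩
    simp only [wp, List.getD_cons_zero, List.getD_cons_succ, fst_pair, snd_pair]
    refine fun a ha => exists_app_clo (wp_letin ?_)
    obtain ⟨y, hy, hy'⟩ := hq 𝔐 _ _ _ hg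
    rw [realizesEq_iff (hρ i).1 (hρ' i).1] at hy'
    obtain ⟨z, hz, hz', hz''⟩ := hy'.2 _ ha
    obtain ⟨w, hw, hw'⟩ := hf _ hz'
    simp only [wp, List.getD_cons_zero, List.getD_cons_succ, fst_pair, snd_pair]
    exact ⟨y, hy, z, hz, w, hw, hp 𝔐 _ _ _ _ (isSet_extend hρ ((hρ i).down hz'))
      (isSet_extend hρ' ((hρ' i).down ha)) (.extend
        (realizesEq_symm (down_mem_sets (hρ' i).1 _) (down_mem_sets (hρ i).1 _) hz'') hg) hw'⟩
  | @bex n i φ ih =>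
    obtain ⟨p, hp⟩ := ih
    obtain ⟨q, hq⟩ := exists_eqList_proj.{u} i
    refine ⟨(PTerm.lam (.letin (.app (.fst (.app (.num q) (.fst (.var 0)))) (.fst (.snd (.var 0))))
      (.pair (.fst (.var 0)) (.app (.num p) (.pair (.pair (.snd (.var 0)) (.fst (.var 1)))
        (.snd (.snd (.var 1)))))))).val,
      fun 𝔐 _ ρ ρ' g f hρ hρ' hg hf => exists_app_val (wp_letin ?_)⟩
    rw [realizes_bex] at hf
    obtain ⟨y, hy, hy'⟩ := hq 𝔐 _ _ _ hg
    rw [realizesEq_iff (hρ i).1 (hρ' i).1] at hy'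
    obtain ⟨z, hz, hz', hz''⟩ := hy'.1 _ hf.1
    obtain ⟨w, hw, hw'⟩ := hp 𝔐 _ _ _ _ (isSet_extend hρ ((hρ i).down hf.1))
      (isSet_extend hρ' ((hρ' i).down hz')) (.extend hz'' hg) hf.2
    simp only [wp, List.getD_cons_zero, List.getD_cons_succ, fst_pair, snd_pair]
    refine ⟨y, hy, z, hz, w, hw, ?_⟩
    rw [realizes_bex]
    simp only [fst_pair, snd_pair]
    exact ⟨hz', hw'⟩
  | @all n φ ih =>
    obtain ⟨p, hp⟩ := ih
    refine ⟨(PTerm.lam (.app (.num p)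
      (.pair (.pair (.num reflIdx) (.fst (.var 0))) (.snd (.var 0))))).val,
      fun 𝔐 _ ρ ρ' g f hρ hρ' hg hf => exists_app_val ?_⟩
    -- A single output must serve every `X`. The input of the program does not mention `X`, so by
    -- determinism all outputs coincide; the empty tree shows that there is an output at all.
    have key := fun X (hX : 𝔐.IsSet X) => hp 𝔐 _ _ _ _ (isSet_extend hρ hX)
      (isSet_extend hρ' hX) (.extend (realizesEq_refl hX) hg) (hf X hX)
    obtain ⟨y, hy, -⟩ := key _ isSet_emptyTree
    simp only [wp, List.getD_cons_zero, List.getD_cons_succ, fst_pair, snd_pair]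
    refine ⟨y, hy, fun X hX => ?_⟩
    obtain ⟨z, hz, hz'⟩ := key X hX
    rwa [hy.det hz]
  | @ex n φ ih =>
    obtain ⟨p, hp⟩ := ih
    refine ⟨(PTerm.lam (.app (.num p)
      (.pair (.pair (.num reflIdx) (.fst (.var 0))) (.snd (.var 0))))).val,
      fun 𝔐 _ ρ ρ' g f hρ hρ' hg ⟨X, hX, hf⟩ => exists_app_val ?_⟩
    obtain ⟨y, hy, hy'⟩ := hp 𝔐 _ _ _ _ (isSet_extend hρ hX)
      (isSet_extend hρ' hX) (.extend (realizesEq_refl hX) hg) hf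
    simp only [wp, List.getD_cons_zero, List.getD_cons_succ, fst_pair, snd_pair]
    exact ⟨y, hy, X, hX, hy'⟩

/-- Substitution of equals for the last variable. -/
theorem exists_transport_last {n : ℕ} (φ : Form (n + 1)) : ∃ s : ℕ, ∀ (𝔐 : Henkin.{u})
    [Fact 𝔐.IsModelZ2] (ρ : Fin n → Set 𝔐.N) (X Y : Set 𝔐.N) (e f : 𝔐.N), (∀ i, 𝔐.IsSet (ρ i)) →
    𝔐.IsSet X → 𝔐.IsSet Y → 𝔐.RealizesEq X Y e → 𝔐.Realizes φ (extend ρ X) f →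
    ∃ y, 𝔐.App (𝔐.num s) (𝔐.pair e f) y ∧ 𝔐.Realizes φ (extend ρ Y) y := by
  obtain ⟨p, hp⟩ := exists_transport.{u} φ
  obtain ⟨q, hq⟩ := exists_eqList_refl.{u} n
  refine ⟨(PTerm.lam (.app (.num p)
      (.pair (.pair (.fst (.var 0)) (.num q)) (.snd (.var 0))))).val,
    fun 𝔐 _ ρ X Y e f hρ hX hY he hf => exists_app_val ?_⟩
  simp only [wp, List.getD_cons_zero, List.getD_cons_succ, fst_pair, snd_pair]
  exact hp 𝔐 _ _ _ _ (isSet_extend hρ hX) (isSet_extend hρ hY) (.extend he (hq 𝔐 ρ hρ)) hf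

end Henkin

namespace Henkin

/-! ### Soundness of intuitionistic logic -/

section Context

variable {𝔐 : Henkin.{u}} [hM : Fact 𝔐.IsModelZ2]

/-- `g` codes a list of realizers of the formulas in `Γ`. -/
def RealizesCtx {n : ℕ} : List (Form n) → (Fin n → Set 𝔐.N) → 𝔐.N → Prop
  | [], _, _ => True
  | φ :: Γ, ρ, g => 𝔐.Realizes φ ρ (fst g) ∧ RealizesCtx Γ ρ (snd g)

theorem RealizesCtx.cons {n : ℕ} {Γ : List (Form n)} {φ : Form n} {ρ : Fin n → Set 𝔐.N}
    {e g : 𝔐.N} (he : 𝔐.Realizes φ ρ e) (hg : RealizesCtx Γ ρ g) :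
    RealizesCtx (φ :: Γ) ρ (𝔐.pair e g) := by
  simpa only [RealizesCtx, fst_pair, snd_pair] using And.intro he hg

theorem RealizesCtx.weaken {n : ℕ} {Γ : List (Form n)} {ρ : Fin n → Set 𝔐.N} {X : Set 𝔐.N}
    {g : 𝔐.N} (h : RealizesCtx Γ ρ g) : RealizesCtx (Γ.map Form.weaken) (extend ρ X) g := by
  induction Γ generalizing g with
  | nil => trivial
  | cons φ Γ ih => exact ⟨realizes_weaken.2 h.1, ih h.2⟩

end Context

theorem exists_realizesCtx_proj {n : ℕ} {Γ : List (Form n)} {φ : Form n} (h : φ ∈ Γ) :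
    ∃ s : ℕ, ∀ (𝔐 : Henkin.{u}) [Fact 𝔐.IsModelZ2] (ρ : Fin n → Set 𝔐.N) (g : 𝔐.N),
    RealizesCtx Γ ρ g → ∃ y, 𝔐.App (𝔐.num s) g y ∧ 𝔐.Realizes φ ρ y := by
  induction Γ with
  | nil => cases h
  | cons ψ Γ ih =>
    rcases List.mem_cons.1 h with rfl | h
    · refine ⟨(PTerm.lam (.fst (.var 0))).val, fun 𝔐 _ ρ g h => exists_app_val ?_⟩
      simp only [wp, List.getD_cons_zero, List.getD_cons_succ, fst_pair, snd_pair]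
      exact h.1
    · obtain ⟨s, hs⟩ := ih h
      refine ⟨(PTerm.lam (.app (.num s) (.snd (.var 0)))).val, fun 𝔐 _ ρ g h => exists_app_val ?_⟩
      simp only [wp, List.getD_cons_zero, List.getD_cons_succ, fst_pair, snd_pair]
      exact hs 𝔐 _ _ h.2

/-- Each rule is translated into a program acting on a list of realizers of the assumptions. Tree
parameters never enter the computation, and the program is chosen before the model. -/
theorem exists_realizer_of_derives {Ax : Form 0 → Prop} (hAx : ∀ φ, Ax φ → Realized.{u} φ) {n : ℕ}
    {Γ : List (Form n)} {φ : Form n} (h : Derives Ax Γ φ) :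
    ∃ s : ℕ, ∀ (𝔐 : Henkin.{u}) [Fact 𝔐.IsModelZ2] (ρ : Fin n → Set 𝔐.N) (g : 𝔐.N),
    (∀ i, 𝔐.IsSet (ρ i)) → RealizesCtx Γ ρ g → ∃ y, 𝔐.App (𝔐.num s) g y ∧ 𝔐.Realizes φ ρ y := by
  induction h with
  | @ax n Γ φ h =>
    obtain ⟨e, he⟩ := hAx φ h
    refine ⟨(PTerm.lam (.num e)).val, fun 𝔐 hM ρ g _ _ => exists_app_val ?_⟩
    simp only [wp, List.getD_cons_zero, List.getD_cons_succ, fst_pair, snd_pair]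
    rw [realizes_rename]
    convert he 𝔐 hM.out using 1
  | hyp h =>
    obtain ⟨s, hs⟩ := exists_realizesCtx_proj.{u} h
    exact ⟨s, fun 𝔐 _ ρ g _ => hs 𝔐 ρ g⟩
  | botE _ ih =>
    obtain ⟨s, hs⟩ := ih
    refine ⟨0, fun 𝔐 _ ρ g hρ hg => ?_⟩
    obtain ⟨y, -, hy⟩ := hs 𝔐 ρ g hρ hg
    exact (realizes_bot hy).elim
  | andI _ _ ih₁ ih₂ =>
    obtain ⟨p, hp⟩ := ih₁
    obtain ⟨q, hq⟩ := ih₂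
    refine ⟨(PTerm.lam (.pair (.app (.num p) (.var 0)) (.app (.num q) (.var 0)))).val,
      fun 𝔐 _ ρ g hρ hg => exists_app_val ?_⟩
    obtain ⟨x, hx, hx'⟩ := hp 𝔐 ρ g hρ hg
    obtain ⟨y, hy, hy'⟩ := hq 𝔐 ρ g hρ hg
    simp only [wp, List.getD_cons_zero, List.getD_cons_succ, fst_pair, snd_pair]
    refine ⟨x, hx, y, hy, ?_⟩
    simpa only [realizes_and, fst_pair, snd_pair] using And.intro hx' hy'
  | andE₁ _ ih =>
    obtain ⟨p, hp⟩ := ih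
    refine ⟨(PTerm.lam (.fst (.app (.num p) (.var 0)))).val,
      fun 𝔐 _ ρ g hρ hg => exists_app_val ?_⟩
    obtain ⟨x, hx, hx'⟩ := hp 𝔐 ρ g hρ hg
    simp only [wp, List.getD_cons_zero, List.getD_cons_succ, fst_pair, snd_pair]
    exact ⟨x, hx, (realizes_and.1 hx').1⟩
  | andE₂ _ ih =>
    obtain ⟨p, hp⟩ := ih
    refine ⟨(PTerm.lam (.snd (.app (.num p) (.var 0)))).val,
      fun 𝔐 _ ρ g hρ hg => exists_app_val ?_⟩
    obtain ⟨x, hx, hx'⟩ := hp 𝔐 ρ g hρ hg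
    simp only [wp, List.getD_cons_zero, List.getD_cons_succ, fst_pair, snd_pair]
    exact ⟨x, hx, (realizes_and.1 hx').2⟩
  | orI₁ _ ih =>
    obtain ⟨p, hp⟩ := ih
    refine ⟨(PTerm.lam (.pair (.num 0) (.app (.num p) (.var 0)))).val,
      fun 𝔐 _ ρ g hρ hg => exists_app_val ?_⟩
    obtain ⟨x, hx, hx'⟩ := hp 𝔐 ρ g hρ hg
    simp only [wp, List.getD_cons_zero, List.getD_cons_succ, fst_pair, snd_pair]
    refine ⟨x, hx, ?_⟩
    simpa [realizes_or] using hx'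
  | orI₂ _ ih =>
    obtain ⟨p, hp⟩ := ih
    refine ⟨(PTerm.lam (.pair (.num 1) (.app (.num p) (.var 0)))).val,
      fun 𝔐 _ ρ g hρ hg => exists_app_val ?_⟩
    obtain ⟨x, hx, hx'⟩ := hp 𝔐 ρ g hρ hg
    simp only [wp, List.getD_cons_zero, List.getD_cons_succ, fst_pair, snd_pair]
    refine ⟨x, hx, ?_⟩
    simpa [realizes_or] using hx'
  | orE _ _ _ ih ih₁ ih₂ =>
    obtain ⟨p, hp⟩ := ih
    obtain ⟨q, hq⟩ := ih₁
    obtain ⟨r, hr⟩ := ih₂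
    refine ⟨(PTerm.lam (.letin (.app (.num p) (.var 0)) (.natCase (.fst (.var 0))
      (.app (.num q) (.pair (.snd (.var 0)) (.var 1)))
      (.app (.num r) (.pair (.snd (.var 1)) (.var 2)))))).val,
      fun 𝔐 _ ρ g hρ hg => exists_app_val (wp_letin ?_)⟩
    obtain ⟨x, hx, hx'⟩ := hp 𝔐 ρ g hρ hg
    simp only [wp, List.getD_cons_zero, List.getD_cons_succ, fst_pair, snd_pair]
    refine ⟨x, hx, ?_⟩
    rcases realizes_or.1 hx' with ⟨h0, h⟩ | ⟨h1, h⟩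
    · rw [h0]
      exact ⟨fun _ => hq 𝔐 _ _ hρ (.cons h hg), fun y hy => absurd hy.symm (succ_ne_zero _)⟩
    · rw [h1]
      exact ⟨fun h => absurd h (succ_ne_zero _), fun _ _ => hr 𝔐 _ _ hρ (.cons h hg)⟩
  | impI _ ih =>
    obtain ⟨p, hp⟩ := ih
    refine ⟨(PTerm.lam (.lam (.app (.num p) (.pair (.var 0) (.var 1))))).val,
      fun 𝔐 _ ρ g hρ hg => exists_app_val ?_⟩
    simp only [wp, List.getD_cons_zero, List.getD_cons_succ, fst_pair, snd_pair]
    refine fun f hf => exists_app_clo ?_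
    simp only [wp, List.getD_cons_zero, List.getD_cons_succ, fst_pair, snd_pair]
    exact hp 𝔐 _ _ hρ (.cons hf hg)
  | impE _ _ ih₁ ih₂ =>
    obtain ⟨p, hp⟩ := ih₁
    obtain ⟨q, hq⟩ := ih₂
    refine ⟨(PTerm.lam (.app (.app (.num p) (.var 0)) (.app (.num q) (.var 0)))).val,
      fun 𝔐 _ ρ g hρ hg => exists_app_val ?_⟩
    obtain ⟨x, hx, hx'⟩ := hp 𝔐 ρ g hρ hg
    obtain ⟨y, hy, hy'⟩ := hq 𝔐 ρ g hρ hg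
    simp only [wp, List.getD_cons_zero, List.getD_cons_succ, fst_pair, snd_pair]
    exact ⟨x, hx, y, hy, hx' y hy'⟩
  | allI _ ih =>
    obtain ⟨p, hp⟩ := ih
    refine ⟨p, fun 𝔐 _ ρ g hρ hg => ?_⟩
    have key := fun X (hX : 𝔐.IsSet X) => hp 𝔐 _ g (isSet_extend hρ hX) hg.weaken
    -- The domain is inhabited, so the program terminates; its value cannot depend on `X`, which is
    -- not part of the input.
    obtain ⟨y, hy, -⟩ := key _ isSet_emptyTree
    refine ⟨y, hy, fun X hX => ?_⟩
    obtain ⟨z, hz, hz'⟩ := key X hX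
    rwa [hy.det hz]
  | allE i _ ih =>
    obtain ⟨p, hp⟩ := ih
    refine ⟨p, fun 𝔐 _ ρ g hρ hg => ?_⟩
    obtain ⟨y, hy, h⟩ := hp 𝔐 ρ g hρ hg
    exact ⟨y, hy, realizes_inst.2 (h _ (hρ i))⟩
  | exI i _ ih =>
    obtain ⟨p, hp⟩ := ih
    refine ⟨p, fun 𝔐 _ ρ g hρ hg => ?_⟩
    obtain ⟨y, hy, h⟩ := hp 𝔐 ρ g hρ hg
    exact ⟨y, hy, _, hρ i, realizes_inst.1 h⟩
  | exE _ _ ih₁ ih₂ =>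
    obtain ⟨p, hp⟩ := ih₁
    obtain ⟨q, hq⟩ := ih₂
    refine ⟨(PTerm.lam (.app (.num q) (.pair (.app (.num p) (.var 0)) (.var 0)))).val,
      fun 𝔐 _ ρ g hρ hg => exists_app_val ?_⟩
    obtain ⟨x, hx, X, hX, hx'⟩ := hp 𝔐 ρ g hρ hg
    obtain ⟨y, hy, hy'⟩ := hq 𝔐 _ _ (isSet_extend hρ hX) (.cons hx' hg.weaken)
    simp only [wp, List.getD_cons_zero, List.getD_cons_succ, fst_pair, snd_pair]
    exact ⟨x, hx, y, hy, realizes_weaken.1 hy'⟩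
  | ballI _ ih =>
    obtain ⟨p, hp⟩ := ih
    refine ⟨(PTerm.lam (.lam (.app (.num p)
      (.pair (.pair (.var 0) (.num reflIdx)) (.var 1))))).val,
      fun 𝔐 _ ρ g hρ hg => exists_app_val ?_⟩
    simp only [wp, List.getD_cons_zero, List.getD_cons_succ, fst_pair, snd_pair]
    refine fun a ha => exists_app_clo ?_
    simp only [wp, List.getD_cons_zero, List.getD_cons_succ, fst_pair, snd_pair]
    refine hp 𝔐 _ _ (isSet_extend hρ ((hρ _).down ha)) (.cons ?_ hg.weaken)
    simpa [realizes_mem] using realizesMem_down (hρ _) ha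
  | @ballE n Γ i φ j _ _ ih₁ ih₂ =>
    obtain ⟨p, hp⟩ := ih₁
    obtain ⟨q, hq⟩ := ih₂
    obtain ⟨r, hr⟩ := exists_transport_last.{u} φ
    refine ⟨(PTerm.lam (.letin (.app (.num q) (.var 0)) (.app (.num r)
      (.pair (.pair (.snd (.snd (.var 0))) (.fst (.snd (.var 0))))
        (.app (.app (.num p) (.var 1)) (.fst (.var 0))))))).val,
      fun 𝔐 _ ρ g hρ hg => exists_app_val (wp_letin ?_)⟩
    obtain ⟨x, hx, hx'⟩ := hp 𝔐 ρ g hρ hg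
    obtain ⟨y, hy, hy'⟩ := hq 𝔐 ρ g hρ hg
    rw [realizes_mem] at hy'
    obtain ⟨z, hz, hz'⟩ := hx' _ hy'.1
    have hd := (hρ i).down hy'.1
    -- A realizer of membership only says that the element equals some immediate subtree. The
    -- bounded quantifier yields the conclusion for that subtree, and it is carried over along the
    -- equality.
    obtain ⟨w, hw, hw'⟩ := hr 𝔐 ρ _ _ _ _ hρ hd (hρ j) (realizesEq_symm (hρ j).1 hd.1 hy'.2) hz'
    simp only [wp, List.getD_cons_zero, List.getD_cons_succ, fst_pair, snd_pair]
    exact ⟨y, hy, x, hx, z, hz, w, hw, realizes_inst.2 hw'⟩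
  | @bexI n Γ i φ j _ _ ih₁ ih₂ =>
    obtain ⟨p, hp⟩ := ih₁
    obtain ⟨q, hq⟩ := ih₂
    obtain ⟨r, hr⟩ := exists_transport_last.{u} φ
    refine ⟨(PTerm.lam (.letin (.app (.num p) (.var 0)) (.pair (.fst (.var 0)) (.app (.num r)
      (.pair (.snd (.var 0)) (.app (.num q) (.var 1))))))).val,
      fun 𝔐 _ ρ g hρ hg => exists_app_val (wp_letin ?_)⟩
    obtain ⟨x, hx, hx'⟩ := hp 𝔐 ρ g hρ hg
    obtain ⟨y, hy, hy'⟩ := hq 𝔐 ρ g hρ hg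
    rw [realizes_mem] at hx'
    obtain ⟨w, hw, hw'⟩ := hr 𝔐 ρ _ _ _ _ hρ (hρ j) ((hρ i).down hx'.1) hx'.2 (realizes_inst.1 hy')
    simp only [wp, List.getD_cons_zero, List.getD_cons_succ, fst_pair, snd_pair]
    refine ⟨x, hx, y, hy, w, hw, ?_⟩
    simpa only [realizes_bex, fst_pair, snd_pair] using And.intro hx'.1 hw'
  | bexE _ _ ih₁ ih₂ =>
    obtain ⟨p, hp⟩ := ih₁
    obtain ⟨q, hq⟩ := ih₂
    refine ⟨(PTerm.lam (.letin (.app (.num p) (.var 0)) (.app (.num q) (.pair (.snd (.var 0))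
      (.pair (.pair (.fst (.var 0)) (.num reflIdx)) (.var 1)))))).val,
      fun 𝔐 _ ρ g hρ hg => exists_app_val (wp_letin ?_)⟩
    obtain ⟨x, hx, hx'⟩ := hp 𝔐 ρ g hρ hg
    rw [realizes_bex] at hx'
    obtain ⟨y, hy, hy'⟩ := hq 𝔐 _ _ (isSet_extend hρ ((hρ _).down hx'.1))
      (.cons hx'.2 (.cons (e := 𝔐.pair (fst x) (𝔐.num reflIdx))
        (by simpa [realizes_mem] using realizesMem_down (hρ _) hx'.1) hg.weaken))
    simp only [wp, List.getD_cons_zero, List.getD_cons_succ, fst_pair, snd_pair]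
    exact ⟨x, hx, y, hy, realizes_weaken.1 hy'⟩
  | eqRefl i =>
    refine ⟨(PTerm.lam (.num reflIdx)).val, fun 𝔐 hM ρ g hρ _ => exists_app_val ?_⟩
    simp only [wp, List.getD_cons_zero, List.getD_cons_succ, fst_pair, snd_pair]
    exact realizesEq_refl (hρ i)
  | @eqSubst n Γ φ i j _ _ ih₁ ih₂ =>
    obtain ⟨p, hp⟩ := ih₁
    obtain ⟨q, hq⟩ := ih₂
    obtain ⟨r, hr⟩ := exists_transport_last.{u} φ
    refine ⟨(PTerm.lam (.app (.num r)
      (.pair (.app (.num p) (.var 0)) (.app (.num q) (.var 0))))).val,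
      fun 𝔐 _ ρ g hρ hg => exists_app_val ?_⟩
    obtain ⟨x, hx, hx'⟩ := hp 𝔐 ρ g hρ hg
    obtain ⟨y, hy, hy'⟩ := hq 𝔐 ρ g hρ hg
    obtain ⟨w, hw, hw'⟩ := hr 𝔐 ρ _ _ _ _ hρ (hρ i) (hρ j) hx' (realizes_inst.1 hy')
    simp only [wp, List.getD_cons_zero, List.getD_cons_succ, fst_pair, snd_pair]
    exact ⟨x, hx, y, hy, w, hw, realizes_inst.2 hw'⟩

theorem realized_exists_of_derives {Ax : Form 0 → Prop} (hAx : ∀ φ, Ax φ → Realized.{u} φ)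
    {φ : Form 0} (h : Derives Ax [] φ) (𝔐 : Henkin.{u}) [Fact 𝔐.IsModelZ2] :
    ∃ e, 𝔐.Realizes φ Fin.elim0 e := by
  obtain ⟨s, hs⟩ := exists_realizer_of_derives hAx h
  obtain ⟨y, -, hy⟩ := hs 𝔐 Fin.elim0 𝔐.zero (fun i => i.elim0) trivial
  exact ⟨y, hy⟩

/-- A sentence is translated to the statement that it has a realizer. -/
theorem realizabilityInterprets {Ax : Form 0 → Prop} (hAx : ∀ φ, Ax φ → Realized.{u} φ) :
    RealizabilityInterprets.{u} Ax := by
  have hK : ∀ 𝔐 : {𝔐 : Henkin.{u} // 𝔐.IsModelZ2}, Fact 𝔐.1.IsModelZ2 := fun 𝔐 => ⟨𝔐.2⟩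
  have key : ∀ φ : Form 0, ∃ θ : SOFormula 0 0, ∀ 𝔐 : Henkin.{u}, 𝔐.IsModelZ2 →
      (𝔐.Sat θ Fin.elim0 Fin.elim0 ↔ ∃ e, 𝔐.Realizes φ Fin.elim0 e) := fun φ => by
    -- The family consists of all models at once and parameters are forbidden, so the definition
    -- obtained is one sentence that works in every model.
    have h : Dfn (fun 𝔐 : {𝔐 : Henkin.{u} // 𝔐.IsModelZ2} => 𝔐.1) False 0 0
      (fun 𝔐 ρ σ => ∃ e, 𝔐.1.Realizes φ σ e) := inferInstance
    obtain ⟨k, l, θ, a, A, hkl, -, h⟩ := h.out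
    obtain ⟨rfl, rfl⟩ := hkl.resolve_left id
    refine ⟨θ, fun 𝔐 hM => ?_⟩
    rw [← h ⟨𝔐, hM⟩ Fin.elim0 Fin.elim0 fun j => j.elim0]
    exact iff_of_eq (congrArg₂ _ (funext fun j => j.elim0) (funext fun j => j.elim0))
  choose tr htr using key
  refine ⟨tr, htr, fun φ h 𝔐 hM => ?_, fun 𝔐 hM => ?_⟩
  · have : Fact 𝔐.IsModelZ2 := ⟨hM⟩
    exact (htr φ 𝔐 hM).2 (realized_exists_of_derives hAx h 𝔐)
  · intro h
    have : Fact 𝔐.IsModelZ2 := ⟨hM⟩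
    obtain ⟨e, he⟩ := (htr .bot 𝔐 hM).1 h
    exact realizes_bot he

end Henkin

/-! ## The axioms of `CZF` with full Separation -/

section Extend

variable {α : Type*} {n : ℕ}

theorem extend_v_of_lt (ρ : Fin n → α) (x : α) (i : ℕ) (h : i < n + 1) (h' : i < n) :
    extend ρ x (Form.v i h) = ρ (Form.v i h') :=
  extend_castSucc ρ x ⟨i, h'⟩

theorem extend_v_of_eq (ρ : Fin n → α) (x : α) (i : ℕ) (h : i < n + 1) (h' : i = n) :
    extend ρ x (Form.v i h) = x := by
  subst h'; exact extend_last ρ x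

theorem extend_castLE (ρ : Fin n → α) (x : α) {k : ℕ} (h : k ≤ n + 1) (h' : k ≤ n) (i : Fin k) :
    extend ρ x (i.castLE h) = ρ (i.castLE h') :=
  extend_castSucc ρ x (i.castLE h')

end Extend

namespace Henkin

section Family

variable {I : Type*} {K : I → Henkin.{u}} {par : Prop} {n m : ℕ}
  {f : ∀ i, (Fin n → (K i).N) → (Fin m → Set (K i).N) → (K i).N}
  {X Y : ∀ i, (Fin n → (K i).N) → (Fin m → Set (K i).N) → Set (K i).N}
  [hK : ∀ i, Fact (K i).IsModelZ2]

instance DfnF.fst [DfnF K par n m f] : DfnF K par n m (fun i ρ σ => Henkin.fst (f i ρ σ)) := by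
  have h : Dfn K par 2 0 (fun i ρ _ => ∃ b, ρ 1 = (K i).pair (ρ 0) b) := inferInstance
  exact ⟨Dfn.subst₂ (P := fun i x y => x = Henkin.fst y) (h.congr fun i ρ σ _ =>
    ⟨fun ⟨b, hb⟩ => by rw [hb, fst_pair], fun h => ⟨Henkin.snd _, by rw [h, pair_fst_snd]⟩⟩)⟩

instance DfnF.snd [DfnF K par n m f] : DfnF K par n m (fun i ρ σ => Henkin.snd (f i ρ σ)) := by
  have h : Dfn K par 2 0 (fun i ρ _ => ∃ a, ρ 1 = (K i).pair a (ρ 0)) := inferInstance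
  exact ⟨Dfn.subst₂ (P := fun i x y => x = Henkin.snd y) (h.congr fun i ρ σ _ =>
    ⟨fun ⟨b, hb⟩ => by rw [hb, snd_pair], fun h => ⟨Henkin.fst _, by rw [h, pair_fst_snd]⟩⟩)⟩

end Family

section Model

variable {𝔐 : Henkin.{u}} [hM : Fact 𝔐.IsModelZ2]

/-- Since unbounded universal quantifiers are uniform, closing a formula leaves its realizers
unchanged. -/
theorem realizes_closure {n : ℕ} {φ : Form n} {e : 𝔐.N} :
    𝔐.Realizes φ.closure Fin.elim0 e ↔
      ∀ ρ : Fin n → Set 𝔐.N, (∀ i, 𝔐.IsSet (ρ i)) → 𝔐.Realizes φ ρ e := by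
  induction n with
  | zero =>
    exact ⟨fun h ρ _ => by rwa [Subsingleton.elim ρ Fin.elim0], fun h => h _ fun i => i.elim0⟩
  | succ n ih =>
    rw [Form.closure, ih]
    refine ⟨fun h ρ hρ => ?_, fun h ρ hρ X hX => h _ (isSet_extend hρ hX)⟩
    rw [← extend_init ρ]
    exact h _ (fun i => hρ _) _ (hρ _)

section At

variable {k n : ℕ} {ρ : Fin n → Set 𝔐.N} {e : 𝔐.N} (h : k ≤ n)

theorem realizes_at₁ {φ : Form (k + 1)} {a : Fin n} : 𝔐.Realizes (φ.at' ![a] h) ρ e ↔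
    𝔐.Realizes φ (extend (fun i => ρ (i.castLE h)) (ρ a)) e := by
  have : (![a] : Fin 1 → Fin n) = extend Fin.elim0 a := by
    funext i; fin_cases i; rfl
  rw [Form.at', realizes_rename, this, append_extend, comp_extend, Fin.append_elim0]
  rfl

theorem realizes_at₂ {φ : Form (k + 2)} {a b : Fin n} : 𝔐.Realizes (φ.at' ![a, b] h) ρ e ↔
    𝔐.Realizes φ (extend (extend (fun i => ρ (i.castLE h)) (ρ a)) (ρ b)) e := by
  have : (![a, b] : Fin 2 → Fin n) = extend (extend Fin.elim0 a) b := by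
    funext i; fin_cases i <;> rfl
  rw [Form.at', realizes_rename, this, append_extend, append_extend, comp_extend, comp_extend,
    Fin.append_elim0]
  rfl

theorem realizes_at₃ {φ : Form (k + 3)} {a b c : Fin n} : 𝔐.Realizes (φ.at' ![a, b, c] h) ρ e ↔
    𝔐.Realizes φ (extend (extend (extend (fun i => ρ (i.castLE h)) (ρ a)) (ρ b)) (ρ c)) e := by
  have : (![a, b, c] : Fin 3 → Fin n) = extend (extend (extend Fin.elim0 a) b) c := by
    funext i; fin_cases i <;> rfl
  rw [Form.at', realizes_rename, this, append_extend, append_extend, append_extend, comp_extend,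
    comp_extend, comp_extend, Fin.append_elim0]
  rfl

end At

/-! ### Trees with prescribed immediate subtrees -/

/-- The tree whose immediate subtrees are `F a` for `a` with `I a`. -/
def mkTree (I : 𝔐.N → Prop) (F : 𝔐.N → Set 𝔐.N) : Set 𝔐.N :=
  {t | t = 𝔐.nil ∨ ∃ a s, t = 𝔐.cons a s ∧ I a ∧ s ∈ F a}

section MkTree

variable {I : 𝔐.N → Prop} {F : 𝔐.N → Set 𝔐.N}

theorem down_mkTree {a : 𝔐.N} (ha : I a) : 𝔐.down (mkTree I F) a = F a := by
  ext s; simp [down, mkTree, cons_ne_nil, cons_inj, ha]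

theorem mem_immd_mkTree (h : ∀ a, I a → 𝔐.IsSet (F a)) {a : 𝔐.N} :
    a ∈ 𝔐.immd (mkTree I F) ↔ I a := by
  simp only [immd, single, mkTree, Set.mem_ofPred_eq, cons_ne_nil, cons_inj, false_or]
  exact ⟨fun ⟨b, s, h, hI, _⟩ => h.1 ▸ hI, fun ha => ⟨a, _, ⟨rfl, rfl⟩, ha, (h a ha).2.1.1⟩⟩

theorem isSet_mkTree (h : ∀ a, I a → 𝔐.IsSet (F a))
    (hI : 𝔐.Def₂ (fun a s => I a ∧ s ∈ F a) := by infer_instance) : 𝔐.IsSet (mkTree I F) := by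
  -- Only the combined relation "`a` is an index and `s` lies in `F a`" is known to be definable, so
  -- it is replaced by a set before membership of the tree in the structure is checked.
  obtain ⟨Z, hZ, hZI⟩ := exists_rel₂ _ hI
  have : Fact (Z ∈ 𝔐.sets) := ⟨hZ⟩
  have hmem := setOf_mem_sets (fun t => t = 𝔐.nil ∨ ∃ a s, t = 𝔐.cons a s ∧ 𝔐.rel₂ Z a s)
  simp only [hZI] at hmem
  refine isSet_of_down hmem (Or.inl rfl) (fun a s hs => ?_) fun a ha => ?_
  · rcases hs with hs | ⟨b, t, hs, hI, _⟩
    · exact absurd hs (cons_ne_nil _ _)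
    · rw [cons_inj] at hs
      exact (mem_immd_mkTree h).2 (hs.1 ▸ hI)
  · rw [mem_immd_mkTree h] at ha
    rw [down_mkTree ha]
    exact h a ha

end MkTree

end Model

/-- The value of a closed term is a numeral. -/
theorem realized_of {φ : Form 0} (t : PTerm) (h : ∀ (𝔐 : Henkin.{u}) [Fact 𝔐.IsModelZ2],
    𝔐.Realizes φ Fin.elim0 (𝔐.num t.val)) : Realized.{u} φ :=
  ⟨t.val, fun 𝔐 hM => have : Fact 𝔐.IsModelZ2 := ⟨hM⟩; h 𝔐⟩

/-! ### Realizers of the single axioms of `CZF` with full Separation. -/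

theorem realized_extensionality : Realized.{u} Form.extensionality := by
  refine realized_of (.lam (.pair
    (.lam (.app (.fst (.var 1)) (.pair (.var 0) (.num reflIdx))))
    (.lam (.app (.snd (.var 1)) (.pair (.var 0) (.num reflIdx)))))) fun 𝔐 _ X hX Y hY f hf => ?_
  simp (disch := omega) [Form.iff, realizes_all, realizes_and, realizes_imp, realizes_mem, extend_v_of_lt, extend_v_of_eq] at hf
  refine exists_app_val ?_
  simp only [wp, List.getD_cons_zero, List.getD_cons_succ, fst_pair, snd_pair]
  simp (disch := omega) [realizes_eq, extend_v_of_lt, extend_v_of_eq, realizesEq_iff hX.1 hY.1]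
  refine ⟨fun a ha => exists_app_clo ?_, fun a ha => exists_app_clo ?_⟩
  · simp only [wp, List.getD_cons_zero, List.getD_cons_succ, fst_pair, snd_pair]
    exact (hf _ (hX.down ha)).1 _ (realizesMem_down hX ha)
  · simp only [wp, List.getD_cons_zero, List.getD_cons_succ, fst_pair, snd_pair]
    exact (hf _ (hY.down ha)).2 _ (realizesMem_down hY ha)

theorem mem_immd_join {𝔐 : Henkin.{u}} [Fact 𝔐.IsModelZ2] {A B : Set 𝔐.N} (hA : 𝔐.nil ∈ A)
    (hB : 𝔐.nil ∈ B) {a : 𝔐.N} : a ∈ 𝔐.immd (𝔐.join A B) ↔ a = 𝔐.num 0 ∨ a = 𝔐.num 1 := by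
  simp only [immd, single, join, Set.mem_ofPred_eq, cons_ne_nil, cons_inj, false_or]
  exact or_congr ⟨fun ⟨_, _, h⟩ => h.1, fun h => ⟨_, hA, h, rfl⟩⟩
    ⟨fun ⟨_, _, h⟩ => h.1, fun h => ⟨_, hB, h, rfl⟩⟩

theorem isSet_join {𝔐 : Henkin.{u}} [Fact 𝔐.IsModelZ2] {A B : Set 𝔐.N} (hA : 𝔐.IsSet A)
    (hB : 𝔐.IsSet B) : 𝔐.IsSet (𝔐.join A B) := by
  have himm := fun {a} => mem_immd_join hA.2.1.1 hB.2.1.1 (a := a)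
  refine isSet_of_down (join_mem_sets hA.1 hB.1) (Or.inl rfl) (fun a s h => himm.2 ?_)
    fun a ha => ?_
  · rcases h with h | ⟨_, _, h⟩ | ⟨_, _, h⟩
    · exact absurd h (cons_ne_nil _ _)
    · exact Or.inl (cons_inj.1 h).1
    · exact Or.inr (cons_inj.1 h).1
  · rcases himm.1 ha with rfl | rfl
    · rwa [down_join_zero]
    · rwa [down_join_one]

/-- The join has indices 0 and 1, which are exactly the tags of a realized disjunction; the identity
realizes both directions. -/
theorem realized_pairing : Realized.{u} Form.pairing := by
  refine realized_of (.pair (.lam (.var 0)) (.lam (.var 0))) fun 𝔐 _ A hA B hB => ?_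
  refine ⟨𝔐.join A B, isSet_join hA hB, fun X hX => ?_⟩
  have himm := fun {a} => mem_immd_join hA.2.1.1 hB.2.1.1 (a := a)
  simp (disch := omega) [Form.iff, realizes_and, realizes_or, realizes_imp, realizes_mem, realizes_eq, extend_v_of_lt, extend_v_of_eq,
    num_val_pair, num_val_lam]
  refine ⟨fun f hf => exists_app_clo ?_, fun f hf => exists_app_clo ?_⟩
  · simp only [wp, List.getD_cons_zero, List.getD_cons_succ, fst_pair, snd_pair]
    rcases himm.1 hf.1 with h | h
    · exact Or.inl ⟨h, by simpa [h] using hf.2⟩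
    · exact Or.inr ⟨h, by simpa [h] using hf.2⟩
  · simp only [wp, List.getD_cons_zero, List.getD_cons_succ, fst_pair, snd_pair]
    rcases hf with ⟨h, hf⟩ | ⟨h, hf⟩
    · exact ⟨himm.2 (Or.inl h), by simpa [h] using hf⟩
    · exact ⟨himm.2 (Or.inr h), by simpa [h] using hf⟩

/-- The union is indexed by pairs: an index of a member, followed by an index of a member of that
member. Both realizers only regroup pairs. -/
theorem realized_union : Realized.{u} Form.union := by
  refine realized_of (.pair
    (.lam (.pair (.fst (.fst (.var 0))) (.pair (.snd (.fst (.var 0))) (.snd (.var 0)))))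
    (.lam (.pair (.pair (.fst (.var 0)) (.fst (.snd (.var 0)))) (.snd (.snd (.var 0))))))
    fun 𝔐 _ A hA => ?_
  have : Fact (A ∈ 𝔐.sets) := ⟨hA.1⟩
  have hF : ∀ p, fst p ∈ 𝔐.immd A ∧ snd p ∈ 𝔐.immd (𝔐.down A (fst p)) →
    𝔐.IsSet (𝔐.down (𝔐.down A (fst p)) (snd p)) := fun p hp => (hA.down hp.1).down hp.2
  refine ⟨_, isSet_mkTree hF, fun X hX => ?_⟩
  simp (disch := omega) [Form.iff, realizes_and, realizes_imp, realizes_mem, realizes_bex, extend_v_of_lt, extend_v_of_eq,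
    num_val_pair, num_val_lam]
  refine ⟨fun f hf => exists_app_clo ?_, fun f h₁ ⟨h₂, he⟩ => exists_app_clo ?_⟩
  · simp only [wp, List.getD_cons_zero, List.getD_cons_succ, fst_pair, snd_pair]
    rw [RealizesMem, mem_immd_mkTree hF] at hf
    obtain ⟨hf, he⟩ := hf
    rw [down_mkTree hf] at he
    simp only [RealizesMem, fst_pair, snd_pair]
    exact ⟨hf.1, hf.2, he⟩
  · simp only [wp, List.getD_cons_zero, List.getD_cons_succ, fst_pair, snd_pair]
    have hp : fst (𝔐.pair (fst f) (fst (snd f))) ∈ 𝔐.immd A ∧ snd (𝔐.pair (fst f) (fst (snd f))) ∈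
      𝔐.immd (𝔐.down A (fst (𝔐.pair (fst f) (fst (snd f))))) := by
      simpa only [fst_pair, snd_pair] using And.intro h₁ h₂
    rw [RealizesMem, fst_pair, snd_pair, mem_immd_mkTree hF, down_mkTree hp]
    refine ⟨hp, ?_⟩
    simpa only [fst_pair, snd_pair] using he

/-- From a realizer `e` of progressivity, form the program `c` that on any index returns the value
of `e` at `c`. Induction on trees shows that this value realizes `φ`; it is the same for all trees.
-/
theorem realized_setInduction {k : ℕ} (φ : Form (k + 1)) : Realized.{u} φ.setInduction := by
  refine realized_of (.lam (.app (.var 0) (.fix (.app (.var 2) (.var 1))))) fun 𝔐 _ =>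
    realizes_closure.2 fun ρ hρ e he => exists_app_val ?_
  have : Fact (∀ (_ : Unit) j, ρ j ∈ 𝔐.sets) := ⟨fun _ j => (hρ j).1⟩
  set c : 𝔐.N := fixv (.app (.var 2) (.var 1)) [e] with hc
  have key : ∀ X, 𝔐.IsSet X → ∃ y, 𝔐.App e c y ∧ 𝔐.Realizes φ (extend ρ X) y := fun X hX => by
    refine hX.induct (fun X => ∃ y, 𝔐.App e c y ∧ 𝔐.Realizes φ (extend ρ X) y) inferInstance
      fun X hX ih => ?_
    have := he X hX
    simp (disch := omega) [realizes_imp, realizes_ball, realizes_at₁, extend_v_of_lt, extend_v_of_eq, extend_castLE] at this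
    refine this c fun a ha => exists_app_fixv ?_
    simp only [wp, List.getD_cons_zero, List.getD_cons_succ, fst_pair, snd_pair]
    exact ih a ha
  simp only [wp, List.getD_cons_zero, List.getD_cons_succ, fst_pair, snd_pair]
  obtain ⟨y, hy, -⟩ := key _ isSet_emptyTree
  refine ⟨y, hy, fun X hX => ?_⟩
  obtain ⟨z, hz, hz'⟩ := key X hX
  rw [hy.det hz]
  simpa (disch := omega) [realizes_at₁, extend_v_of_lt, extend_v_of_eq, extend_castLE] using hz'

/-- The subset is indexed by pairs of an index of `A` and a realizer of `φ` for that subtree.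
Transport is needed because the element in question is only equal to the indexed subtree. -/
theorem realized_separation {k : ℕ} (φ : Form (k + 1)) : Realized.{u} φ.separation := by
  obtain ⟨s, hs⟩ := exists_transport_last.{u} φ
  refine realized_of (.pair
    (.lam (.pair (.pair (.fst (.fst (.var 0))) (.snd (.var 0)))
      (.app (.num s) (.pair (.pair (.snd (.snd (.var 0))) (.fst (.snd (.var 0))))
        (.snd (.fst (.var 0)))))))
    (.lam (.pair (.pair (.fst (.fst (.var 0))) (.app (.num s)
      (.pair (.snd (.fst (.var 0))) (.snd (.var 0))))) (.snd (.fst (.var 0))))))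
    fun 𝔐 _ => realizes_closure.2 fun ρ hρ A hA => ?_
  have : Fact (A ∈ 𝔐.sets) := ⟨hA.1⟩
  have : Fact (∀ (_ : Unit) j, ρ j ∈ 𝔐.sets) := ⟨fun _ j => (hρ j).1⟩
  have hF : ∀ p, fst p ∈ 𝔐.immd A ∧ 𝔐.Realizes φ (extend ρ (𝔐.down A (fst p))) (snd p) →
    𝔐.IsSet (𝔐.down A (fst p)) := fun p hp => hA.down hp.1
  refine ⟨_, isSet_mkTree hF, fun X hX => ?_⟩
  simp (disch := omega) [Form.iff, realizes_and, realizes_imp, realizes_mem, realizes_at₁, extend_v_of_lt, extend_v_of_eq, extend_castLE,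
    num_val_pair, num_val_lam]
  refine ⟨fun f hf => exists_app_clo ?_, fun f ⟨h₁, h₂⟩ he => exists_app_clo ?_⟩
  · simp only [wp, List.getD_cons_zero, List.getD_cons_succ, fst_pair, snd_pair]
    rw [RealizesMem, mem_immd_mkTree hF] at hf
    obtain ⟨hf, he⟩ := hf
    rw [down_mkTree hf] at he
    obtain ⟨y, hy, hy'⟩ := hs 𝔐 ρ _ _ _ _ hρ (hA.down hf.1) hX
      (realizesEq_symm hX.1 (hA.down hf.1).1 he) hf.2
    refine ⟨y, hy, ⟨?_, ?_⟩, hy'⟩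
    · simpa only [fst_pair] using hf.1
    · simpa only [fst_pair, snd_pair] using he
  · obtain ⟨y, hy, hy'⟩ := hs 𝔐 ρ _ _ _ _ hρ hX (hA.down h₁) h₂ he
    simp only [wp, List.getD_cons_zero, List.getD_cons_succ, fst_pair, snd_pair]
    refine ⟨y, hy, ?_⟩
    have hp : fst (𝔐.pair (fst (fst f)) y) ∈ 𝔐.immd A ∧
        𝔐.Realizes φ (extend ρ (𝔐.down A (fst (𝔐.pair (fst (fst f)) y))))
          (snd (𝔐.pair (fst (fst f)) y)) := by
      simpa only [fst_pair, snd_pair] using And.intro h₁ hy'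
    rw [RealizesMem, fst_pair, snd_pair, mem_immd_mkTree hF, down_mkTree hp]
    refine ⟨hp, ?_⟩
    simpa only [fst_pair, snd_pair] using h₂

/-- A realizer of the premise gives for each index a number that works for some witness tree, but no
witness. The choice scheme collects witnesses as the rows of one set, and these become the immediate
subtrees, under the same indices as in `A`. -/
theorem realized_strongCollection {k : ℕ} (φ : Form (k + 2)) :
    Realized.{u} φ.strongCollection := by
  refine realized_of (.lam (.pair (.lam (.pair (.var 0) (.app (.var 1) (.var 0))))
    (.lam (.pair (.var 0) (.app (.var 1) (.var 0))))))
    fun 𝔐 _ => realizes_closure.2 fun ρ hρ A hA f hf => exists_app_val ?_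
  have : Fact (A ∈ 𝔐.sets) := ⟨hA.1⟩
  have : Fact (∀ (_ : Unit) j, ρ j ∈ 𝔐.sets) := ⟨fun _ j => (hρ j).1⟩
  simp (disch := omega) [realizes_ball, realizes_ex, realizes_at₂, extend_v_of_lt, extend_v_of_eq, extend_castLE] at hf
  -- Numbers that are not indices impose no condition; `A` serves as their default witness.
  obtain ⟨Z, hZ, h⟩ := choice_def (fun a Y => a ∈ 𝔐.immd A → ∃ d, 𝔐.App f a d ∧ 𝔐.IsSet Y ∧
    𝔐.Realizes φ (extend (extend ρ (𝔐.down A a)) Y) d) inferInstance fun a => by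
      by_cases ha : a ∈ 𝔐.immd A
      · obtain ⟨d, hd, Y, hY, h⟩ := hf a ha
        exact ⟨Y, hY.1, fun _ => ⟨d, hd, hY, h⟩⟩
      · exact ⟨_, hA.1, fun h => absurd h ha⟩
  have : Fact (Z ∈ 𝔐.sets) := ⟨hZ⟩
  have hF : ∀ a, a ∈ 𝔐.immd A → 𝔐.IsSet (𝔐.row Z a) := fun a ha => by
    obtain ⟨_, _, h, _⟩ := h a ha
    exact h
  simp only [wp, List.getD_cons_zero, List.getD_cons_succ, fst_pair, snd_pair]
  refine ⟨_, isSet_mkTree hF, ?_⟩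
  simp (disch := omega) [realizes_and, realizes_ball, realizes_bex, realizes_at₂, extend_v_of_lt, extend_v_of_eq, extend_castLE]
  refine ⟨fun a ha => exists_app_clo ?_, fun a ha => exists_app_clo ?_⟩
  · simp only [wp, List.getD_cons_zero, List.getD_cons_succ, fst_pair, snd_pair]
    obtain ⟨d, hd, -, hd'⟩ := h a ha
    rw [mem_immd_mkTree hF, down_mkTree ha]
    exact ⟨d, hd, ha, hd'⟩
  · simp only [wp, List.getD_cons_zero, List.getD_cons_succ, fst_pair, snd_pair]
    rw [mem_immd_mkTree hF] at ha
    obtain ⟨d, hd, -, hd'⟩ := h a ha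
    rw [down_mkTree ha]
    exact ⟨d, hd, ha, hd'⟩

/-- The indices of `c` are the programs that map each index of `A` to a pair whose first part is an
index of `B`. Every realizer of the premise is such a program and so indexes its own subimage,
whatever `U` is. -/
theorem realized_subsetCollection {k : ℕ} (φ : Form (k + 3)) :
    Realized.{u} φ.subsetCollection := by
  refine realized_of (.lam (.pair (.var 0)
    (.pair (.lam (.pair (.var 0) (.snd (.app (.var 1) (.var 0)))))
      (.lam (.pair (.var 0) (.snd (.app (.var 1) (.var 0))))))))
    fun 𝔐 _ => realizes_closure.2 fun ρ hρ A hA B hB => ?_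
  have : Fact (A ∈ 𝔐.sets) := ⟨hA.1⟩
  have : Fact (B ∈ 𝔐.sets) := ⟨hB.1⟩
  -- Application is partial, so the subtree is described through the graph of application;
  -- determinism (`hFeq`) identifies it once the value is known.
  let F : 𝔐.N → 𝔐.N → Set 𝔐.N := fun e a => {s | ∃ y, 𝔐.App e a y ∧ s ∈ 𝔐.down B (fst y)}
  have hFeq : ∀ {e a y}, 𝔐.App e a y → F e a = 𝔐.down B (fst y) := fun {e a y} h => by
    ext s
    exact ⟨fun ⟨z, hz, hs⟩ => by rwa [h.det hz], fun hs => ⟨y, h, hs⟩⟩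
  have hF : ∀ e, (∀ a, a ∈ 𝔐.immd A → ∃ y, 𝔐.App e a y ∧ fst y ∈ 𝔐.immd B) →
      ∀ a, a ∈ 𝔐.immd A → 𝔐.IsSet (F e a) := fun e he a ha => by
    obtain ⟨y, hy, hy'⟩ := he a ha
    rw [hFeq hy]
    exact hB.down hy'
  have hG : ∀ e, (∀ a, a ∈ 𝔐.immd A → ∃ y, 𝔐.App e a y ∧ fst y ∈ 𝔐.immd B) →
      𝔐.IsSet (mkTree (fun a => a ∈ 𝔐.immd A) (F e)) := fun e he =>
    isSet_mkTree (hF e he) (by simp only [F]; infer_instance)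
  refine ⟨_, isSet_mkTree hG (by simp only [mkTree, F]; infer_instance), fun U hU f hf =>
    exists_app_val ?_⟩
  simp (disch := omega) [realizes_ball, realizes_bex, realizes_at₃, extend_v_of_lt, extend_v_of_eq, extend_castLE] at hf
  have hf' : ∀ a, a ∈ 𝔐.immd A → ∃ y, 𝔐.App f a y ∧ fst y ∈ 𝔐.immd B := fun a ha => by
    obtain ⟨y, hy, hy', -⟩ := hf a ha
    exact ⟨y, hy, hy'⟩
  simp only [wp, List.getD_cons_zero, List.getD_cons_succ, fst_pair, snd_pair]
  simp (disch := omega) [realizes_and, realizes_ball, realizes_bex, realizes_at₃, extend_v_of_lt, extend_v_of_eq, extend_castLE]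
  rw [mem_immd_mkTree hG, down_mkTree hf']
  refine ⟨hf', fun a ha => exists_app_clo ?_, fun a ha => exists_app_clo ?_⟩
  · simp only [wp, List.getD_cons_zero, List.getD_cons_succ, fst_pair, snd_pair]
    obtain ⟨d, hd, hd', hd''⟩ := hf a ha
    rw [mem_immd_mkTree (hF f hf'), down_mkTree ha, hFeq hd]
    exact ⟨d, hd, ha, hd''⟩
  · simp only [wp, List.getD_cons_zero, List.getD_cons_succ, fst_pair, snd_pair]
    rw [mem_immd_mkTree (hF f hf')] at ha
    obtain ⟨d, hd, hd', hd''⟩ := hf a ha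
    rw [down_mkTree ha, hFeq hd]
    exact ⟨d, hd, ha, hd''⟩

end Henkin

namespace Henkin

/-! ## Types -/

section Codes

variable {I : Type*} {K : I → Henkin.{u}} {par : Prop} {n m : ℕ}
  {f g : ∀ i, (Fin n → (K i).N) → (Fin m → Set (K i).N) → (K i).N}

instance DfnF.natCode : DfnF K par n m (fun i _ _ => (K i).natCode) := by
  unfold Henkin.natCode; infer_instance

instance DfnF.finCode [DfnF K par n m f] : DfnF K par n m (fun i ρ σ => (K i).finCode (f i ρ σ)) := by
  unfold Henkin.finCode; infer_instance

instance DfnF.sumCode [DfnF K par n m f] [DfnF K par n m g] :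
    DfnF K par n m (fun i ρ σ => (K i).sumCode (f i ρ σ) (g i ρ σ)) := by
  unfold Henkin.sumCode; infer_instance

instance DfnF.piCode [DfnF K par n m f] [DfnF K par n m g] :
    DfnF K par n m (fun i ρ σ => (K i).piCode (f i ρ σ) (g i ρ σ)) := by
  unfold Henkin.piCode; infer_instance

instance DfnF.sigmaCode [DfnF K par n m f] [DfnF K par n m g] :
    DfnF K par n m (fun i ρ σ => (K i).sigmaCode (f i ρ σ) (g i ρ σ)) := by
  unfold Henkin.sigmaCode; infer_instance

instance DfnF.supCode [DfnF K par n m f] [DfnF K par n m g] :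
    DfnF K par n m (fun i ρ σ => (K i).supCode (f i ρ σ) (g i ρ σ)) := by
  unfold Henkin.supCode; infer_instance

end Codes

section TypeStep

variable (𝔐 : Henkin.{u})

/-- `A` is a type code whose components are in `D`. -/
def TypeComps (D : 𝔐.N → Prop) (E : 𝔐.N → 𝔐.N → Prop) (A : 𝔐.N) : Prop :=
  A = 𝔐.natCode ∨ (∃ n, A = 𝔐.finCode n) ∨ (∃ B C, A = 𝔐.sumCode B C ∧ D B ∧ D C) ∨
    ∃ B F, (A = 𝔐.piCode B F ∨ A = 𝔐.sigmaCode B F) ∧ D B ∧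
      ∀ x, E B x → ∃ C, 𝔐.App F x C ∧ D C

/-- The extension of `A`, given those of its components. -/
def TypeExt (E : 𝔐.N → 𝔐.N → Prop) (A z : 𝔐.N) : Prop :=
  A = 𝔐.natCode ∨ (∃ n, A = 𝔐.finCode n ∧ 𝔐.lt z n) ∨
    (∃ B C, A = 𝔐.sumCode B C ∧ ((∃ x, z = 𝔐.pair (𝔐.num 0) x ∧ E B x) ∨
      ∃ y, z = 𝔐.pair (𝔐.num 1) y ∧ E C y)) ∨
    (∃ B F, A = 𝔐.piCode B F ∧ ∀ x, E B x → ∃ C y, 𝔐.App F x C ∧ 𝔐.App z x y ∧ E C y) ∨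
    ∃ B F, A = 𝔐.sigmaCode B F ∧ ∃ x w C, z = 𝔐.pair x w ∧ E B x ∧ 𝔐.App F x C ∧ E C w

variable {𝔐} [hM : Fact 𝔐.IsModelZ2] {D D' : 𝔐.N → Prop} {E E' : 𝔐.N → 𝔐.N → Prop}

theorem typeExt_nat {z : 𝔐.N} : 𝔐.TypeExt E 𝔐.natCode z := Or.inl rfl

theorem typeExt_fin {n z : 𝔐.N} : 𝔐.TypeExt E (𝔐.finCode n) z ↔ 𝔐.lt z n := by
  simp [TypeExt, natCode, finCode, sumCode, piCode, sigmaCode, pair_inj]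

theorem typeExt_sum {B C z : 𝔐.N} : 𝔐.TypeExt E (𝔐.sumCode B C) z ↔
    (∃ x, z = 𝔐.pair (𝔐.num 0) x ∧ E B x) ∨ ∃ y, z = 𝔐.pair (𝔐.num 1) y ∧ E C y := by
  simp only [TypeExt, natCode, finCode, sumCode, piCode, sigmaCode, pair_inj, num_inj]
  simp [and_assoc, ← exists_and_left]

theorem typeExt_pi {B F z : 𝔐.N} : 𝔐.TypeExt E (𝔐.piCode B F) z ↔
    ∀ x, E B x → ∃ C y, 𝔐.App F x C ∧ 𝔐.App z x y ∧ E C y := by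
  simp only [TypeExt, natCode, finCode, sumCode, piCode, sigmaCode, pair_inj, num_inj]
  simp [and_assoc]

theorem typeExt_sigma {B F z : 𝔐.N} : 𝔐.TypeExt E (𝔐.sigmaCode B F) z ↔
    ∃ x w C, z = 𝔐.pair x w ∧ E B x ∧ 𝔐.App F x C ∧ E C w := by
  simp only [TypeExt, natCode, finCode, sumCode, piCode, sigmaCode, pair_inj, num_inj]
  simp [and_assoc]

/-- Separating the condition on components from the description of the extension makes both parts
definable and lets them be varied independently. -/
theorem typeStep_iff {A : 𝔐.N} {P : 𝔐.N → Prop} :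
    𝔐.TypeStep D E A P ↔ 𝔐.TypeComps D E A ∧ ∀ z, P z ↔ 𝔐.TypeExt E A z := by
  constructor
  · rintro (_ | ⟨n⟩ | ⟨A, B, hA, hB⟩ | ⟨A, F, hA, hF⟩ | ⟨A, F, hA, hF⟩)
    · exact ⟨Or.inl rfl, fun z => iff_of_true trivial typeExt_nat⟩
    · exact ⟨Or.inr (Or.inl ⟨n, rfl⟩), fun z => typeExt_fin.symm⟩
    · exact ⟨Or.inr (Or.inr (Or.inl ⟨A, B, rfl, hA, hB⟩)), fun z => typeExt_sum.symm⟩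
    · exact ⟨Or.inr (Or.inr (Or.inr ⟨A, F, Or.inl rfl, hA, hF⟩)), fun z => typeExt_pi.symm⟩
    · exact ⟨Or.inr (Or.inr (Or.inr ⟨A, F, Or.inr rfl, hA, hF⟩)), fun z => typeExt_sigma.symm⟩
  · rintro ⟨rfl | ⟨n, rfl⟩ | ⟨A, B, rfl, hA, hB⟩ | ⟨A, F, rfl | rfl, hA, hF⟩, hP⟩
    · rw [show P = fun _ => True from funext fun z => propext ((hP z).trans
        (iff_of_true typeExt_nat trivial))]
      exact .nat
    · rw [show P = _ from funext fun z => propext ((hP z).trans typeExt_fin)]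
      exact .fin n
    · rw [show P = _ from funext fun z => propext ((hP z).trans typeExt_sum)]
      exact .sum A B hA hB
    · rw [show P = _ from funext fun z => propext ((hP z).trans typeExt_pi)]
      exact .pi A F hA hF
    · rw [show P = _ from funext fun z => propext ((hP z).trans typeExt_sigma)]
      exact .sigma A F hA hF

theorem TypeComps.congr {A : 𝔐.N} (h : 𝔐.TypeComps D E A)
    (hD : ∀ B, D B → D' B ∧ ∀ x, E B x ↔ E' B x) : 𝔐.TypeComps D' E' A := by
  rcases h with h | h | ⟨B, C, h, hB, hC⟩ | ⟨B, F, h, hB, hF⟩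
  · exact Or.inl h
  · exact Or.inr (Or.inl h)
  · exact Or.inr (Or.inr (Or.inl ⟨B, C, h, (hD B hB).1, (hD C hC).1⟩))
  · refine Or.inr (Or.inr (Or.inr ⟨B, F, h, (hD B hB).1, fun x hx => ?_⟩))
    obtain ⟨C, hC, hC'⟩ := hF x (((hD B hB).2 x).2 hx)
    exact ⟨C, hC, (hD C hC').1⟩

/-- The extension of a type depends only on the extensions of its components. For products and sums,
determinism of application identifies the fibre named in the extension with the one known to be a
component. -/
theorem TypeComps.typeExt_congr {A : 𝔐.N} (h : 𝔐.TypeComps D E A)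
    (hD : ∀ B, D B → ∀ x, E B x ↔ E' B x) (z : 𝔐.N) : 𝔐.TypeExt E A z ↔ 𝔐.TypeExt E' A z := by
  rcases h with rfl | ⟨n, rfl⟩ | ⟨B, C, rfl, hB, hC⟩ | ⟨B, F, rfl | rfl, hB, hF⟩
  · exact iff_of_true typeExt_nat typeExt_nat
  · rw [typeExt_fin, typeExt_fin]
  · simp only [typeExt_sum, hD B hB, hD C hC]
  · simp only [typeExt_pi, ← hD B hB]
    refine forall₂_congr fun x hx => ?_
    obtain ⟨C, hC, hC'⟩ := hF x hx
    constructor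
    · rintro ⟨B, y, h₁, h₂, h₃⟩
      obtain rfl := h₁.det hC
      exact ⟨B, y, h₁, h₂, (hD _ hC' _).1 h₃⟩
    · rintro ⟨B, y, h₁, h₂, h₃⟩
      obtain rfl := h₁.det hC
      exact ⟨B, y, h₁, h₂, (hD _ hC' _).2 h₃⟩
  · simp only [typeExt_sigma, ← hD B hB]
    refine exists₃_congr fun x w C => and_congr_right fun _ => and_congr_right fun hx =>
      and_congr_right fun h => ?_
    obtain ⟨C', hC, hC'⟩ := hF x hx
    obtain rfl := h.det hC
    exact hD _ hC' _

theorem isTypeStructure_iff {D E : Set 𝔐.N} : 𝔐.IsTypeStructure D E ↔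
    (∀ A, A ∈ D → 𝔐.TypeComps (fun B => B ∈ D) (𝔐.rel₂ E) A ∧
      ∀ z, 𝔐.rel₂ E A z ↔ 𝔐.TypeExt (𝔐.rel₂ E) A z) ∧
    ∀ X ∈ 𝔐.sets, (∀ A, A ∈ D → 𝔐.TypeComps (fun B => B ∈ D ∧ B ∈ X) (𝔐.rel₂ E) A →
      A ∈ X) → ∀ A, A ∈ D → A ∈ X := by
  simp only [IsTypeStructure, typeStep_iff]
  refine and_congr_right fun h => forall₂_congr fun X hX => ?_
  exact ⟨fun h' h₁ => h' fun A hA h₂ => h₁ A hA h₂.1,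
    fun h' h₁ => h' fun A hA h₂ => h₁ A hA ⟨h₂, (h A hA).2⟩⟩

end TypeStep

section Family

variable {I : Type*} {K : I → Henkin.{u}} {par : Prop} {n m : ℕ}
  {f : ∀ i, (Fin n → (K i).N) → (Fin m → Set (K i).N) → (K i).N}
  [hK : ∀ i, Fact (K i).IsModelZ2]

theorem Dfn.isTypeStructure₀ :
    Dfn K par 0 2 (fun i _ σ => (K i).IsTypeStructure (σ 0) (σ 1)) := by
  have h : Dfn K par 0 2 (fun i _ σ =>
    (∀ A, A ∈ σ 0 → (K i).TypeComps (fun B => B ∈ σ 0) ((K i).rel₂ (σ 1)) A ∧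
      ∀ z, (K i).rel₂ (σ 1) A z ↔ (K i).TypeExt ((K i).rel₂ (σ 1)) A z) ∧
    ∀ X ∈ (K i).sets, (∀ A, A ∈ σ 0 →
      (K i).TypeComps (fun B => B ∈ σ 0 ∧ B ∈ X) ((K i).rel₂ (σ 1)) A →
      A ∈ X) → ∀ A, A ∈ σ 0 → A ∈ X) := by
    unfold TypeComps TypeExt; infer_instance
  exact h.congr fun i ρ σ _ => isTypeStructure_iff.symm

end Family
end Henkin

namespace Henkin

section Family

variable {I : Type*} {K : I → Henkin.{u}} {par : Prop} {n m : ℕ}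
  {f : ∀ i, (Fin n → (K i).N) → (Fin m → Set (K i).N) → (K i).N}
  {X Y : ∀ i, (Fin n → (K i).N) → (Fin m → Set (K i).N) → Set (K i).N}
  [hK : ∀ i, Fact (K i).IsModelZ2]

instance Dfn.isTypeStructure [hX : DfnS K par n m X] [hY : DfnS K par n m Y] :
    Dfn K par n m (fun i ρ σ => (K i).IsTypeStructure (X i ρ σ) (Y i ρ σ)) :=
  Dfn.substVec Dfn.isTypeStructure₀ (fun j => j.elim0) (fun i ρ σ => ![X i ρ σ, Y i ρ σ])
    (fun j => j.elim0) ⟨fun j => by fin_cases j; exacts [hX, hY]⟩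

instance Dfn.isType [DfnF K par n m f] : Dfn K par n m (fun i ρ σ => (K i).IsType (f i ρ σ)) :=
  Dfn.subst₁ (P := fun i => (K i).IsType) (by unfold IsType; infer_instance)

instance DfnS.ext [DfnF K par n m f] : DfnS K par n m (fun i ρ σ => (K i).ext (f i ρ σ)) :=
  ⟨Dfn.subst₂ (P := fun i x A => x ∈ (K i).ext A) (by unfold Henkin.ext; infer_instance)⟩

instance DfnS.V : DfnS K par n m (fun i _ _ => (K i).V) :=
  ⟨Dfn.subst₁ (P := fun i x => x ∈ (K i).V) (by unfold Henkin.V; infer_instance)⟩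

instance DfnS.treeOf [DfnF K par n m f] : DfnS K par n m (fun i ρ σ => (K i).treeOf (f i ρ σ)) :=
  ⟨Dfn.subst₂ (P := fun i s v => s ∈ (K i).treeOf v) (by unfold Henkin.treeOf; infer_instance)⟩

end Family

/-! ### Types: uniqueness of extensions, induction, and closure under the formers. -/

section Model

variable {𝔐 : Henkin.{u}} [hM : Fact 𝔐.IsModelZ2]

/-- A code determines its components, so two presentations of the same code have them in common. In
the dependent cases the first components have equal extensions, and the fibres agree by determinism.
-/
theorem TypeComps.inter {D D' : 𝔐.N → Prop} {E E' : 𝔐.N → 𝔐.N → Prop} {A : 𝔐.N}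
    (h : 𝔐.TypeComps D E A) (h' : 𝔐.TypeComps D' E' A)
    (hD : ∀ B, D B → D' B → ∀ x, E B x ↔ E' B x) : 𝔐.TypeComps (fun B => D B ∧ D' B) E A := by
  rcases h with rfl | ⟨n, rfl⟩ | ⟨B, C, rfl, hB, hC⟩ | ⟨B, F, hA, hB, hF⟩
  · exact Or.inl rfl
  · exact Or.inr (Or.inl ⟨n, rfl⟩)
  · refine Or.inr (Or.inr (Or.inl ⟨B, C, rfl, ?_⟩))
    simp [TypeComps, natCode, finCode, sumCode, piCode, sigmaCode, pair_inj] at h'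
    exact ⟨⟨hB, h'.1⟩, hC, h'.2⟩
  · refine Or.inr (Or.inr (Or.inr ⟨B, F, hA, ?_⟩))
    have h'' : D' B ∧ ∀ x, E' B x → ∃ C, 𝔐.App F x C ∧ D' C := by
      rcases hA with rfl | rfl <;>
      · simp only [TypeComps, natCode, finCode, sumCode, piCode, sigmaCode, pair_inj, num_inj] at h'
        simp at h'
        exact h'
    refine ⟨⟨hB, h''.1⟩, fun x hx => ?_⟩
    obtain ⟨C, hC, hC'⟩ := hF x hx
    obtain ⟨C', hC₂, hC₂'⟩ := h''.2 x ((hD B hB h''.1 x).1 hx)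
    obtain rfl := hC.det hC₂
    exact ⟨C, hC, hC', hC₂'⟩

/-- Induction along the first type structure: two structures agree on a code as soon as they agree
on its components. The extension of a type is thus independent of the structure that witnesses it.
-/
theorem IsTypeStructure.ext_unique {D E D' E' : Set 𝔐.N} (hD : D ∈ 𝔐.sets) (hE : E ∈ 𝔐.sets)
    (hD' : D' ∈ 𝔐.sets) (hE' : E' ∈ 𝔐.sets) (h : 𝔐.IsTypeStructure D E)
    (h' : 𝔐.IsTypeStructure D' E') {A : 𝔐.N} (hA : A ∈ D) (hA' : A ∈ D') (x : 𝔐.N) :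
    𝔐.rel₂ E A x ↔ 𝔐.rel₂ E' A x := by
  have : Fact (D' ∈ 𝔐.sets) := ⟨hD'⟩
  have : Fact (E ∈ 𝔐.sets) := ⟨hE⟩
  have : Fact (E' ∈ 𝔐.sets) := ⟨hE'⟩
  rw [isTypeStructure_iff] at h h'
  refine h.2 {A | A ∈ D' → ∀ x, 𝔐.rel₂ E A x ↔ 𝔐.rel₂ E' A x}
    (setOf_mem_sets (fun A => A ∈ D' → ∀ x, 𝔐.rel₂ E A x ↔ 𝔐.rel₂ E' A x))
    (fun A hA hc hA' x => ?_) A hA hA' x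
  rw [(h.1 A hA).2, (h'.1 A hA').2]
  have hc' := (h'.1 A hA').1
  exact (hc.inter hc' fun B hB => hB.2).typeExt_congr (fun B hB => hB.1.2 hB.2) x

theorem IsTypeStructure.mem_ext_iff {D E : Set 𝔐.N} (hD : D ∈ 𝔐.sets) (hE : E ∈ 𝔐.sets)
    (h : 𝔐.IsTypeStructure D E) {A : 𝔐.N} (hA : A ∈ D) (x : 𝔐.N) :
    x ∈ 𝔐.ext A ↔ 𝔐.rel₂ E A x :=
  ⟨fun ⟨_, hD', _, hE', h', hA', hx⟩ => (h.ext_unique hD hE hD' hE' h' hA hA' x).2 hx,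
    fun hx => ⟨D, hD, E, hE, h, hA, hx⟩⟩

theorem IsType.comps {A : 𝔐.N} (hA : 𝔐.IsType A) :
    𝔐.TypeComps 𝔐.IsType (fun B x => x ∈ 𝔐.ext B) A ∧
      ∀ x, x ∈ 𝔐.ext A ↔ 𝔐.TypeExt (fun B x => x ∈ 𝔐.ext B) A x := by
  obtain ⟨D, hD, E, hE, h, hA⟩ := hA
  have hext := fun B (hB : B ∈ D) x => (h.mem_ext_iff hD hE hB x).symm
  have h' := (isTypeStructure_iff.1 h).1 A hA
  refine ⟨h'.1.congr fun B hB => ⟨⟨D, hD, E, hE, h, hB⟩, hext B hB⟩, fun x => ?_⟩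
  rw [← hext A hA, h'.2, h'.1.typeExt_congr hext]

theorem IsType.induct {A : 𝔐.N} (hA : 𝔐.IsType A) (P : 𝔐.N → Prop) (hP : 𝔐.Def₁ P)
    (h : ∀ A, 𝔐.IsType A →
      𝔐.TypeComps (fun B => 𝔐.IsType B ∧ P B) (fun B x => x ∈ 𝔐.ext B) A → P A) : P A := by
  obtain ⟨D, hD, E, hE, hDE, hA⟩ := hA
  refine (isTypeStructure_iff.1 hDE).2 {A | P A} (setOf_mem_sets P hP) (fun B hB hc => ?_) A hA
  exact h B ⟨D, hD, E, hE, hDE, hB⟩ (hc.congr fun C hC => ⟨⟨⟨D, hD, E, hE, hDE, hC.1⟩, hC.2⟩,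
    fun x => (hDE.mem_ext_iff hD hE hC.1 x).symm⟩)

/-- By comprehension, the codes whose components are types form a set; with the extensions they must
have, they are a type structure. A set closed as in the induction clause contains all types, hence
also these codes, which lie at most one step above. -/
theorem IsType.of_comps {A : 𝔐.N}
    (hA : 𝔐.TypeComps 𝔐.IsType (fun B x => x ∈ 𝔐.ext B) A) : 𝔐.IsType A := by
  have hD : {A | 𝔐.TypeComps 𝔐.IsType (fun B x => x ∈ 𝔐.ext B) A} ∈ 𝔐.sets :=
    setOf_mem_sets (fun A => 𝔐.TypeComps 𝔐.IsType (fun B x => x ∈ 𝔐.ext B) A)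
      (by unfold TypeComps; infer_instance)
  obtain ⟨E, hE, hEx⟩ := exists_rel₂ (fun A x => 𝔐.TypeExt (fun B x => x ∈ 𝔐.ext B) A x)
    (by unfold TypeExt; infer_instance)
  refine ⟨_, hD, E, hE, ?_, hA⟩
  have hext : ∀ B, 𝔐.IsType B → ∀ x, x ∈ 𝔐.ext B ↔ 𝔐.rel₂ E B x := fun B hB x => by
    rw [hEx, hB.comps.2]
  rw [isTypeStructure_iff]
  refine ⟨fun B hB => ⟨TypeComps.congr hB fun C hC => ⟨hC.comps.1, hext C hC⟩, fun z => ?_⟩,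
    fun X hX h => ?_⟩
  · rw [hEx]
    exact TypeComps.typeExt_congr hB hext z
  · have : Fact (X ∈ 𝔐.sets) := ⟨hX⟩
    have key : ∀ B, 𝔐.IsType B → B ∈ X := fun B hB => hB.induct (fun B => B ∈ X) inferInstance
      fun B hB hc => h B hB.comps.1 (hc.congr fun C hC => ⟨⟨hC.1.comps.1, hC.2⟩, hext C hC.1⟩)
    exact fun B hB => h B hB (TypeComps.congr hB fun C hC => ⟨⟨hC.comps.1, key C hC⟩, hext C hC⟩)

section Formers

variable {A B F n : 𝔐.N}

theorem isType_nat : 𝔐.IsType 𝔐.natCode := .of_comps (Or.inl rfl)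

theorem mem_ext_nat {x : 𝔐.N} : x ∈ 𝔐.ext 𝔐.natCode := (isType_nat.comps.2 x).2 typeExt_nat

theorem isType_fin : 𝔐.IsType (𝔐.finCode n) := .of_comps (Or.inr (Or.inl ⟨n, rfl⟩))

theorem mem_ext_fin {x : 𝔐.N} : x ∈ 𝔐.ext (𝔐.finCode n) ↔ 𝔐.lt x n :=
  (isType_fin.comps.2 x).trans typeExt_fin

theorem isType_sum (hA : 𝔐.IsType A) (hB : 𝔐.IsType B) : 𝔐.IsType (𝔐.sumCode A B) :=
  .of_comps (Or.inr (Or.inr (Or.inl ⟨A, B, rfl, hA, hB⟩)))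

theorem mem_ext_sum (hA : 𝔐.IsType A) (hB : 𝔐.IsType B) {z : 𝔐.N} : z ∈ 𝔐.ext (𝔐.sumCode A B) ↔
    (fst z = 𝔐.num 0 ∧ snd z ∈ 𝔐.ext A) ∨ (fst z = 𝔐.num 1 ∧ snd z ∈ 𝔐.ext B) := by
  rw [(isType_sum hA hB).comps.2, typeExt_sum]
  obtain ⟨x, y, rfl⟩ := exists_pair z
  simp [pair_inj]

theorem isType_pi (hA : 𝔐.IsType A) (hF : ∀ x ∈ 𝔐.ext A, ∃ B, 𝔐.App F x B ∧ 𝔐.IsType B) :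
    𝔐.IsType (𝔐.piCode A F) :=
  .of_comps (Or.inr (Or.inr (Or.inr ⟨A, F, Or.inl rfl, hA, hF⟩)))

theorem mem_ext_pi (hA : 𝔐.IsType A) (hF : ∀ x ∈ 𝔐.ext A, ∃ B, 𝔐.App F x B ∧ 𝔐.IsType B)
    {f : 𝔐.N} : f ∈ 𝔐.ext (𝔐.piCode A F) ↔
      ∀ x ∈ 𝔐.ext A, ∃ B y, 𝔐.App F x B ∧ 𝔐.App f x y ∧ y ∈ 𝔐.ext B := by
  rw [(isType_pi hA hF).comps.2, typeExt_pi]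

theorem isType_sigma (hA : 𝔐.IsType A) (hF : ∀ x ∈ 𝔐.ext A, ∃ B, 𝔐.App F x B ∧ 𝔐.IsType B) :
    𝔐.IsType (𝔐.sigmaCode A F) :=
  .of_comps (Or.inr (Or.inr (Or.inr ⟨A, F, Or.inr rfl, hA, hF⟩)))

theorem mem_ext_sigma (hA : 𝔐.IsType A) (hF : ∀ x ∈ 𝔐.ext A, ∃ B, 𝔐.App F x B ∧ 𝔐.IsType B)
    {z : 𝔐.N} : z ∈ 𝔐.ext (𝔐.sigmaCode A F) ↔
      fst z ∈ 𝔐.ext A ∧ ∃ B, 𝔐.App F (fst z) B ∧ snd z ∈ 𝔐.ext B := by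
  rw [(isType_sigma hA hF).comps.2, typeExt_sigma]
  obtain ⟨x, y, rfl⟩ := exists_pair z
  simp only [pair_inj, fst_pair, snd_pair]
  exact ⟨fun ⟨_, _, C, h, h'⟩ => by obtain ⟨rfl, rfl⟩ := h; exact ⟨h'.1, C, h'.2⟩,
    fun ⟨h, C, h'⟩ => ⟨x, y, C, ⟨rfl, rfl⟩, h, h'⟩⟩

end Formers

/-! ### The universe `V` and its trees -/

theorem supCode_mem_V {A f : 𝔐.N} (hA : 𝔐.IsType A)
    (hf : ∀ x ∈ 𝔐.ext A, ∃ w, 𝔐.App f x w ∧ w ∈ 𝔐.V) : 𝔐.supCode A f ∈ 𝔐.V := by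
  intro Z hZ h
  refine h A f hA fun x hx => ?_
  obtain ⟨w, hw, hw'⟩ := hf x hx
  exact ⟨w, hw' Z hZ h, hw⟩

/-- Applying the definition to the intersection of `V` with `P` makes membership of the children in
`V` available in the induction step. -/
theorem V_induct (P : 𝔐.N → Prop) (hP : 𝔐.Def₁ P)
    (h : ∀ A f, 𝔐.IsType A → (∀ x ∈ 𝔐.ext A, ∃ w, 𝔐.App f x w ∧ w ∈ 𝔐.V ∧ P w) →
      P (𝔐.supCode A f)) {v : 𝔐.N} (hv : v ∈ 𝔐.V) : P v := by
  obtain ⟨Y, hY, hYP⟩ : ∃ Y ∈ 𝔐.sets, ∀ x, x ∈ Y ↔ P x := ⟨_, setOf_mem_sets P hP, fun _ => Iff.rfl⟩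
  have : Fact (Y ∈ 𝔐.sets) := ⟨hY⟩
  refine (hYP v).1 (hv {x | x ∈ 𝔐.V ∧ x ∈ Y} (setOf_mem_sets (fun x => x ∈ 𝔐.V ∧ x ∈ Y))
    fun A f hA hf => ?_).2
  have hf' : ∀ x ∈ 𝔐.ext A, ∃ w, 𝔐.App f x w ∧ w ∈ 𝔐.V ∧ P w := fun x hx => by
    obtain ⟨w, hw, hw'⟩ := hf x hx
    exact ⟨w, hw', hw.1, (hYP w).1 hw.2⟩
  exact ⟨supCode_mem_V hA fun x hx => (hf' x hx).imp fun w hw => ⟨hw.1, hw.2.1⟩,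
    (hYP _).2 (h A f hA hf')⟩

/-- The index type of `sup(A, f)`. -/
noncomputable def dom (v : 𝔐.N) : 𝔐.N := fst (snd v)

/-- The function `f` of `sup(A, f)`. -/
noncomputable def fn (v : 𝔐.N) : 𝔐.N := snd (snd v)

@[simp]
theorem dom_supCode (A f : 𝔐.N) : dom (𝔐.supCode A f) = A := by simp [dom, supCode]

@[simp]
theorem fn_supCode (A f : 𝔐.N) : fn (𝔐.supCode A f) = f := by simp [fn, supCode]

theorem V_cases {v : 𝔐.N} (hv : v ∈ 𝔐.V) : v = 𝔐.supCode (dom v) (fn v) ∧ 𝔐.IsType (dom v) ∧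
    ∀ x ∈ 𝔐.ext (dom v), ∃ w, 𝔐.App (fn v) x w ∧ w ∈ 𝔐.V := by
  refine V_induct (fun v => v = 𝔐.supCode (dom v) (fn v) ∧ 𝔐.IsType (dom v) ∧
    ∀ x ∈ 𝔐.ext (dom v), ∃ w, 𝔐.App (fn v) x w ∧ w ∈ 𝔐.V) (by unfold dom fn; infer_instance)
    (fun A f hA hf => ?_) hv
  simp only [dom_supCode, fn_supCode, true_and]
  exact ⟨hA, fun x hx => (hf x hx).imp fun w hw => ⟨hw.1, hw.2.1⟩⟩

theorem nil_mem_treeOf {v : 𝔐.N} (hv : v ∈ 𝔐.V) : 𝔐.nil ∈ 𝔐.treeOf v := fun _ _ h _ => h v hv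

/-- Inversion through a definable closed relation. That relation reads the type and the function off
the code by projections, so that it makes sense for every number. -/
theorem cons_mem_treeOf_iff {A f x s : 𝔐.N} (hv : 𝔐.supCode A f ∈ 𝔐.V) :
    𝔐.cons x s ∈ 𝔐.treeOf (𝔐.supCode A f) ↔
      x ∈ 𝔐.ext A ∧ ∃ w, 𝔐.App f x w ∧ s ∈ 𝔐.treeOf w := by
  constructor
  · intro h
    obtain ⟨Z, hZ, hZP⟩ := exists_rel₂ (fun v t => t ∈ 𝔐.treeOf v ∧ ∀ x s, t = 𝔐.cons x s →
      x ∈ 𝔐.ext (fst (snd v)) ∧ ∃ w, 𝔐.App (snd (snd v)) x w ∧ s ∈ 𝔐.treeOf w)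
    have := h Z hZ (fun v hv => ?_) (fun A f x w s hv hx hw hs => ?_)
    · simpa [supCode] using ((hZP _ _).1 this).2 x s rfl
    · exact (hZP _ _).2 ⟨nil_mem_treeOf hv, fun x s h => absurd h (nil_ne_cons _ _)⟩
    · have hs' := ((hZP _ _).1 hs).1
      refine (hZP _ _).2 ⟨fun Z hZ h₁ h₂ => h₂ A f x w s hv hx hw (hs' Z hZ h₁ h₂),
        fun y t h => ?_⟩
      obtain ⟨rfl, rfl⟩ := cons_inj.1 h
      simp only [supCode, fst_pair, snd_pair]
      exact ⟨hx, w, hw, hs'⟩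
  · rintro ⟨hx, w, hw, hs⟩ Z hZ h₁ h₂
    exact h₂ A f x w s hv hx hw (hs Z hZ h₁ h₂)

theorem mem_immd_treeOf {v : 𝔐.N} (hv : v ∈ 𝔐.V) {a : 𝔐.N} :
    a ∈ 𝔐.immd (𝔐.treeOf v) ↔ a ∈ 𝔐.ext (dom v) := by
  obtain ⟨h₁, h₂, h₃⟩ := V_cases hv
  rw [h₁] at hv ⊢
  rw [mem_immd, cons_mem_treeOf_iff hv, dom_supCode]
  refine and_iff_left_of_imp fun ha => ?_
  obtain ⟨w, hw, hw'⟩ := h₃ a ha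
  exact ⟨w, hw, nil_mem_treeOf hw'⟩

theorem down_treeOf {v a w : 𝔐.N} (hv : v ∈ 𝔐.V) (ha : a ∈ 𝔐.ext (dom v))
    (hw : 𝔐.App (fn v) a w) : 𝔐.down (𝔐.treeOf v) a = 𝔐.treeOf w := by
  have h := (V_cases hv).1
  rw [h] at hv ⊢
  ext s
  refine (cons_mem_treeOf_iff hv).trans ⟨fun ⟨_, w', hw', hs⟩ => ?_, fun hs => ⟨ha, w, hw, hs⟩⟩
  rwa [hw.det hw']

theorem isSet_treeOf {v : 𝔐.N} (hv : v ∈ 𝔐.V) : 𝔐.IsSet (𝔐.treeOf v) := by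
  refine V_induct (fun v => 𝔐.IsSet (𝔐.treeOf v)) inferInstance (fun A f hA hf => ?_) hv
  have hv : 𝔐.supCode A f ∈ 𝔐.V :=
    supCode_mem_V hA fun x hx => (hf x hx).imp fun w hw => ⟨hw.1, hw.2.1⟩
  refine isSet_of_down (setOf_mem_sets (fun s => s ∈ 𝔐.treeOf (𝔐.supCode A f))) (nil_mem_treeOf hv)
    (fun a s h => ?_) fun a ha => ?_
  · rw [mem_immd_treeOf hv, dom_supCode]
    exact ((cons_mem_treeOf_iff hv).1 h).1
  · rw [mem_immd_treeOf hv, dom_supCode] at ha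
    obtain ⟨w, hw, hw', hw''⟩ := hf a ha
    rwa [down_treeOf hv (by rwa [dom_supCode]) (by rwa [fn_supCode])]

theorem treeM_eq : 𝔐.treeM = mkTree (fun v => v ∈ 𝔐.V) 𝔐.treeOf := by
  ext t
  simp only [treeM, mkTree, Set.mem_ofPred_eq]
  exact or_congr_right ⟨fun ⟨x, hx, s, hs, h⟩ => ⟨x, s, h, hx, hs⟩,
    fun ⟨x, s, h, hx, hs⟩ => ⟨x, hx, s, hs, h⟩⟩

variable (𝔐) in
theorem isSet_treeM : 𝔐.IsSet 𝔐.treeM := by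
  rw [treeM_eq]
  exact isSet_mkTree (fun v => isSet_treeOf)

theorem mem_immd_treeM {v : 𝔐.N} : v ∈ 𝔐.immd 𝔐.treeM ↔ v ∈ 𝔐.V := by
  rw [treeM_eq]
  exact mem_immd_mkTree (fun v => isSet_treeOf)

theorem down_treeM {v : 𝔐.N} (hv : v ∈ 𝔐.V) : 𝔐.down 𝔐.treeM v = 𝔐.treeOf v := by
  rw [treeM_eq]
  exact down_mkTree (I := fun v => v ∈ 𝔐.V) hv

end Model
end Henkin

/-! ### Program terms for the codes of types and of elements of `V`. -/

namespace PTerm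

def domT (t : PTerm) : PTerm := .fst (.snd t)
def fnT (t : PTerm) : PTerm := .snd (.snd t)
def finT (t : PTerm) : PTerm := .pair (.num 1) t
def sumT (s t : PTerm) : PTerm := .pair (.num 2) (.pair s t)
def piT (s t : PTerm) : PTerm := .pair (.num 3) (.pair s t)
def sigmaT (s t : PTerm) : PTerm := .pair (.num 4) (.pair s t)
def supT (s t : PTerm) : PTerm := .pair (.num 5) (.pair s t)

end PTerm

namespace Henkin

open PTerm

/-! ## `M` is a model -/

section Model

variable {𝔐 : Henkin.{u}} [hM : Fact 𝔐.IsModelZ2]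

section Programs

variable {s t : PTerm} {env : List 𝔐.N} {Q : 𝔐.N → Prop}

theorem wp_domT : wp (domT t) env Q = wp t env (fun x => Q (dom x)) := rfl

theorem wp_fnT : wp (fnT t) env Q = wp t env (fun x => Q (fn x)) := rfl

theorem wp_finT : wp (finT t) env Q = wp t env (fun x => Q (𝔐.finCode x)) := rfl

theorem wp_sumT :
    wp (sumT s t) env Q = wp s env (fun x => wp t env (fun y => Q (𝔐.sumCode x y))) := rfl

theorem wp_piT :
    wp (piT s t) env Q = wp s env (fun x => wp t env (fun y => Q (𝔐.piCode x y))) := rfl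

theorem wp_sigmaT :
    wp (sigmaT s t) env Q = wp s env (fun x => wp t env (fun y => Q (𝔐.sigmaCode x y))) := rfl

theorem wp_supT :
    wp (supT s t) env Q = wp s env (fun x => wp t env (fun y => Q (𝔐.supCode x y))) := rfl

theorem app_clo {a c : 𝔐.N} (h : wp t (a :: env) (· = c)) : 𝔐.App (clo t env) a c := by
  obtain ⟨y, hy, rfl⟩ := exists_app_clo h
  exact hy

end Programs

theorem V_step {v a : 𝔐.N} (hv : v ∈ 𝔐.V) (ha : a ∈ 𝔐.immd (𝔐.treeOf v)) :
    ∃ w, 𝔐.App (fn v) a w ∧ w ∈ 𝔐.V ∧ 𝔐.down (𝔐.treeOf v) a = 𝔐.treeOf w := by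
  rw [mem_immd_treeOf hv] at ha
  obtain ⟨w, hw, hw'⟩ := (V_cases hv).2.2 a ha
  exact ⟨w, hw, hw', down_treeOf hv ha hw⟩

theorem down_treeOf_supCode {A f a w : 𝔐.N} (hv : 𝔐.supCode A f ∈ 𝔐.V) (ha : a ∈ 𝔐.ext A)
    (hw : 𝔐.App f a w) : 𝔐.down (𝔐.treeOf (𝔐.supCode A f)) a = 𝔐.treeOf w :=
  down_treeOf hv (by rwa [dom_supCode]) (by rwa [fn_supCode])

theorem mem_immd_treeOf_supCode {A f a : 𝔐.N} (hv : 𝔐.supCode A f ∈ 𝔐.V) :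
    a ∈ 𝔐.immd (𝔐.treeOf (𝔐.supCode A f)) ↔ a ∈ 𝔐.ext A := by
  rw [mem_immd_treeOf hv, dom_supCode]

/-- The sets constructed in `M` have literally the intended immediate subtrees, so the reflexivity
realizer suffices for the equality part of each membership. -/
theorem realizesMem_of_eq {S T : Set 𝔐.N} (hT : 𝔐.IsSet T) {a : 𝔐.N} (ha : a ∈ 𝔐.immd T)
    (h : S = 𝔐.down T a) : RealizesMem S T (𝔐.pair a (𝔐.num reflIdx)) :=
  h ▸ realizesMem_down hT ha

end Model

theorem realizedAtM_of {φ : Form 1} (t : PTerm) (h : ∀ (𝔐 : Henkin.{u}) [Fact 𝔐.IsModelZ2],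
    𝔐.Realizes φ (fun _ => 𝔐.treeM) (𝔐.num t.val)) : RealizedAtM.{u} φ :=
  ⟨t.val, fun 𝔐 hM => have : Fact 𝔐.IsModelZ2 := ⟨hM⟩; h 𝔐⟩

/-! ### Transitivity of `M` and Union. -/

theorem realizedAtM_transitiveM : RealizedAtM.{u} Form.transitiveM := by
  refine realizedAtM_of (.lam (.lam (.pair (.app (fnT (.var 1)) (.var 0)) (.num reflIdx))))
    fun 𝔐 _ => ?_
  simp (disch := omega) only [Form.transitiveM, realizes_ball, realizes_mem, extend_v_of_lt,
    extend_v_of_eq, mem_immd_treeM]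
  refine fun v hv => exists_app_val ?_
  simp only [wp_domT, wp_fnT, wp_supT, wp_finT, wp_sumT, wp_piT, wp_sigmaT, wp, List.getD_cons_zero,
      List.getD_cons_succ, fst_pair, snd_pair]
  rw [down_treeM hv]
  refine fun a ha => exists_app_clo ?_
  obtain ⟨w, hw, hw', h⟩ := V_step hv ha
  simp only [wp_domT, wp_fnT, wp_supT, wp_finT, wp_sumT, wp_piT, wp_sigmaT, wp, List.getD_cons_zero,
      List.getD_cons_succ, fst_pair, snd_pair]
  exact ⟨w, hw, realizesMem_of_eq (isSet_treeM 𝔐) (mem_immd_treeM.2 hw')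
    (by rw [h, down_treeM hw'])⟩

/-- The index type of the union is the sum, over the indices `x` of `v`, of the index type of the
child at `x`; a pair is sent to the corresponding grandchild. -/
theorem realizedAtM_unionM : RealizedAtM.{u} Form.unionM := by
  let tF : PTerm := .domT (.app (fnT (.var 1)) (.var 0))
  let tG : PTerm := .app (fnT (.app (fnT (.var 1)) (.fst (.var 0)))) (.snd (.var 0))
  refine realizedAtM_of (.lam (.pair (supT (sigmaT (domT (.var 0)) (.lam tF)) (.lam tG))
    (.pair (.lam (.lam (.pair (.pair (.var 1) (.var 0)) (.num reflIdx))))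
      (.lam (.pair (.fst (.var 0)) (.pair (.snd (.var 0)) (.num reflIdx))))))) fun 𝔐 _ => ?_
  simp (disch := omega) only [Form.unionM, realizes_ball, realizes_bex, realizes_and, realizes_mem,
    extend_v_of_lt, extend_v_of_eq, mem_immd_treeM]
  refine fun v hv => exists_app_val ?_
  simp only [wp_domT, wp_fnT, wp_supT, wp_finT, wp_sumT, wp_piT, wp_sigmaT, wp, List.getD_cons_zero,
      List.getD_cons_succ, fst_pair, snd_pair]
  rw [down_treeM hv]
  have hF : ∀ {x w}, 𝔐.App (fn v) x w → 𝔐.App (clo tF [v]) x (dom w) := fun {x w} h =>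
    app_clo (by
      simp only [tF]
      simp only [wp_domT, wp_fnT, wp_supT, wp_finT, wp_sumT, wp_piT, wp_sigmaT, wp, List.getD_cons_zero,
      List.getD_cons_succ, fst_pair, snd_pair]
      exact ⟨w, h, rfl⟩)
  have hG : ∀ {p w z}, 𝔐.App (fn v) (fst p) w → 𝔐.App (fn w) (snd p) z →
      𝔐.App (clo tG [v]) p z := fun {p w z} h h' =>
    app_clo (by
      simp only [tG]
      simp only [wp_domT, wp_fnT, wp_supT, wp_finT, wp_sumT, wp_piT, wp_sigmaT, wp, List.getD_cons_zero,
      List.getD_cons_succ, fst_pair, snd_pair]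
      exact ⟨w, h, z, h', rfl⟩)
  obtain ⟨-, hA, hf⟩ := V_cases hv
  have hF' : ∀ x ∈ 𝔐.ext (dom v), ∃ B, 𝔐.App (clo tF [v]) x B ∧ 𝔐.IsType B := fun x hx => by
    obtain ⟨w, hw, hw'⟩ := hf x hx
    exact ⟨_, hF hw, (V_cases hw').2.1⟩
  have hS : ∀ {p}, p ∈ 𝔐.ext (𝔐.sigmaCode (dom v) (clo tF [v])) ↔ fst p ∈ 𝔐.ext (dom v) ∧
      ∃ w, 𝔐.App (fn v) (fst p) w ∧ w ∈ 𝔐.V ∧ snd p ∈ 𝔐.ext (dom w) := fun {p} => by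
    rw [mem_ext_sigma hA hF']
    refine and_congr_right fun hp => ?_
    obtain ⟨w, hw, hw'⟩ := hf _ hp
    constructor
    · rintro ⟨B, hB, h⟩
      obtain rfl := hB.det (hF hw)
      exact ⟨w, hw, hw', h⟩
    · rintro ⟨w', hw₂, -, h⟩
      exact ⟨_, hF hw₂, h⟩
  have hb : 𝔐.supCode (𝔐.sigmaCode (dom v) (clo tF [v])) (clo tG [v]) ∈ 𝔐.V := by
    refine supCode_mem_V (isType_sigma hA hF') fun p hp => ?_
    obtain ⟨hp, w, hw, hw', hp'⟩ := hS.1 hp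
    obtain ⟨z, hz, hz'⟩ := (V_cases hw').2.2 _ hp'
    exact ⟨z, hG hw hz, hz'⟩
  rw [down_treeM hb]
  refine ⟨hb, fun x hx => exists_app_clo ?_, fun p hp => exists_app_clo ?_⟩
  · simp only [wp_domT, wp_fnT, wp_supT, wp_finT, wp_sumT, wp_piT, wp_sigmaT, wp, List.getD_cons_zero,
      List.getD_cons_succ, fst_pair, snd_pair]
    refine fun y hy => exists_app_clo ?_
    obtain ⟨w, hw, hw', h⟩ := V_step hv hx
    rw [h] at hy ⊢
    obtain ⟨z, hz, hz', h'⟩ := V_step hw' hy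
    simp only [wp_domT, wp_fnT, wp_supT, wp_finT, wp_sumT, wp_piT, wp_sigmaT, wp, List.getD_cons_zero,
      List.getD_cons_succ, fst_pair, snd_pair]
    have hp : 𝔐.pair x y ∈ 𝔐.ext (𝔐.sigmaCode (dom v) (clo tF [v])) := by
      simp only [hS, fst_pair, snd_pair]
      exact ⟨(mem_immd_treeOf hv).1 hx, w, hw, hw', (mem_immd_treeOf hw').1 hy⟩
    refine realizesMem_of_eq (isSet_treeOf hb) ((mem_immd_treeOf_supCode hb).2 hp) ?_
    rw [h', down_treeOf_supCode hb hp (hG (by rwa [fst_pair]) (by rwa [snd_pair]))]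
  · rw [mem_immd_treeOf_supCode hb] at hp
    obtain ⟨hp₁, w, hw, hw', hp₂⟩ := hS.1 hp
    obtain ⟨z, hz, hz'⟩ := (V_cases hw').2.2 _ hp₂
    simp only [wp_domT, wp_fnT, wp_supT, wp_finT, wp_sumT, wp_piT, wp_sigmaT, wp, List.getD_cons_zero,
      List.getD_cons_succ, fst_pair, snd_pair]
    refine ⟨(mem_immd_treeOf hv).2 hp₁, ?_⟩
    rw [down_treeOf hv hp₁ hw, down_treeOf_supCode hb hp (hG hw hz)]
    exact realizesMem_of_eq (isSet_treeOf hw') ((mem_immd_treeOf hw').2 hp₂)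
      (down_treeOf hw' hp₂ hz).symm

/-! ### Infinity -/

section Omega

variable {𝔐 : Henkin.{u}} [hM : Fact 𝔐.IsModelZ2]

/-- The program sends `n` to the code with index type `N_n` and with the program itself as function,
so the children are the values at all smaller numbers. The same program over the type of natural
numbers gives `ω`. -/
def ordBody : PTerm := supT (finT (.var 0)) (.var 1)

/-- The element of `V` that represents the number `n`. -/
noncomputable def ord (n : 𝔐.N) : 𝔐.N := 𝔐.supCode (𝔐.finCode n) (fixv ordBody [])

theorem app_ord (n : 𝔐.N) : 𝔐.App (fixv ordBody []) n (ord n) := by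
  obtain ⟨y, hy, rfl⟩ := exists_app_fixv (t := ordBody) (env := []) (a := n) (Q := (· = ord n)) rfl
  exact hy

theorem ord_mem_V (n : 𝔐.N) : ord n ∈ 𝔐.V := by
  refine strong_induct (fun n => ord n ∈ 𝔐.V) (by unfold ord; infer_instance) (fun n ih => ?_) n
  exact supCode_mem_V isType_fin fun k hk => ⟨ord k, app_ord k, ih k (mem_ext_fin.1 hk)⟩

theorem mem_immd_ord {k n : 𝔐.N} : k ∈ 𝔐.immd (𝔐.treeOf (ord n)) ↔ k < n := by
  rw [mem_immd_treeOf (ord_mem_V n), ord, dom_supCode, mem_ext_fin, lt_eq_lt]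

theorem down_ord {k n : 𝔐.N} (h : k < n) : 𝔐.down (𝔐.treeOf (ord n)) k = 𝔐.treeOf (ord k) :=
  down_treeOf_supCode (ord_mem_V n) (mem_ext_fin.2 h) (app_ord k)

variable (𝔐) in
/-- The element of `V` that represents `ω`. -/
noncomputable def omega : 𝔐.N := 𝔐.supCode 𝔐.natCode (fixv ordBody [])

theorem omega_mem_V : 𝔐.omega ∈ 𝔐.V :=
  supCode_mem_V isType_nat fun n _ => ⟨ord n, app_ord n, ord_mem_V n⟩

theorem mem_immd_omega (n : 𝔐.N) : n ∈ 𝔐.immd (𝔐.treeOf 𝔐.omega) :=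
  (mem_immd_treeOf_supCode omega_mem_V).2 mem_ext_nat

theorem down_omega (n : 𝔐.N) : 𝔐.down (𝔐.treeOf 𝔐.omega) n = 𝔐.treeOf (ord n) :=
  down_treeOf_supCode omega_mem_V mem_ext_nat (app_ord n)

/-- Both numbers are decreased together. The answer is 0 if the first runs out strictly earlier and
1 otherwise; it is used only for `k` at most `n`, where it is the tag of the disjunction "member or
equal". -/
def cmpBody : PTerm :=
  .natCase (.snd (.var 0)) (.num 1)
    (.natCase (.fst (.var 1)) (.num 0) (.app (.var 3) (.pair (.var 0) (.var 1))))

/-- Decides whether `k < n` or `k = n`. -/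
def cmpIdx : ℕ := (PTerm.fix cmpBody).val

theorem app_cmp_succ {k n y : 𝔐.N} (h : 𝔐.App (𝔐.num cmpIdx) (𝔐.pair k n) y) :
    𝔐.App (𝔐.num cmpIdx) (𝔐.pair (𝔐.succ k) (𝔐.succ n)) y := by
  rw [cmpIdx, num_val_fix] at *
  obtain ⟨z, hz, rfl⟩ := exists_app_fixv (t := cmpBody) (env := [])
    (a := 𝔐.pair (𝔐.succ k) (𝔐.succ n)) (Q := (· = y)) (by
      simp only [cmpBody]
      simp only [wp, List.getD_cons_zero, List.getD_cons_succ, fst_pair, snd_pair]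
      refine ⟨fun h => absurd h (succ_ne_zero _), fun m hm => ⟨fun h => absurd h (succ_ne_zero _),
        fun l hl => ?_⟩⟩
      rw [succ_inj] at hm hl
      subst hm hl
      exact ⟨y, h, rfl⟩)
  exact hz

theorem app_cmp_self (n : 𝔐.N) : 𝔐.App (𝔐.num cmpIdx) (𝔐.pair n n) (𝔐.num 1) := by
  refine induct (fun n => 𝔐.App (𝔐.num cmpIdx) (𝔐.pair n n) (𝔐.num 1)) inferInstance ?_
    (fun n => app_cmp_succ) n
  rw [cmpIdx, num_val_fix]
  obtain ⟨z, hz, rfl⟩ := exists_app_fixv (t := cmpBody) (env := [])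
    (a := 𝔐.pair 𝔐.zero 𝔐.zero) (Q := (· = 𝔐.num 1)) (by
      simp only [cmpBody]
      simp only [wp, List.getD_cons_zero, List.getD_cons_succ, fst_pair, snd_pair]
      exact ⟨fun _ => trivial, fun m hm => absurd hm (zero_ne_succ _)⟩)
  exact hz

theorem app_cmp_of_lt {k n : 𝔐.N} (h : k < n) :
    𝔐.App (𝔐.num cmpIdx) (𝔐.pair k n) (𝔐.num 0) := by
  refine induct (fun n => ∀ k, 𝔐.lt k n → 𝔐.App (𝔐.num cmpIdx) (𝔐.pair k n) (𝔐.num 0))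
    inferInstance (fun k h => absurd h (hM.out.not_lt_zero k)) (fun n ih k hk => ?_) n k h
  rcases eq_zero_or_succ k with rfl | ⟨k, rfl⟩
  · rw [cmpIdx, num_val_fix]
    obtain ⟨z, hz, rfl⟩ := exists_app_fixv (t := cmpBody) (env := [])
      (a := 𝔐.pair 𝔐.zero (𝔐.succ n)) (Q := (· = 𝔐.num 0)) (by
        simp only [cmpBody]
        simp only [wp, List.getD_cons_zero, List.getD_cons_succ, fst_pair, snd_pair]
        exact ⟨fun h => absurd h (succ_ne_zero _), fun _ _ =>
          ⟨fun _ => trivial, fun m hm => absurd hm (zero_ne_succ _)⟩⟩)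
    exact hz
  · refine app_cmp_succ (ih k ?_)
    rw [lt_eq_lt, succ_eq_add_one, succ_eq_add_one, lt_add_one_iff', add_one_le_iff'] at hk
    exact hk

/-- `e ⊩ Y = X ∪ {X}`. -/
def RealizesSucc (X Y : Set 𝔐.N) (e : 𝔐.N) : Prop :=
  (∀ a ∈ 𝔐.immd Y, ∃ z, 𝔐.App (fst e) a z ∧
    ((fst z = 𝔐.num 0 ∧ RealizesMem (𝔐.down Y a) X (snd z)) ∨
      (fst z = 𝔐.num 1 ∧ 𝔐.RealizesEq (𝔐.down Y a) X (snd z)))) ∧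
  (∀ a ∈ 𝔐.immd X, ∃ z, 𝔐.App (fst (snd e)) a z ∧ RealizesMem (𝔐.down X a) Y z) ∧
  RealizesMem X Y (snd (snd e))

theorem realizes_isSucc {n : ℕ} {x y : Fin n} {ρ : Fin n → Set 𝔐.N} {e : 𝔐.N} :
    𝔐.Realizes (Form.isSucc x y) ρ e ↔ RealizesSucc (ρ x) (ρ y) e := by
  simp only [Form.isSucc, realizes_and, realizes_ball, realizes_or, realizes_mem, realizes_eq,
    extend_last, extend_castSucc, RealizesSucc]

def succIdx : ℕ := (PTerm.lam (.pair
  (.lam (.natCase (.app (.num cmpIdx) (.pair (.var 0) (.var 1)))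
    (.pair (.num 0) (.pair (.var 0) (.num reflIdx)))
    (.pair (.num 1) (.num reflIdx))))
  (.pair (.lam (.pair (.var 0) (.num reflIdx))) (.pair (.var 0) (.num reflIdx))))).val

theorem exists_realizesSucc (n : 𝔐.N) : ∃ y, 𝔐.App (𝔐.num succIdx) n y ∧
    RealizesSucc (𝔐.treeOf (ord n)) (𝔐.treeOf (ord (𝔐.succ n))) y := by
  refine exists_app_val ?_
  simp only [wp, List.getD_cons_zero, List.getD_cons_succ, fst_pair, snd_pair]
  have hlt : ∀ {k}, k < 𝔐.succ n ↔ k ≤ n := fun {k} => by rw [succ_eq_add_one, lt_add_one_iff']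
  simp only [RealizesSucc, fst_pair, snd_pair]
  refine ⟨fun k hk => exists_app_clo ?_, fun k hk => exists_app_clo ?_, ?_⟩
  · rw [mem_immd_ord] at hk
    simp only [wp, List.getD_cons_zero, List.getD_cons_succ, fst_pair, snd_pair]
    rcases (hlt.1 hk).lt_or_eq with h | rfl
    · refine ⟨_, app_cmp_of_lt h, fun _ => Or.inl ⟨trivial, ?_⟩, fun y hy =>
        absurd hy (zero_ne_succ _)⟩
      exact realizesMem_of_eq (isSet_treeOf (ord_mem_V n)) (mem_immd_ord.2 h)
        (by rw [down_ord hk, down_ord h])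
    · refine ⟨_, app_cmp_self k, fun h => absurd h (succ_ne_zero _), fun _ _ => Or.inr ⟨trivial, ?_⟩⟩
      rw [down_ord hk]
      exact realizesEq_refl (isSet_treeOf (ord_mem_V k))
  · simp only [wp, List.getD_cons_zero, List.getD_cons_succ, fst_pair, snd_pair]
    rw [mem_immd_ord] at hk
    exact realizesMem_of_eq (isSet_treeOf (ord_mem_V _)) (mem_immd_ord.2 (hlt.2 hk.le))
      (by rw [down_ord hk, down_ord (hlt.2 hk.le)])
  · exact realizesMem_of_eq (isSet_treeOf (ord_mem_V _)) (mem_immd_ord.2 (hlt.2 le_rfl))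
      (by rw [down_ord (hlt.2 le_rfl)])

def omegaRealizer : PTerm :=
  .pair (.pair (.num 0) (.num 0))
    (.pair (.lam (.pair (.succ (.var 0)) (.app (.num succIdx) (.var 0))))
      (.lam (.natCase (.var 0) (.pair (.num 0) (.num 0))
        (.pair (.num 1) (.pair (.var 0) (.app (.num succIdx) (.var 0)))))))

/-- Index `n` carries the tree of `n`, so the successor is computed on indices and a case
distinction on the index decides between zero and successor. Any number realizes that zero is empty.
-/
theorem realizes_isOmega {n : ℕ} {w : Fin n} {ρ : Fin n → Set 𝔐.N}
    (hw : ρ w = 𝔐.treeOf 𝔐.omega) : 𝔐.Realizes (Form.isOmega w) ρ (𝔐.num omegaRealizer.val) := by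
  have h0 : ∀ a, a ∉ 𝔐.immd (𝔐.treeOf (ord 𝔐.zero)) := fun a ha =>
    hM.out.not_lt_zero a (mem_immd_ord.1 ha)
  simp only [Form.isOmega, Form.isEmpty, realizes_and, realizes_ball, realizes_bex, realizes_or,
    realizes_isSucc, extend_last, extend_castSucc, hw, down_omega, omegaRealizer, num_val_pair,
    num_val_lam, fst_pair, snd_pair]
  refine ⟨⟨mem_immd_omega _, fun a ha => (h0 a ha).elim⟩, fun a _ => exists_app_clo ?_,
    fun a _ => exists_app_clo ?_⟩
  · obtain ⟨y, hy, h⟩ := exists_realizesSucc a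
    simp only [wp, List.getD_cons_zero, List.getD_cons_succ, fst_pair, snd_pair]
    exact ⟨y, hy, mem_immd_omega _, h⟩
  · simp only [wp, List.getD_cons_zero, List.getD_cons_succ, fst_pair, snd_pair]
    refine ⟨?_, ?_⟩
    · rintro rfl
      exact Or.inl ⟨trivial, fun a ha => (h0 a ha).elim⟩
    · rintro m rfl
      obtain ⟨y, hy, h⟩ := exists_realizesSucc m
      exact ⟨y, hy, Or.inr ⟨trivial, mem_immd_omega _, h⟩⟩

end Omega

theorem realizedAtM_omegaM : RealizedAtM.{u} Form.omegaM := by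
  refine realizedAtM_of (.pair (.pair (.num 5) (.pair (.pair (.num 0) (.num 0)) (.fix ordBody)))
    omegaRealizer) fun 𝔐 _ => ?_
  -- The code of `ω` has to be a standard numeral: tag 5, the code of the type of naturals, and the
  -- closed program for the children.
  have h : 𝔐.num (PTerm.pair (.num 5) (.pair (.pair (.num 0) (.num 0)) (.fix ordBody))).val =
      𝔐.omega := by
    simp only [num_val_pair, num_val_fix]; rfl
  rw [Form.omegaM, realizes_bex, num_val_pair, fst_pair, snd_pair, h, mem_immd_treeM]
  refine ⟨omega_mem_V, realizes_isOmega ?_⟩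
  rw [extend_v_of_eq _ _ _ _ rfl, down_treeM omega_mem_V]

theorem realized_infinity : Realized.{u} Form.infinity :=
  realized_of omegaRealizer fun 𝔐 _ => ⟨𝔐.treeOf 𝔐.omega, isSet_treeOf omega_mem_V,
    realizes_isOmega (extend_v_of_eq _ _ _ _ rfl)⟩

/-! ### Collection -/

section Collection

variable {𝔐 : Henkin.{u}} [hM : Fact 𝔐.IsModelZ2]

/-- `e ⊩ ⟨X, Y⟩ ∈ R`. -/
def RealizesPairMem (X Y R : Set 𝔐.N) (e : 𝔐.N) : Prop :=
  𝔐.Realizes (Form.pairMem (0 : Fin 3) 1 2) ![X, Y, R] e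

theorem rename_pairMem {n m : ℕ} (f : Fin n → Fin m) (x y r : Fin n) :
    (Form.pairMem x y r).rename f = Form.pairMem (f x) (f y) (f r) := by
  simp only [Form.pairMem, Form.isOrdPair, Form.isPair, Form.rename, extend_last, extend_castSucc]

theorem realizes_pairMem {n : ℕ} {x y r : Fin n} {ρ : Fin n → Set 𝔐.N} {e : 𝔐.N} :
    𝔐.Realizes (Form.pairMem x y r) ρ e ↔ RealizesPairMem (ρ x) (ρ y) (ρ r) e := by
  have : Form.pairMem x y r = (Form.pairMem (0 : Fin 3) 1 2).rename ![x, y, r] := by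
    rw [rename_pairMem]; rfl
  rw [this, realizes_rename, RealizesPairMem]
  refine iff_of_eq (congrArg (fun ρ => 𝔐.Realizes _ ρ e) (funext fun i => ?_))
  fin_cases i <;> rfl

theorem realizes_multi {n : ℕ} {r a b : Fin n} {ρ : Fin n → Set 𝔐.N} {e : 𝔐.N} :
    𝔐.Realizes (Form.multi r a b) ρ e ↔ ∀ x ∈ 𝔐.immd (ρ a), ∃ y, 𝔐.App e x y ∧
      fst y ∈ 𝔐.immd (ρ b) ∧
      RealizesPairMem (𝔐.down (ρ a) x) (𝔐.down (ρ b) (fst y)) (ρ r) (snd y) := by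
  simp only [Form.multi, realizes_ball, realizes_bex, realizes_pairMem, extend_last,
    extend_castSucc]

/-- If `b` has the same indices as `a`, and index `x` of `b` carries the image of index `x` of `a`,
then one program realizes both halves. Realizers of membership in `R` are passed on without being
inspected. -/
theorem realizes_subimage {n : ℕ} {r a b : Fin n} {ρ : Fin n → Set 𝔐.N} {f c : 𝔐.N}
    (hb : 𝔐.immd (ρ b) = 𝔐.immd (ρ a))
    (hf : ∀ x ∈ 𝔐.immd (ρ a), ∃ y, 𝔐.App f x y ∧
      RealizesPairMem (𝔐.down (ρ a) x) (𝔐.down (ρ b) x) (ρ r) (snd y))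
    (hc : ∀ x y, 𝔐.App f x y → 𝔐.App c x (𝔐.pair x (snd y))) :
    𝔐.Realizes (Form.subimage r a b) ρ (𝔐.pair c c) := by
  simp only [Form.subimage, realizes_multi, realizes_and, realizes_ball, realizes_bex,
    realizes_pairMem, extend_last, extend_castSucc, fst_pair, snd_pair, hb]
  refine ⟨fun x hx => ?_, fun x hx => ?_⟩
  all_goals
    obtain ⟨y, hy, h⟩ := hf x hx
    exact ⟨_, hc x y hy, by simpa only [fst_pair, snd_pair] using And.intro hx h⟩

end Collection

/-- A realizer of the premise computes, for each index of `a`, an index in `M`, which is a code in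
`V`. Hence `b` reuses the index type of `a` with this computation as its function. It is uniform in
`R`, and no choice is involved. -/
theorem realizedAtM_strongCollectionM : RealizedAtM.{u} Form.strongCollectionM := by
  let tC : PTerm := .pair (.var 0) (.snd (.app (.var 1) (.var 0)))
  let tB : PTerm := .fst (.app (.var 1) (.var 0))
  refine realizedAtM_of (.lam (.lam (.pair (supT (domT (.var 1)) (.lam tB))
    (.pair (.lam tC) (.lam tC))))) fun 𝔐 _ => ?_
  simp (disch := omega) only [Form.strongCollectionM, realizes_ball, realizes_all, realizes_imp,
    realizes_bex, realizes_multi, extend_v_of_lt, extend_v_of_eq, mem_immd_treeM]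
  refine fun v hv => exists_app_val ?_
  simp only [wp_domT, wp_fnT, wp_supT, wp_finT, wp_sumT, wp_piT, wp_sigmaT, wp, List.getD_cons_zero,
      List.getD_cons_succ, fst_pair, snd_pair]
  rw [down_treeM hv]
  refine fun R hR f hf => exists_app_clo ?_
  simp only [wp_domT, wp_fnT, wp_supT, wp_finT, wp_sumT, wp_piT, wp_sigmaT, wp, List.getD_cons_zero,
      List.getD_cons_succ, fst_pair, snd_pair]
  have hB : ∀ {x y}, 𝔐.App f x y → 𝔐.App (clo tB [f, v]) x (fst y) := fun {x y} h =>
    app_clo (by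
      simp only [tB]
      simp only [wp_domT, wp_fnT, wp_supT, wp_finT, wp_sumT, wp_piT, wp_sigmaT, wp, List.getD_cons_zero,
      List.getD_cons_succ, fst_pair, snd_pair]
      exact ⟨y, h, rfl⟩)
  have hC : ∀ x y, 𝔐.App f x y → 𝔐.App (clo tC [f, v]) x (𝔐.pair x (snd y)) := fun x y h =>
    app_clo (by
      simp only [tC]
      simp only [wp_domT, wp_fnT, wp_supT, wp_finT, wp_sumT, wp_piT, wp_sigmaT, wp, List.getD_cons_zero,
      List.getD_cons_succ, fst_pair, snd_pair]
      exact ⟨y, h, rfl⟩)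
  have hb : 𝔐.supCode (dom v) (clo tB [f, v]) ∈ 𝔐.V := by
    refine supCode_mem_V (V_cases hv).2.1 fun x hx => ?_
    obtain ⟨y, hy, hy', -⟩ := hf x ((mem_immd_treeOf hv).2 hx)
    exact ⟨_, hB hy, hy'⟩
  refine ⟨hb, realizes_subimage (f := f) ?_ ?_ hC⟩
  all_goals simp (disch := omega) only [extend_v_of_lt, extend_v_of_eq, down_treeM hb]
  · ext x
    rw [mem_immd_treeOf_supCode hb, mem_immd_treeOf hv]
  · intro x hx
    obtain ⟨y, hy, hy', h⟩ := hf x hx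
    refine ⟨y, hy, ?_⟩
    rw [down_treeM hy'] at h
    rwa [down_treeOf_supCode hb ((mem_immd_treeOf hv).1 hx) (hB hy)]

/-- The indices of `c` are the functions `h` from the index type of `a` to that of `b`, a type by
closure under products; at `h` sits the family of the elements of `b` at `h x`. For given `R`, the
relevant `h` is the first projection of the premise's realizer. -/
theorem realizedAtM_subsetCollectionM : RealizedAtM.{u} Form.subsetCollectionM := by
  let tC : PTerm := .pair (.var 0) (.snd (.app (.var 1) (.var 0)))
  let tH : PTerm := .fst (.app (.var 1) (.var 0))
  let tP : PTerm := domT (.var 1)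
  let tE : PTerm := .app (fnT (.var 2)) (.app (.var 1) (.var 0))
  let tD : PTerm := supT (domT (.var 2)) (.lam tE)
  refine realizedAtM_of (.lam (.lam (.pair (supT (piT (domT (.var 1)) (.lam tP)) (.lam tD))
    (.lam (.pair (.lam tH) (.pair (.lam tC) (.lam tC))))))) fun 𝔐 _ => ?_
  simp (disch := omega) only [Form.subsetCollectionM, realizes_ball, realizes_all, realizes_imp,
    realizes_bex, realizes_multi, extend_v_of_lt, extend_v_of_eq, mem_immd_treeM]
  refine fun v hv => exists_app_val ?_
  simp only [wp_domT, wp_fnT, wp_supT, wp_finT, wp_sumT, wp_piT, wp_sigmaT, wp, List.getD_cons_zero,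
      List.getD_cons_succ, fst_pair, snd_pair]
  refine fun w hw => exists_app_clo ?_
  simp only [wp_domT, wp_fnT, wp_supT, wp_finT, wp_sumT, wp_piT, wp_sigmaT, wp, List.getD_cons_zero,
      List.getD_cons_succ, fst_pair, snd_pair]
  rw [down_treeM hv, down_treeM hw]
  obtain ⟨-, hA, -⟩ := V_cases hv
  obtain ⟨-, hB, hg⟩ := V_cases hw
  have hP' : ∀ x, 𝔐.App (clo tP [w, v]) x (dom w) := fun x => app_clo rfl
  have hP : ∀ x ∈ 𝔐.ext (dom v), ∃ B, 𝔐.App (clo tP [w, v]) x B ∧ 𝔐.IsType B := fun x _ =>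
    ⟨dom w, hP' x, hB⟩
  have hPi : ∀ {h}, h ∈ 𝔐.ext (𝔐.piCode (dom v) (clo tP [w, v])) ↔
      ∀ x ∈ 𝔐.ext (dom v), ∃ y, 𝔐.App h x y ∧ y ∈ 𝔐.ext (dom w) := fun {h} => by
    rw [mem_ext_pi hA hP]
    refine forall₂_congr fun x hx => ?_
    exact ⟨fun ⟨B, y, h₁, h₂, h₃⟩ => ⟨y, h₂, by rwa [(hP' x).det h₁]⟩,
      fun ⟨y, h₁, h₂⟩ => ⟨_, y, hP' x, h₁, h₂⟩⟩
  have hE : ∀ {h x y z}, 𝔐.App h x y → 𝔐.App (fn w) y z → 𝔐.App (clo tE [h, w, v]) x z :=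
    fun {h x y z} h₁ h₂ => app_clo (by
      simp only [tE]
      simp only [wp_domT, wp_fnT, wp_supT, wp_finT, wp_sumT, wp_piT, wp_sigmaT, wp, List.getD_cons_zero,
      List.getD_cons_succ, fst_pair, snd_pair]
      exact ⟨y, h₁, z, h₂, rfl⟩)
  have hd : ∀ {h}, h ∈ 𝔐.ext (𝔐.piCode (dom v) (clo tP [w, v])) →
      𝔐.supCode (dom v) (clo tE [h, w, v]) ∈ 𝔐.V := fun {h} hh => by
    refine supCode_mem_V hA fun x hx => ?_
    obtain ⟨y, hy, hy'⟩ := hPi.1 hh x hx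
    obtain ⟨z, hz, hz'⟩ := hg y hy'
    exact ⟨z, hE hy hz, hz'⟩
  have hD : ∀ h, 𝔐.App (clo tD [w, v]) h (𝔐.supCode (dom v) (clo tE [h, w, v])) := fun h =>
    app_clo rfl
  have hc : 𝔐.supCode (𝔐.piCode (dom v) (clo tP [w, v])) (clo tD [w, v]) ∈ 𝔐.V :=
    supCode_mem_V (isType_pi hA hP) fun h hh => ⟨_, hD h, hd hh⟩
  rw [down_treeM hc]
  refine ⟨hc, fun R hR f hf => exists_app_clo ?_⟩
  simp only [wp_domT, wp_fnT, wp_supT, wp_finT, wp_sumT, wp_piT, wp_sigmaT, wp, List.getD_cons_zero,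
      List.getD_cons_succ, fst_pair, snd_pair]
  have hH : ∀ {x y}, 𝔐.App f x y → 𝔐.App (clo tH [f, w, v]) x (fst y) := fun {x y} h =>
    app_clo (by
      simp only [tH]
      simp only [wp_domT, wp_fnT, wp_supT, wp_finT, wp_sumT, wp_piT, wp_sigmaT, wp, List.getD_cons_zero,
      List.getD_cons_succ, fst_pair, snd_pair]
      exact ⟨y, h, rfl⟩)
  have hC : ∀ x y, 𝔐.App f x y → 𝔐.App (clo tC [f, w, v]) x (𝔐.pair x (snd y)) := fun x y h =>
    app_clo (by
      simp only [tC]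
      simp only [wp_domT, wp_fnT, wp_supT, wp_finT, wp_sumT, wp_piT, wp_sigmaT, wp, List.getD_cons_zero,
      List.getD_cons_succ, fst_pair, snd_pair]
      exact ⟨y, h, rfl⟩)
  have hh : clo tH [f, w, v] ∈ 𝔐.ext (𝔐.piCode (dom v) (clo tP [w, v])) := hPi.2 fun x hx => by
    obtain ⟨y, hy, hy', -⟩ := hf x ((mem_immd_treeOf hv).2 hx)
    exact ⟨_, hH hy, (mem_immd_treeOf hw).1 hy'⟩
  refine ⟨(mem_immd_treeOf_supCode hc).2 hh,
    realizes_subimage (f := f) ?_ ?_ hC⟩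
  all_goals simp (disch := omega) only [extend_v_of_lt, extend_v_of_eq,
    down_treeOf_supCode hc hh (hD _)]
  · ext x
    rw [mem_immd_treeOf_supCode (hd hh), mem_immd_treeOf hv]
  · intro x hx
    obtain ⟨y, hy, hy', h⟩ := hf x hx
    refine ⟨y, hy, ?_⟩
    obtain ⟨z, hz, hz', hz''⟩ := V_step hw hy'
    rw [hz''] at h
    rwa [down_treeOf_supCode (hd hh) ((mem_immd_treeOf hv).1 hx) (hE (hH hy) hz)]

end Henkin

namespace Henkin

open PTerm

/-! ### Bounded formulas as types -/

section Model

variable {𝔐 : Henkin.{u}} [hM : Fact 𝔐.IsModelZ2]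

/-- `τ` is a type whose elements are the numbers with the property `P`. -/
def IsTypeOf (τ : 𝔐.N) (P : 𝔐.N → Prop) : Prop := 𝔐.IsType τ ∧ ∀ e, e ∈ 𝔐.ext τ ↔ P e

theorem isTypeOf_empty : IsTypeOf (𝔐.finCode (𝔐.num 0)) fun _ => False :=
  ⟨isType_fin, fun e => iff_of_false (fun h => hM.out.not_lt_zero e (mem_ext_fin.1 h)) id⟩

theorem isTypeOf_sum {A B : 𝔐.N} {P Q : 𝔐.N → Prop} (hA : IsTypeOf A P) (hB : IsTypeOf B Q) :
    IsTypeOf (𝔐.sumCode A B) fun e =>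
      (fst e = 𝔐.num 0 ∧ P (snd e)) ∨ (fst e = 𝔐.num 1 ∧ Q (snd e)) :=
  ⟨isType_sum hA.1 hB.1, fun e => by rw [mem_ext_sum hA.1 hB.1, hA.2, hB.2]⟩

theorem isTypeOf_pi {A F : 𝔐.N} {P : 𝔐.N → Prop} {Q : 𝔐.N → 𝔐.N → Prop} (hA : IsTypeOf A P)
    (hF : ∀ x, P x → ∃ B, 𝔐.App F x B ∧ IsTypeOf B (Q x)) :
    IsTypeOf (𝔐.piCode A F) fun e => ∀ x, P x → ∃ y, 𝔐.App e x y ∧ Q x y := by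
  have hF' : ∀ x ∈ 𝔐.ext A, ∃ B, 𝔐.App F x B ∧ 𝔐.IsType B := fun x hx =>
    (hF x ((hA.2 x).1 hx)).imp fun B hB => ⟨hB.1, hB.2.1⟩
  refine ⟨isType_pi hA.1 hF', fun e => ?_⟩
  rw [mem_ext_pi hA.1 hF']
  refine forall_congr' fun x => imp_congr_ctx (hA.2 x) fun hx => ?_
  obtain ⟨B, hB, hB'⟩ := hF x hx
  exact ⟨fun ⟨C, y, h₁, h₂, h₃⟩ => by obtain rfl := hB.det h₁; exact ⟨y, h₂, (hB'.2 _).1 h₃⟩,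
    fun ⟨y, h₁, h₂⟩ => ⟨B, y, hB, h₁, (hB'.2 _).2 h₂⟩⟩

theorem isTypeOf_sigma {A F : 𝔐.N} {P : 𝔐.N → Prop} {Q : 𝔐.N → 𝔐.N → Prop} (hA : IsTypeOf A P)
    (hF : ∀ x, P x → ∃ B, 𝔐.App F x B ∧ IsTypeOf B (Q x)) :
    IsTypeOf (𝔐.sigmaCode A F) fun e => P (fst e) ∧ Q (fst e) (snd e) := by
  have hF' : ∀ x ∈ 𝔐.ext A, ∃ B, 𝔐.App F x B ∧ 𝔐.IsType B := fun x hx =>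
    (hF x ((hA.2 x).1 hx)).imp fun B hB => ⟨hB.1, hB.2.1⟩
  refine ⟨isType_sigma hA.1 hF', fun e => ?_⟩
  rw [mem_ext_sigma hA.1 hF', hA.2]
  refine and_congr_right fun hx => ?_
  obtain ⟨B, hB, hB'⟩ := hF _ hx
  exact ⟨fun ⟨C, h, h'⟩ => by obtain rfl := hB.det h; exact (hB'.2 _).1 h',
    fun h => ⟨B, hB, (hB'.2 _).2 h⟩⟩

theorem isTypeOf_dom {v : 𝔐.N} (hv : v ∈ 𝔐.V) :
    IsTypeOf (dom v) fun a => a ∈ 𝔐.immd (𝔐.treeOf v) :=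
  ⟨(V_cases hv).2.1, fun a => (mem_immd_treeOf hv).symm⟩

theorem IsTypeOf.congr {A : 𝔐.N} {P Q : 𝔐.N → Prop} (h : IsTypeOf A P) (hPQ : ∀ e, P e ↔ Q e) :
    IsTypeOf A Q :=
  ⟨h.1, fun e => (h.2 e).trans (hPQ e)⟩

/-- From `self`, `v`, `w`, the type `∏ a : dom v, ∑ c : dom w, self (fn v a, fn w c)`. -/
def halfEqIdx : ℕ := (PTerm.lam (piT (domT (.fst (.snd (.var 0)))) (.lam
  (sigmaT (domT (.snd (.snd (.var 1)))) (.lam (.app (.fst (.var 2)) (.pair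
    (.app (fnT (.fst (.snd (.var 2)))) (.var 1))
    (.app (fnT (.snd (.snd (.var 2)))) (.var 0))))))))).val

/-- The condition has the form "for every `a` there is a `b` with equal subtrees", hence it is a
product of sums of equality types of children. Their computation is delegated to the given program
`c`. -/
theorem exists_halfEq {c v w : 𝔐.N} (hv : v ∈ 𝔐.V) (hw : w ∈ 𝔐.V)
    (h : ∀ a a' b b', a ∈ 𝔐.ext (dom v) → b ∈ 𝔐.ext (dom w) → 𝔐.App (fn v) a a' →
      𝔐.App (fn w) b b' → ∃ τ, 𝔐.App c (𝔐.pair a' b') τ ∧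
        IsTypeOf τ (𝔐.RealizesEq (𝔐.treeOf a') (𝔐.treeOf b'))) :
    ∃ τ, 𝔐.App (𝔐.num halfEqIdx) (𝔐.pair c (𝔐.pair v w)) τ ∧
      IsTypeOf τ fun e => ∀ a ∈ 𝔐.immd (𝔐.treeOf v), ∃ y, 𝔐.App e a y ∧
        RealizesMem (𝔐.down (𝔐.treeOf v) a) (𝔐.treeOf w) y := by
  refine exists_app_val ?_
  simp only [wp_domT, wp_fnT, wp_supT, wp_finT, wp_sumT, wp_piT, wp_sigmaT, wp, List.getD_cons_zero,
      List.getD_cons_succ, fst_pair, snd_pair]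
  refine isTypeOf_pi (isTypeOf_dom hv) fun a ha => exists_app_clo ?_
  simp only [wp_domT, wp_fnT, wp_supT, wp_finT, wp_sumT, wp_piT, wp_sigmaT, wp, List.getD_cons_zero,
      List.getD_cons_succ, fst_pair, snd_pair]
  obtain ⟨a', haa', ha', hda⟩ := V_step hv ha
  refine isTypeOf_sigma (P := fun b => b ∈ 𝔐.immd (𝔐.treeOf w))
    (Q := fun b => 𝔐.RealizesEq (𝔐.down (𝔐.treeOf v) a) (𝔐.down (𝔐.treeOf w) b))
    (isTypeOf_dom hw) fun b hb => exists_app_clo ?_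
  obtain ⟨b', hbb', hb', hdb⟩ := V_step hw hb
  simp only [wp_domT, wp_fnT, wp_supT, wp_finT, wp_sumT, wp_piT, wp_sigmaT, wp, List.getD_cons_zero,
      List.getD_cons_succ, fst_pair, snd_pair]
  rw [hda, hdb]
  exact ⟨a', haa', b', hbb', h a a' b b' ((mem_immd_treeOf hv).1 ha) ((mem_immd_treeOf hw).1 hb)
    haa' hbb'⟩

def eqTypeBody : PTerm :=
  sigmaT (.app (.num halfEqIdx) (.pair (.var 1) (.var 0))) (.lam (.app (.num halfEqIdx)
    (.pair (.var 2) (.pair (.snd (.var 1)) (.fst (.var 1))))))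

/-- From `v`, `w`, the type of realizers of `𝔱(v) = 𝔱(w)`. -/
def eqTypeIdx : ℕ := (PTerm.fix eqTypeBody).val

/-- `eqTypeIdx` computes the type of realizers of `𝔱(v) = 𝔱(w)`. -/
def EqTypeSpec (v w : 𝔐.N) : Prop := ∃ τ, 𝔐.App (𝔐.num eqTypeIdx) (𝔐.pair v w) τ ∧
  IsTypeOf τ (𝔐.RealizesEq (𝔐.treeOf v) (𝔐.treeOf w))

/-- A realizer of equality is a pair of two inclusions, so its type is a sum with a constant family.
The second inclusion exchanges the codes, so both orders are required for the children. -/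
theorem eqTypeSpec_of_children {v w : 𝔐.N} (hv : v ∈ 𝔐.V) (hw : w ∈ 𝔐.V)
    (h : ∀ a a' b b', a ∈ 𝔐.ext (dom v) → b ∈ 𝔐.ext (dom w) → 𝔐.App (fn v) a a' →
      𝔐.App (fn w) b b' → EqTypeSpec a' b' ∧ EqTypeSpec b' a') : EqTypeSpec v w := by
  obtain ⟨σ, hσ, hσ'⟩ := exists_halfEq hv hw fun a a' b b' h₁ h₂ h₃ h₄ => (h a a' b b' h₁ h₂ h₃ h₄).1
  obtain ⟨τ, hτ, hτ'⟩ := exists_halfEq hw hv fun a a' b b' h₁ h₂ h₃ h₄ => (h b b' a a' h₂ h₁ h₄ h₃).2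
  rw [EqTypeSpec]
  rw [eqTypeIdx, num_val_fix] at *
  refine exists_app_fixv ?_
  rw [eqTypeBody]
  simp only [wp_domT, wp_fnT, wp_supT, wp_finT, wp_sumT, wp_piT, wp_sigmaT, wp, List.getD_cons_zero,
      List.getD_cons_succ, fst_pair, snd_pair]
  refine ⟨σ, hσ, (isTypeOf_sigma (Q := fun _ e => ∀ a ∈ 𝔐.immd (𝔐.treeOf w), ∃ y, 𝔐.App e a y ∧
      RealizesMem (𝔐.down (𝔐.treeOf w) a) (𝔐.treeOf v) y)
    hσ' fun e he => exists_app_clo ?_).congr fun e =>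
    (realizesEq_iff (isSet_treeOf hv).1 (isSet_treeOf hw).1).symm⟩
  simp only [wp_domT, wp_fnT, wp_supT, wp_finT, wp_sumT, wp_piT, wp_sigmaT, wp, List.getD_cons_zero,
      List.getD_cons_succ, fst_pair, snd_pair]
  exact ⟨τ, hτ, hτ'⟩

/-- Induction on `v` only, with `w` arbitrary and both orders proved together, as for transitivity
of equality. -/
theorem eqTypeSpec {v w : 𝔐.N} (hv : v ∈ 𝔐.V) (hw : w ∈ 𝔐.V) : EqTypeSpec v w := by
  refine (V_induct (fun v => ∀ w, w ∈ 𝔐.V → EqTypeSpec v w ∧ EqTypeSpec w v)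
    (by unfold EqTypeSpec IsTypeOf; infer_instance) (fun A f hA hf w hw => ?_) hv w hw).1
  have hv : 𝔐.supCode A f ∈ 𝔐.V :=
    supCode_mem_V hA fun x hx => (hf x hx).imp fun w hw => ⟨hw.1, hw.2.1⟩
  have key : ∀ a a' b b', a ∈ 𝔐.ext (dom (𝔐.supCode A f)) → b ∈ 𝔐.ext (dom w) →
      𝔐.App (fn (𝔐.supCode A f)) a a' → 𝔐.App (fn w) b b' →
      EqTypeSpec a' b' ∧ EqTypeSpec b' a' := fun a a' b b' ha hb haa' hbb' => by
    rw [dom_supCode] at ha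
    rw [fn_supCode] at haa'
    obtain ⟨a₁, ha₁, -, h⟩ := hf a ha
    obtain ⟨b₁, hb₁, hb₁'⟩ := (V_cases hw).2.2 b hb
    obtain rfl := haa'.det ha₁
    obtain rfl := hbb'.det hb₁
    exact h b' hb₁'
  exact ⟨eqTypeSpec_of_children hv hw key, eqTypeSpec_of_children hw hv
    fun a a' b b' h₁ h₂ h₃ h₄ => (key b b' a a' h₂ h₁ h₄ h₃).symm⟩

/-- `g` codes a list of elements of `V` whose trees are `ρ`. -/
def Codes : {n : ℕ} → (Fin n → Set 𝔐.N) → 𝔐.N → Prop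
  | 0, _, _ => True
  | n + 1, ρ, g => (fst g ∈ 𝔐.V ∧ ρ (Fin.last n) = 𝔐.treeOf (fst g)) ∧
      Codes (fun i => ρ i.castSucc) (snd g)

theorem Codes.extend {n : ℕ} {ρ : Fin n → Set 𝔐.N} {g v : 𝔐.N} {X : Set 𝔐.N} (hv : v ∈ 𝔐.V)
    (hX : X = 𝔐.treeOf v) (h : Codes ρ g) : Codes (_root_.extend ρ X) (𝔐.pair v g) := by
  simp only [Codes, fst_pair, snd_pair, extend_last, extend_castSucc]
  exact ⟨⟨hv, hX⟩, h⟩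

end Model

theorem exists_eqType : ∃ s : ℕ, ∀ (𝔐 : Henkin.{u}) [Fact 𝔐.IsModelZ2] {v w : 𝔐.N}, v ∈ 𝔐.V →
    w ∈ 𝔐.V → ∃ τ, 𝔐.App (𝔐.num s) (𝔐.pair v w) τ ∧
      IsTypeOf τ (𝔐.RealizesEq (𝔐.treeOf v) (𝔐.treeOf w)) :=
  ⟨eqTypeIdx, fun _ _ _ _ => eqTypeSpec⟩

theorem exists_codes_proj {n : ℕ} (i : Fin n) : ∃ s : ℕ, ∀ (𝔐 : Henkin.{u}) [Fact 𝔐.IsModelZ2]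
    (ρ : Fin n → Set 𝔐.N) (g : 𝔐.N), Codes ρ g →
    ∃ y, 𝔐.App (𝔐.num s) g y ∧ y ∈ 𝔐.V ∧ ρ i = 𝔐.treeOf y := by
  induction n with
  | zero => exact i.elim0
  | succ n ih =>
    induction i using Fin.lastCases with
    | last =>
      refine ⟨(PTerm.lam (.fst (.var 0))).val, fun 𝔐 _ ρ g h => exists_app_val ?_⟩
      simp only [wp, List.getD_cons_zero, List.getD_cons_succ, fst_pair, snd_pair]
      exact h.1
    | cast i =>
      obtain ⟨s, hs⟩ := ih i
      refine ⟨(PTerm.lam (.app (.num s) (.snd (.var 0)))).val, fun 𝔐 _ ρ g h => exists_app_val ?_⟩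
      simp only [wp, List.getD_cons_zero, List.getD_cons_succ, fst_pair, snd_pair]
      exact hs 𝔐 _ _ h.2

/-- The realizers of a bounded formula with parameters in `V` form a type. -/
theorem exists_typeOf_bounded {n : ℕ} (φ : Form n) (hφ : φ.Bounded) :
    ∃ s : ℕ, ∀ (𝔐 : Henkin.{u}) [Fact 𝔐.IsModelZ2] (ρ : Fin n → Set 𝔐.N) (g : 𝔐.N), Codes ρ g →
    ∃ τ, 𝔐.App (𝔐.num s) g τ ∧ IsTypeOf τ (𝔐.Realizes φ ρ) := by
  obtain ⟨r, hr⟩ := exists_eqType.{u}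
  induction φ with
  | bot =>
    refine ⟨(PTerm.lam (finT (.num 0))).val, fun 𝔐 _ ρ g hg => exists_app_val ?_⟩
    simp only [wp_domT, wp_fnT, wp_supT, wp_finT, wp_sumT, wp_piT, wp_sigmaT, wp, List.getD_cons_zero,
      List.getD_cons_succ, fst_pair, snd_pair]
    exact isTypeOf_empty
  | mem i j =>
    obtain ⟨p, hp⟩ := exists_codes_proj.{u} i
    obtain ⟨q, hq⟩ := exists_codes_proj.{u} j
    refine ⟨(PTerm.lam (sigmaT (domT (.app (.num q) (.var 0))) (.lam (.app (.num r)
      (.pair (.app (.num p) (.var 1)) (.app (fnT (.app (.num q) (.var 1))) (.var 0))))))).val,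
      fun 𝔐 _ ρ g hg => exists_app_val ?_⟩
    obtain ⟨v, hv, hv', hi⟩ := hp 𝔐 ρ g hg
    obtain ⟨w, hw, hw', hj⟩ := hq 𝔐 ρ g hg
    simp only [wp_domT, wp_fnT, wp_supT, wp_finT, wp_sumT, wp_piT, wp_sigmaT, wp, List.getD_cons_zero,
      List.getD_cons_succ, fst_pair, snd_pair]
    refine ⟨w, hw, (isTypeOf_sigma (Q := fun b => 𝔐.RealizesEq (ρ i) (𝔐.down (ρ j) b))
      (isTypeOf_dom hw') fun b hb => exists_app_clo ?_).congr fun e => ?_⟩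
    · obtain ⟨z, hz, hz', h⟩ := V_step hw' hb
      obtain ⟨τ, hτ, hτ'⟩ := hr 𝔐 hv' hz'
      simp only [wp_domT, wp_fnT, wp_supT, wp_finT, wp_sumT, wp_piT, wp_sigmaT, wp, List.getD_cons_zero,
      List.getD_cons_succ, fst_pair, snd_pair]
      exact ⟨v, hv, w, hw, z, hz, τ, hτ, hτ'.congr fun e => by rw [hi, hj, h]⟩
    · rw [realizes_mem, RealizesMem, hj]
  | eq i j =>
    obtain ⟨p, hp⟩ := exists_codes_proj.{u} i
    obtain ⟨q, hq⟩ := exists_codes_proj.{u} j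
    refine ⟨(PTerm.lam (.app (.num r)
      (.pair (.app (.num p) (.var 0)) (.app (.num q) (.var 0))))).val,
      fun 𝔐 _ ρ g hg => exists_app_val ?_⟩
    obtain ⟨v, hv, hv', hi⟩ := hp 𝔐 ρ g hg
    obtain ⟨w, hw, hw', hj⟩ := hq 𝔐 ρ g hg
    simp only [wp_domT, wp_fnT, wp_supT, wp_finT, wp_sumT, wp_piT, wp_sigmaT, wp, List.getD_cons_zero,
      List.getD_cons_succ, fst_pair, snd_pair]
    refine ⟨v, hv, w, hw, ?_⟩
    obtain ⟨τ, hτ, hτ'⟩ := hr 𝔐 hv' hw'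
    exact ⟨τ, hτ, hτ'.congr fun e => by rw [realizes_eq, hi, hj]⟩
  | and φ ψ ihφ ihψ =>
    obtain ⟨p, hp⟩ := ihφ hφ.1
    obtain ⟨q, hq⟩ := ihψ hφ.2
    refine ⟨(PTerm.lam (sigmaT (.app (.num p) (.var 0)) (.lam (.app (.num q) (.var 1))))).val,
      fun 𝔐 _ ρ g hg => exists_app_val ?_⟩
    obtain ⟨σ, hσ, hσ'⟩ := hp 𝔐 ρ g hg
    simp only [wp_domT, wp_fnT, wp_supT, wp_finT, wp_sumT, wp_piT, wp_sigmaT, wp, List.getD_cons_zero,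
      List.getD_cons_succ, fst_pair, snd_pair]
    refine ⟨σ, hσ, (isTypeOf_sigma (Q := fun _ => 𝔐.Realizes ψ ρ) hσ' fun e he =>
      exists_app_clo ?_).congr fun e => realizes_and.symm⟩
    simp only [wp_domT, wp_fnT, wp_supT, wp_finT, wp_sumT, wp_piT, wp_sigmaT, wp, List.getD_cons_zero,
      List.getD_cons_succ, fst_pair, snd_pair]
    exact hq 𝔐 ρ g hg
  | or φ ψ ihφ ihψ =>
    obtain ⟨p, hp⟩ := ihφ hφ.1
    obtain ⟨q, hq⟩ := ihψ hφ.2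
    refine ⟨(PTerm.lam (sumT (.app (.num p) (.var 0)) (.app (.num q) (.var 0)))).val,
      fun 𝔐 _ ρ g hg => exists_app_val ?_⟩
    obtain ⟨σ, hσ, hσ'⟩ := hp 𝔐 ρ g hg
    obtain ⟨τ, hτ, hτ'⟩ := hq 𝔐 ρ g hg
    simp only [wp_domT, wp_fnT, wp_supT, wp_finT, wp_sumT, wp_piT, wp_sigmaT, wp, List.getD_cons_zero,
      List.getD_cons_succ, fst_pair, snd_pair]
    exact ⟨σ, hσ, τ, hτ, (isTypeOf_sum hσ' hτ').congr fun e => realizes_or.symm⟩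
  -- An implication is a product over the type of realizers of the premise, with a constant family.
  | imp φ ψ ihφ ihψ =>
    obtain ⟨p, hp⟩ := ihφ hφ.1
    obtain ⟨q, hq⟩ := ihψ hφ.2
    refine ⟨(PTerm.lam (piT (.app (.num p) (.var 0)) (.lam (.app (.num q) (.var 1))))).val,
      fun 𝔐 _ ρ g hg => exists_app_val ?_⟩
    obtain ⟨σ, hσ, hσ'⟩ := hp 𝔐 ρ g hg
    simp only [wp_domT, wp_fnT, wp_supT, wp_finT, wp_sumT, wp_piT, wp_sigmaT, wp, List.getD_cons_zero,
      List.getD_cons_succ, fst_pair, snd_pair]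
    refine ⟨σ, hσ, (isTypeOf_pi (Q := fun _ => 𝔐.Realizes ψ ρ) hσ' fun e he =>
      exists_app_clo ?_).congr fun e => realizes_imp.symm⟩
    simp only [wp_domT, wp_fnT, wp_supT, wp_finT, wp_sumT, wp_piT, wp_sigmaT, wp, List.getD_cons_zero,
      List.getD_cons_succ, fst_pair, snd_pair]
    exact hq 𝔐 ρ g hg
  | ball i φ ih =>
    obtain ⟨p, hp⟩ := ih hφ
    obtain ⟨q, hq⟩ := exists_codes_proj.{u} i
    refine ⟨(PTerm.lam (piT (domT (.app (.num q) (.var 0))) (.lam (.app (.num p)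
      (.pair (.app (fnT (.app (.num q) (.var 1))) (.var 0)) (.var 1)))))).val,
      fun 𝔐 _ ρ g hg => exists_app_val ?_⟩
    obtain ⟨v, hv, hv', hi⟩ := hq 𝔐 ρ g hg
    simp only [wp_domT, wp_fnT, wp_supT, wp_finT, wp_sumT, wp_piT, wp_sigmaT, wp, List.getD_cons_zero,
      List.getD_cons_succ, fst_pair, snd_pair]
    refine ⟨v, hv, (isTypeOf_pi
      (Q := fun a => 𝔐.Realizes φ (extend ρ (𝔐.down (ρ i) a)))
      (isTypeOf_dom hv') fun a ha => exists_app_clo ?_).congr fun e => ?_⟩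
    -- The subtree at an index is again the tree of a code in `V`, and this code is computable; it
    -- is pushed onto the list of codes for the formula under the quantifier.
    · obtain ⟨w, hw, hw', h⟩ := V_step hv' ha
      simp only [wp_domT, wp_fnT, wp_supT, wp_finT, wp_sumT, wp_piT, wp_sigmaT, wp, List.getD_cons_zero,
      List.getD_cons_succ, fst_pair, snd_pair]
      exact ⟨v, hv, w, hw, hp 𝔐 _ _ (hg.extend hw' (by rw [hi, h]))⟩
    · rw [realizes_ball, hi]
  | bex i φ ih =>
    obtain ⟨p, hp⟩ := ih hφ
    obtain ⟨q, hq⟩ := exists_codes_proj.{u} i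
    refine ⟨(PTerm.lam (sigmaT (domT (.app (.num q) (.var 0))) (.lam (.app (.num p)
      (.pair (.app (fnT (.app (.num q) (.var 1))) (.var 0)) (.var 1)))))).val,
      fun 𝔐 _ ρ g hg => exists_app_val ?_⟩
    obtain ⟨v, hv, hv', hi⟩ := hq 𝔐 ρ g hg
    simp only [wp_domT, wp_fnT, wp_supT, wp_finT, wp_sumT, wp_piT, wp_sigmaT, wp, List.getD_cons_zero,
      List.getD_cons_succ, fst_pair, snd_pair]
    refine ⟨v, hv, (isTypeOf_sigma
      (Q := fun a => 𝔐.Realizes φ (extend ρ (𝔐.down (ρ i) a)))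
      (isTypeOf_dom hv') fun a ha => exists_app_clo ?_).congr fun e => ?_⟩
    · obtain ⟨w, hw, hw', h⟩ := V_step hv' ha
      simp only [wp_domT, wp_fnT, wp_supT, wp_finT, wp_sumT, wp_piT, wp_sigmaT, wp, List.getD_cons_zero,
      List.getD_cons_succ, fst_pair, snd_pair]
      exact ⟨v, hv, w, hw, hp 𝔐 _ _ (hg.extend hw' (by rw [hi, h]))⟩
    · rw [realizes_bex, hi]
  | all φ ih => exact hφ.elim
  | ex φ ih => exact hφ.elim

/-! ### Bounded Separation -/

theorem extend_succ {α : Type*} {n : ℕ} (ρ : Fin (n + 1) → α) (x : α) :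
    (fun i : Fin (n + 1) => extend ρ x i.succ) = extend (fun i => ρ i.succ) x := by
  symm
  rw [extend_eq_iff]
  exact ⟨fun i => (extend_castSucc ρ x i.succ).symm, (extend_last ρ x).symm⟩

/-- The indices of `M` are codes in `V`, so a prefix of quantifiers bounded by `M` hands over the
codes of its variables one at a time; the realizer gathers them in a list. Variable 0 is `M` and has
no code, whence the shift by `succ`. -/
theorem realizedAtM_ballsM {k : ℕ} (χ : Form (k + 2)) (h : ∃ s : ℕ, ∀ (𝔐 : Henkin.{u})
    [Fact 𝔐.IsModelZ2] (ρ : Fin (k + 2) → Set 𝔐.N) (g : 𝔐.N), ρ 0 = 𝔐.treeM →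
    Codes (fun i : Fin (k + 1) => ρ i.succ) g → ∃ y, 𝔐.App (𝔐.num s) g y ∧ 𝔐.Realizes χ ρ y) :
    RealizedAtM.{u} (Form.ballsM k (.ball (Form.v 0) χ)) := by
  induction k with
  | zero =>
    obtain ⟨s, hs⟩ := h
    refine realizedAtM_of (.lam (.app (.num s) (.pair (.var 0) (.num 0)))) fun 𝔐 _ v hv =>
      exists_app_val ?_
    rw [mem_immd_treeM] at hv
    simp only [wp, List.getD_cons_zero, List.getD_cons_succ, fst_pair, snd_pair]
    refine hs 𝔐 _ _ rfl ?_
    rw [extend_succ]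
    exact .extend hv (down_treeM hv) trivial
  | succ k ih =>
    obtain ⟨s, hs⟩ := h
    refine ih _ ⟨(PTerm.lam (.lam (.app (.num s) (.pair (.var 0) (.var 1))))).val,
      fun 𝔐 _ ρ g h0 hg => exists_app_val ?_⟩
    simp only [wp, List.getD_cons_zero, List.getD_cons_succ, fst_pair, snd_pair]
    have h0' : ρ (Form.v 0) = 𝔐.treeM := h0
    rw [realizes_ball, h0']
    refine fun v hv => exists_app_clo ?_
    rw [mem_immd_treeM] at hv
    simp only [wp, List.getD_cons_zero, List.getD_cons_succ, fst_pair, snd_pair]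
    refine hs 𝔐 _ _ ((extend_castSucc ρ _ 0).trans h0) ?_
    rw [extend_succ]
    exact .extend hv (down_treeM hv) hg

/-- As for full Separation, the index is a pair of an index of `a` and a realizer of `φ`. These
pairs now form a sum type, because the realizers of a bounded formula do, so the subset is again in
`M`. -/
theorem realizedAtM_separationM {k : ℕ} (φ : Form (k + 1)) (hφ : φ.Bounded) :
    RealizedAtM.{u} (Form.separationM φ) := by
  obtain ⟨s, hs⟩ := exists_typeOf_bounded.{u} φ hφ
  let tF : PTerm := .app (.num s) (.pair (.app (fnT (.fst (.var 1))) (.var 0)) (.snd (.var 1)))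
  let tG : PTerm := .app (fnT (.fst (.var 1))) (.fst (.var 0))
  refine realizedAtM_ballsM _ ⟨(PTerm.lam (.pair
    (supT (sigmaT (domT (.fst (.var 0))) (.lam tF)) (.lam tG))
    (.pair (.lam (.pair (.pair (.fst (.var 0)) (.num reflIdx)) (.snd (.var 0))))
      (.lam (.lam (.pair (.pair (.var 1) (.var 0)) (.num reflIdx))))))).val,
    fun 𝔐 _ ρ g h0 hg => exists_app_val ?_⟩
  obtain ⟨⟨hv, ha⟩, hg⟩ := hg
  set v := fst g with hvdef
  have h0' : ρ (Form.v 0) = 𝔐.treeM := h0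
  have ha' : ρ (Form.v (k + 1)) = 𝔐.treeOf v := ha
  -- In the context of the axiom, `M` occupies variable 0, so the parameter `i` of `φ` is variable
  -- `i + 1`; neither `a` nor `b` occurs in `φ`.
  have hφx : ∀ {B X : Set 𝔐.N} {e : 𝔐.N}, 𝔐.Realizes
      (φ.rename (Fin.append (fun i : Fin k => Form.v (i + 1)) ![Form.v (k + 3)]))
      (extend (extend ρ B) X) e ↔
      𝔐.Realizes φ (extend (fun i : Fin k => ρ i.castSucc.succ) X) e := fun {B X e} => by
    have : (![Form.v (k + 3)] : Fin 1 → Fin (k + 4)) = extend Fin.elim0 (Form.v (k + 3)) := by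
      funext i; fin_cases i; rfl
    rw [realizes_rename, this, append_extend, comp_extend, Fin.append_elim0]
    have h₁ : ∀ i : Fin k, extend (extend ρ B) X (Form.v (i + 1)) = ρ i.castSucc.succ := fun i => by
      rw [extend_v_of_lt _ _ _ _ (by omega), extend_v_of_lt _ _ _ _ (by omega)]
      rfl
    rw [extend_v_of_eq _ _ _ _ rfl]
    exact iff_of_eq (congrArg (fun ρ => 𝔐.Realizes φ (extend ρ X) e) (funext h₁))
  simp only [wp_domT, wp_fnT, wp_supT, wp_finT, wp_sumT, wp_piT, wp_sigmaT, wp, List.getD_cons_zero,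
      List.getD_cons_succ, fst_pair, snd_pair]
  simp (disch := omega) only [realizes_bex, realizes_and, realizes_ball, realizes_imp, realizes_mem,
    hφx, extend_v_of_lt, extend_v_of_eq, h0', ha', mem_immd_treeM, fst_pair, snd_pair]
  have hF : ∀ x, x ∈ 𝔐.immd (𝔐.treeOf v) → ∃ τ, 𝔐.App (clo tF [g]) x τ ∧ IsTypeOf τ (𝔐.Realizes φ
      (extend (fun i : Fin k => ρ i.castSucc.succ) (𝔐.down (𝔐.treeOf v) x))) := fun x hx => by
    refine exists_app_clo ?_
    obtain ⟨w, hw, hw', h⟩ := V_step hv hx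
    simp only [tF]
    simp only [wp_domT, wp_fnT, wp_supT, wp_finT, wp_sumT, wp_piT, wp_sigmaT, wp, List.getD_cons_zero,
      List.getD_cons_succ, fst_pair, snd_pair]
    exact ⟨w, hw, hs 𝔐 _ _ (.extend hw' h hg)⟩
  have hS := isTypeOf_sigma (isTypeOf_dom hv) hF
  have hG : ∀ {p w}, 𝔐.App (fn v) (fst p) w → 𝔐.App (clo tG [g]) p w := fun {p w} h =>
    app_clo (by
      simp only [tG]
      simp only [wp_domT, wp_fnT, wp_supT, wp_finT, wp_sumT, wp_piT, wp_sigmaT, wp, List.getD_cons_zero,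
      List.getD_cons_succ, fst_pair, snd_pair]
      exact ⟨w, h, rfl⟩)
  have hb : 𝔐.supCode (𝔐.sigmaCode (dom v) (clo tF [g])) (clo tG [g]) ∈ 𝔐.V := by
    refine supCode_mem_V hS.1 fun p hp => ?_
    obtain ⟨w, hw, hw', -⟩ := V_step hv ((hS.2 p).1 hp).1
    exact ⟨w, hG hw, hw'⟩
  have hdown : ∀ {p}, p ∈ 𝔐.ext (𝔐.sigmaCode (dom v) (clo tF [g])) →
      𝔐.down (𝔐.treeOf (𝔐.supCode (𝔐.sigmaCode (dom v) (clo tF [g])) (clo tG [g]))) p =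
        𝔐.down (𝔐.treeOf v) (fst p) := fun {p} hp => by
    obtain ⟨w, hw, hw', h⟩ := V_step hv ((hS.2 p).1 hp).1
    rw [down_treeOf_supCode hb hp (hG hw), h]
  rw [down_treeM hb]
  refine ⟨hb, fun p hp => exists_app_clo ?_, fun x hx => exists_app_clo ?_⟩
  · rw [mem_immd_treeOf_supCode hb] at hp
    rw [hdown hp]
    simp only [wp_domT, wp_fnT, wp_supT, wp_finT, wp_sumT, wp_piT, wp_sigmaT, wp, List.getD_cons_zero,
      List.getD_cons_succ, fst_pair, snd_pair]
    exact ⟨realizesMem_down (isSet_treeOf hv) ((hS.2 p).1 hp).1, ((hS.2 p).1 hp).2⟩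
  · simp only [wp_domT, wp_fnT, wp_supT, wp_finT, wp_sumT, wp_piT, wp_sigmaT, wp, List.getD_cons_zero,
      List.getD_cons_succ, fst_pair, snd_pair]
    refine fun e he => exists_app_clo ?_
    simp only [wp_domT, wp_fnT, wp_supT, wp_finT, wp_sumT, wp_piT, wp_sigmaT, wp, List.getD_cons_zero,
      List.getD_cons_succ, fst_pair, snd_pair]
    have hp : 𝔐.pair x e ∈ 𝔐.ext (𝔐.sigmaCode (dom v) (clo tF [g])) :=
      (hS.2 _).2 (by simpa only [fst_pair, snd_pair] using And.intro hx he)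
    exact realizesMem_of_eq (isSet_treeOf hb) ((mem_immd_treeOf_supCode hb).2 hp)
      (by rw [hdown hp, fst_pair])

/-! ### The theory `T` -/

theorem realizedAtM_and {φ ψ : Form 1} (hφ : RealizedAtM.{u} φ) (hψ : RealizedAtM.{u} ψ) :
    RealizedAtM.{u} (φ.and ψ) := by
  obtain ⟨e, he⟩ := hφ
  obtain ⟨f, hf⟩ := hψ
  refine ⟨Nat.pair e f, fun 𝔐 hM => ?_⟩
  have : Fact 𝔐.IsModelZ2 := ⟨hM⟩
  rw [num_pair]
  exact ⟨_, _, rfl, he 𝔐 hM, hf 𝔐 hM⟩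

theorem realizedAtM_modelM (L : List (Σ k : ℕ, Form (k + 1))) (hL : ∀ φ ∈ L, φ.2.Bounded) :
    RealizedAtM.{u} (Form.modelM L) := by
  refine realizedAtM_and realizedAtM_transitiveM
    (realizedAtM_and realizedAtM_unionM (realizedAtM_and realizedAtM_omegaM ?_))
  induction L with
  | nil => exact realizedAtM_and realizedAtM_strongCollectionM realizedAtM_subsetCollectionM
  | cons φ L ih =>
    exact realizedAtM_and (realizedAtM_separationM φ.2 (hL φ (by simp)))
      (ih fun ψ hψ => hL ψ (List.mem_cons_of_mem _ hψ))

theorem realized_theoryT {φ : Form 0} (h : Form.TheoryT φ) : Realized.{u} φ := by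
  cases h with
  | extensionality => exact realized_extensionality
  | pairing => exact realized_pairing
  | union => exact realized_union
  | infinity => exact realized_infinity
  | setInduction φ => exact realized_setInduction φ
  | separation φ => exact realized_separation φ
  | strongCollection φ => exact realized_strongCollection φ
  | subsetCollection φ => exact realized_subsetCollection φ
  | exists_M L hL =>
    obtain ⟨e, he⟩ := realizedAtM_modelM.{u} L hL
    refine ⟨e, fun 𝔐 hM => ?_⟩
    have : Fact 𝔐.IsModelZ2 := ⟨hM⟩
    refine ⟨𝔐.treeM, isSet_treeM 𝔐, ?_⟩
    rw [show extend Fin.elim0 𝔐.treeM = fun _ => 𝔐.treeM from funext fun i =>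
      Fin.lastCases (extend_last _ _) (fun j => j.elim0) i]
    exact he 𝔐 hM

end Henkin

/-! ### The theorem assembled from its parts. -/

theorem mainTheorem4 :
    (∀ 𝔐 : Henkin.{u}, 𝔐.IsModelZ2 → 𝔐.IsSet 𝔐.treeM) ∧
    RealizedAtM.{u} Form.transitiveM ∧
    RealizedAtM.{u} Form.unionM ∧
    (∀ {k : ℕ} (φ : Form (k + 1)), φ.Bounded → RealizedAtM.{u} (Form.separationM φ)) ∧
    RealizedAtM.{u} Form.omegaM ∧
    RealizedAtM.{u} Form.strongCollectionM ∧
    RealizedAtM.{u} Form.subsetCollectionM ∧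
    (∀ φ : Form 0, Form.TheoryT φ → Realized.{u} φ) ∧
    RealizabilityInterprets.{u} Form.TheoryT := by
  refine ⟨fun 𝔐 hM => ?_, Henkin.realizedAtM_transitiveM, Henkin.realizedAtM_unionM,
    Henkin.realizedAtM_separationM, Henkin.realizedAtM_omegaM,
    Henkin.realizedAtM_strongCollectionM, Henkin.realizedAtM_subsetCollectionM,
    fun φ => Henkin.realized_theoryT,
    Henkin.realizabilityInterprets fun φ => Henkin.realized_theoryT⟩
  have : Fact 𝔐.IsModelZ2 := ⟨hM⟩
  exact Henkin.isSet_treeM 𝔐
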